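/- **Setting.** Let $S\in\mathbb{R}^{n\times d}$ have rows $s_1,\dots,s_n$ with $\min_i\|s_i\|=1$, and put $\eta(S)=\max_i\|s_i\|^2/\min_i\|s_i\|^2$. Write $|s_i\rangle=\|s_i\|^{-1}\sum_j s_{ij}|j\rangle$. For a threshold $d_{\min}>0$ the adjacency bit is $a_{pq}=1$ if $p\neq q$ and $\|s_p-s_q\|\le d_{\min}$, and $a_{pq}=0$ otherwise. *Quantum access to $S$ in time $T_S$ with norm precision $\kappa$* means two black-box unitaries that perform, for every $i$, $$|i\rangle|0\rangle\mapsto|i\rangle|s_i\rangle,\qquad |i\rangle|0\rangle\mapsto|i\rangle|\overline{\|s_i\|}\rangle .$$ Here $\overline{\|s_i\|}$ is a fixed-point binary number with $\big|\overline{\|s_i\|}-\|s_i\|\big|\le\kappa$ ($\kappa=0$ if the norms are written exactly), index registers hold $\lceil\log_2 n\rceil$ and $\lceil\log_2 d\rceil$ qubits, and each unitary may use workspace qubits that it returns to $|0\rangle$. A call to either unitary or its inverse, possibly controlled by one qubit, takes time $T_S$, and $T_S$ is at least the number of qubits that either unitary acts on. Every other unitary gate on at most two qubits takes time $1$. The running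 time of a circuit is the sum of the times of its operations. A pair $(p,q)$ is *resolved at precision $\epsilon$* if every real $t$ with $\big|t-\|s_p-s_q\|^2\big|\le\epsilon$ satisfies $t\le d_{\min}^2\iff\|s_p-s_q\|^2\le d_{\min}^2$, i.e. if comparing any $\epsilon$-precise estimate of the squared distance with $d_{\min}^2$ gives the correct answer. **Theorem (Quantum algorithm for data point similarity).** There is a universal constant $C>0$ such that the following holds. Let $n,d\in\mathbb{N}$, fix the sizes of the registers of the access unitaries, and let $d_{\min}>0$, $0<\epsilon_{dist}\le\eta$ and $0<\delta\le1$. Then there is a quantum circuit with calls to the access unitaries, depending only on these parameters and on neither $S$ nor the access unitaries, such that for every $S\in\mathbb{R}^{n\times d}$ with $\min_i\|s_i\|=1$ and $\eta(S)\le\eta$, and for every quantum access to $S$ in time $T_S$ with norm precision $\kappa$ where $16\,\kappa\sqrt{\eta}\le\epsilon_{dist}$: 1. the running time of the circuit is at most $C\,T_S\,\dfrac{\eta}{\epsilon_{dist}}\,\log\dfrac{2}{\delta}$; in particular it is $O(T_S\,\eta(S)/\epsilon_{dist})$ for every fixed accuracy $\delta$, on taking $\eta=\eta(S)$; 2. for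 all indices $p,q$ the circuit maps $|p\rangle|q\rangle|0\rangle|0\cdots0\rangle$ exactly to a state of the form $|p\rangle|q\rangle|\varphi_{pq}\rangle$, and if $p=q$ or $(p,q)$ is resolved at precision $\epsilon_{dist}$, then $\big\|\,|\varphi_{pq}\rangle-|a_{pq}\rangle|0\cdots0\rangle\,\big\|\le\delta$. So, up to accuracy $\delta$, the circuit performs $|p\rangle|q\rangle|0\rangle\mapsto|p\rangle|q\rangle|a_{pq}\rangle$ whenever the distance precision $\epsilon_{dist}$ determines $a_{pq}$. -/

import Mathlib

open scoped Matrix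

noncomputable section

namespace QSim

/-! ### Qubit registers and pure states -/

/-- Computational basis labels of a register of `N` qubits. -/
abbrev Bits (N : ℕ) : Type := Fin N → Bool

/-- State vectors of `N` qubits, with the `ℓ²` norm. -/
abbrev QState (N : ℕ) : Type := EuclideanSpace ℂ (Bits N)

/-- The basis state `|x⟩`. -/
def ket {N : ℕ} (x : Bits N) : QState N := EuclideanSpace.single x 1

/-- The state `|0…0⟩`. -/
def zeroKet (N : ℕ) : QState N := ket fun _ => false

/-- The tensor product `|φ⟩|ψ⟩` of the states of two registers. -/
def tensor {M N : ℕ} (φ : QState M) (ψ : QState N) : QState (M + N) :=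
  WithLp.toLp 2 fun x => φ (fun i => x (Fin.castAdd N i)) * ψ (fun j => x (Fin.natAdd M j))

/-- The last `N` binary digits of `v`, the least significant digit first. -/
def natBits (N v : ℕ) : Bits N := fun t => v.testBit t

/-- The natural number with the binary digits `x`. -/
def bitsVal {N : ℕ} (x : Bits N) : ℕ := ∑ t, if x t then 2 ^ (t : ℕ) else 0

/-- The number of qubits of a register that holds an index from a set of `n` indices. -/
def idxWidth (n : ℕ) : ℕ := Nat.clog 2 n

/-- The basis state `|i⟩` of an index register. -/
def idxKet {n : ℕ} (i : Fin n) : QState (idxWidth n) := ket (natBits (idxWidth n) i)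

/-! ### Oracle circuits and their running time -/

/-- The state `V|ψ⟩`. -/
def act {N : ℕ} (V : Matrix (Bits N) (Bits N) ℂ) (ψ : QState N) : QState N :=
  WithLp.toLp 2 (V *ᵥ WithLp.ofLp ψ)

/-- The operator `V` acting on the wires `e 0, e 1, …` of an `N`-qubit system, tensored with the
identity on all other wires. -/
def onWires {k N : ℕ} (e : Fin k ↪ Fin N) (V : Matrix (Bits k) (Bits k) ℂ) :
    Matrix (Bits N) (Bits N) ℂ :=
  Matrix.of fun x y =>
    if ∀ i, (∀ j, e j ≠ i) → x i = y i then V (fun j => x (e j)) (fun j => y (e j)) else 0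

/-- The controlled version of `V`; the control qubit is qubit `0`. -/
def controlled {k : ℕ} (V : Matrix (Bits k) (Bits k) ℂ) :
    Matrix (Bits (k + 1)) (Bits (k + 1)) ℂ :=
  Matrix.of fun x y =>
    if x 0 = y 0 then
      (if x 0 then V (Fin.tail x) (Fin.tail y) else if Fin.tail x = Fin.tail y then 1 else 0)
    else 0

/-- `V` or its inverse `V†`. -/
def maybeDagger {k : ℕ} (dagger : Bool) (V : Matrix (Bits k) (Bits k) ℂ) :
    Matrix (Bits k) (Bits k) ℂ :=
  if dagger then Vᴴ else V

/-- The operations of a quantum algorithm on `N` qubits that has access to black-box unitaries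
`o : ι`, the unitary `o` acting on `w o` qubits: elementary gates (arbitrary unitaries on at most
two qubits), and calls to a black box or to its inverse, plain or controlled by a qubit. -/
inductive Gate {ι : Type} (w : ι → ℕ) (N : ℕ) : Type
  | elem (k : ℕ) (hk : k ≤ 2) (e : Fin k ↪ Fin N) (V : Matrix.unitaryGroup (Bits k) ℂ) : Gate w N
  | query (o : ι) (dagger : Bool) (e : Fin (w o) ↪ Fin N) : Gate w N
  | ctrlQuery (o : ι) (dagger : Bool) (e : Fin (w o + 1) ↪ Fin N) : Gate w N

/-- A family of black-box unitaries of the prescribed widths. -/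
abbrev Oracles {ι : Type} (w : ι → ℕ) : Type := ∀ o : ι, Matrix.unitaryGroup (Bits (w o)) ℂ

/-- The operator performed by one operation. -/
def Gate.toMatrix {ι : Type} {w : ι → ℕ} {N : ℕ} (O : Oracles w) :
    Gate w N → Matrix (Bits N) (Bits N) ℂ
  | .elem _ _ e V => onWires e V.1
  | .query o dagger e => onWires e (maybeDagger dagger (O o).1)
  | .ctrlQuery o dagger e => onWires e (controlled (maybeDagger dagger (O o).1))

/-- The time of one operation, if each black box takes time `T`. -/
def Gate.time {ι : Type} {w : ι → ℕ} {N : ℕ} (T : ℝ) : Gate w N → ℝ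
  | .elem _ _ _ _ => 1
  | .query _ _ _ => T
  | .ctrlQuery _ _ _ => T

/-- An oracle circuit: a list of operations, the first one in the list being performed first. It
is a fixed list, which cannot depend on the black boxes. -/
abbrev Circuit {ι : Type} (w : ι → ℕ) (N : ℕ) : Type := List (Gate w N)

/-- The operator performed by a circuit. -/
def Circuit.toMatrix {ι : Type} {w : ι → ℕ} {N : ℕ} (O : Oracles w) :
    Circuit w N → Matrix (Bits N) (Bits N) ℂ
  | [] => 1
  | g :: c => Circuit.toMatrix O c * g.toMatrix O

/-- The state that a circuit produces from the state `ψ`. -/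
def Circuit.run {ι : Type} {w : ι → ℕ} {N : ℕ} (O : Oracles w) (c : Circuit w N)
    (ψ : QState N) : QState N :=
  act (Circuit.toMatrix O c) ψ

/-- The running time of a circuit, if each black box takes time `T`. -/
def Circuit.time {ι : Type} {w : ι → ℕ} {N : ℕ} (T : ℝ) (c : Circuit w N) : ℝ :=
  (List.map (Gate.time T) c).sum

/-! ### Data matrices -/

/-- The `i`-th data point `s_i`, a vector of `ℝᵈ` with the Euclidean norm. -/
def row {n d : ℕ} (S : Matrix (Fin n) (Fin d) ℝ) (i : Fin n) : EuclideanSpace ℝ (Fin d) :=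
  WithLp.toLp 2 (S i)

/-- The data parameter `η(S) = max_i ‖s_i‖² / min_i ‖s_i‖²`. -/
def eta {n d : ℕ} (S : Matrix (Fin n) (Fin d) ℝ) : ℝ :=
  (⨆ i, ‖row S i‖ ^ 2) / (⨅ i, ‖row S i‖ ^ 2)

/-- The edge value `a_{pq}` of the data graph: `1` if `p ≠ q` and `d(s_p, s_q) ≤ d_min`. -/
def adjacencyBit {n d : ℕ} (S : Matrix (Fin n) (Fin d) ℝ) (dmin : ℝ) (p q : Fin n) : Bool :=
  decide (p ≠ q ∧ dist (row S p) (row S q) ≤ dmin)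

/-- Comparing an estimate `t` of the squared distance of `s_p` and `s_q` with `d_min²` gives the
same answer as the exact squared distance, for every estimate of precision `ε`. -/
def Resolved {n d : ℕ} (S : Matrix (Fin n) (Fin d) ℝ) (dmin ε : ℝ) (p q : Fin n) : Prop :=
  ∀ t : ℝ, |t - dist (row S p) (row S q) ^ 2| ≤ ε →
    (t ≤ dmin ^ 2 ↔ dist (row S p) (row S q) ^ 2 ≤ dmin ^ 2)

/-- The amplitude encoding `|s_i⟩ = ‖s_i‖⁻¹ ∑_j s_{ij} |j⟩`. -/
def rowState {n d : ℕ} (S : Matrix (Fin n) (Fin d) ℝ) (i : Fin n) : QState (idxWidth d) :=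
  ∑ j : Fin d, ((S i j / ‖row S i‖ : ℝ) : ℂ) • idxKet j

/-! ### Quantum access -/

/-- The sizes of the registers of an access procedure: the workspace of the two unitaries, and the
number of binary digits, and of fractional binary digits, in which norms are written. -/
structure AccessLayout where
  rowWork : ℕ
  normWork : ℕ
  normBits : ℕ
  normFrac : ℕ

/-- The two unitaries of an access procedure. -/
inductive AccessKind
  | row
  | norm

/-- The number of qubits of the two unitaries of an access procedure. -/
abbrev AccessLayout.width (L : AccessLayout) (n d : ℕ) : AccessKind → ℕ
  | .row => idxWidth n + idxWidth d + L.rowWork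
  | .norm => idxWidth n + L.normBits + L.normWork

/-- Quantum access in time `T` to the matrix `S`, the norms of the rows being written with
precision `κ`: the black boxes perform `|i⟩|0⟩ ↦ |i⟩|s_i⟩` and `|i⟩|0⟩ ↦ |i⟩|‖s_i‖⟩`, with a
workspace that is returned to `|0⟩`. Time `T` is at least enough to touch each of the qubits. -/
structure QuantumAccess {n d : ℕ} (L : AccessLayout) (S : Matrix (Fin n) (Fin d) ℝ) (κ T : ℝ)
    (O : Oracles (L.width n d)) : Prop where
  width_le : ∀ o, (L.width n d o : ℝ) ≤ T
  row_map : ∀ i : Fin n,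
    act (O AccessKind.row).1
      (tensor (tensor (idxKet i) (zeroKet (idxWidth d))) (zeroKet L.rowWork)) =
    tensor (tensor (idxKet i) (rowState S i)) (zeroKet L.rowWork)
  norm_map : ∀ i : Fin n, ∃ x : Bits L.normBits,
    |(bitsVal x : ℝ) / 2 ^ L.normFrac - ‖row S i‖| ≤ κ ∧
    act (O AccessKind.norm).1
      (tensor (tensor (idxKet i) (zeroKet L.normBits)) (zeroKet L.normWork)) =
    tensor (tensor (idxKet i) (ket x)) (zeroKet L.normWork)

end QSim

end

/-!
# Deciding similarity of data points with a quantum algorithm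

The circuit decides whether `‖s_p - s_q‖² ≤ d_min²` by signal processing of a walk operator whose
spectrum encodes the squared distance; the factor `η / ε` is the degree of a polynomial that
resolves the threshold.

*Encoding the distance.* The program `prep` prepares from the two indices a state `ψ` for which the
observable `Z = (-1) ^ dec` has the expectation `u = c * D`. Here `D` is the squared distance of the
two vectors that have the directions of `s_p`, `s_q` and the written norms. Random bits select two
data points for the two factors of an inner product, a Hadamard gate interferes their encodings,
and each written norm becomes a bit that is set with probability proportional to it (`sampleBit`);
if one of these two bits is not set, the sign is a fair coin. Summing up the outcomes
(`sum_sampled_sign`) gives `⟨s_p, s_p⟩ - 2 ⟨s_p, s_q⟩ + ⟨s_q, s_q⟩` up to the scale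
`c = distScale`, without any arithmetic on the norms (`inner_prep`, `expectation_eq`). Only the
`b` low bits of the norm register are read, where `2 ^ b` is the largest value that a norm can take
up to a constant factor; therefore `c ≥ 1 / (64 η)`. By the bound on `κ`, the number `D` is within
`33 / 64 * ε` of the squared distance, so that for a resolved pair `u` differs from the threshold
`c * d_min²` by at least `ε / (256 η)` (`GoodAccess.exists_expectation`,
`GoodAccess.norm_sub_le`).

*The walk operator.* The product of `Z` and the reflection about `ψ` leaves the plane spanned by
`ψ` and `Z ψ` invariant. Its eigenvalues there have modulus `1` and real part `u`
(`WalkData.exists_signal_components`). The reflection about `ψ` is conjugate by `prep` to the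
reflection about `|0⟩` on the work qubits, so a step costs two runs of `prep`.

*Signal processing.* If the walk is controlled by a signal qubit and alternates with rotations of
that qubit, then an eigenvector with eigenvalue `z` receives the signal amplitudes `P z` and `Q z`.
Every pair of polynomials with `|P|² + |Q|² = 1` on the unit circle arises in this way, with as
many walk steps as the degree (`exists_signalAmp`). A pair whose amplitude changes from one
component to the other when `Re z` crosses the threshold is found as follows
(`exists_step_pair`): convolving a step function with a concentrated kernel over the roots of
unity separates the two sides with a constant error, at degree `O(1 / γ)` for a gap `γ`; a
majority polynomial of degree `O(log (2 / δ))` reduces the error to `δ ^ 2`; and the Fejér–Riesz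
theorem (`fejer_riesz`) turns the resulting functions `w` and `1 - w`, which are positive on the
circle, into `|Q|²` and `|P|²`.

*Output.* The signal qubit is copied to the output qubit and the computation is undone. As one of
its two components is small, this restores the other qubits up to a small error (`decide_bounds`).
The copy is suppressed if a comparison of the index registers finds `p = q`; the output is then
exact. Index registers are never written to, which gives the product form of the final state
(`eq_tensor_of_fixedAt`). Apart from the black boxes, each step uses a number of gates
linear in the number of qubits of the black boxes, hence `O(T)` time (`time_similarityProg_le`).
If there is at most one data point, then the empty circuit is correct.
-/

noncomputable section

namespace QSim

section

open Polynomial ComplexConjugate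

/-! ### Polynomials on the unit circle -/

theorem infinite_unitCircle : {z : ℂ | ‖z‖ = 1}.Infinite := by
  have h : {z : ℂ | ‖z‖ = 1} = Metric.sphere (0 : ℂ) 1 := by ext; simp
  rw [h]
  have hp : IsPreconnected (Metric.sphere (0 : ℂ) 1) :=
    isPreconnected_sphere (by simp [Complex.rank_real_complex]) 0 1
  refine hp.infinite_of_nontrivial ⟨1, by simp, -1, by simp, ?_⟩
  norm_num

theorem poly_eq_of_unitCircle {p q : ℂ[X]} (h : ∀ z : ℂ, ‖z‖ = 1 → p.eval z = q.eval z) :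
    p = q :=
  Polynomial.eq_of_infinite_eval_eq p q (infinite_unitCircle.mono fun z hz => h z hz)

/-- The conjugate reversal `z ^ N * conj (p (1 / conj z))` of a polynomial of degree at most `N`. -/
def conjRev (N : ℕ) (p : ℂ[X]) : ℂ[X] := (p.map (starRingEnd ℂ)).reflect N

theorem eval_conjRev {N : ℕ} {p : ℂ[X]} (hp : p.natDegree ≤ N) {z : ℂ} (hz : z ≠ 0) :
    (conjRev N p).eval z = z ^ N * conj (p.eval (conj z)⁻¹) := by
  let _ : Invertible z⁻¹ := invertibleOfNonzero (inv_ne_zero hz)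
  have h := eval₂_reflect_mul_pow (RingHom.id ℂ) z⁻¹ N (p.map (starRingEnd ℂ))
    ((natDegree_map_le).trans hp)
  have h2 : ⅟(z⁻¹) = z := by simp
  rw [h2, eval₂_id, eval₂_id] at h
  have h3 : (p.map (starRingEnd ℂ)).eval z⁻¹ = conj (p.eval (conj z)⁻¹) := by
    rw [eval_map, ← eval₂_hom]; simp
  rw [conjRev, ← h3, ← h, mul_left_comm, ← mul_pow, mul_inv_cancel₀ hz, one_pow, mul_one]

theorem eval_conjRev_circle {N : ℕ} {p : ℂ[X]} (hp : p.natDegree ≤ N) {z : ℂ} (hz : ‖z‖ = 1) :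
    (conjRev N p).eval z = z ^ N * conj (p.eval z) := by
  have h0 : z ≠ 0 := by rintro rfl; simp at hz
  have : (conj z)⁻¹ = z := by
    rw [Complex.inv_def]; simp [Complex.normSq_eq_norm_sq, hz]
  rw [eval_conjRev hp h0, this]

theorem coeff_conjRev {N : ℕ} (p : ℂ[X]) {i : ℕ} (hi : i ≤ N) :
    (conjRev N p).coeff i = conj (p.coeff (N - i)) := by
  rw [conjRev, coeff_reflect, revAt_le hi, coeff_map]

/-- `w` is, on the unit circle, a trigonometric polynomial of degree at most `K`. The polynomial
`p` is the Laurent polynomial multiplied by `z ^ K`. -/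
def IsTrig (K : ℕ) (w : ℂ → ℝ) : Prop :=
  ∃ p : ℂ[X], p.natDegree ≤ 2 * K ∧ ∀ z : ℂ, ‖z‖ = 1 → p.eval z = z ^ K * (w z : ℂ)

namespace IsTrig

theorem const (c : ℝ) : IsTrig 0 fun _ => c := ⟨C (c : ℂ), by simp, by simp⟩

theorem mono {K K' : ℕ} {w : ℂ → ℝ} (h : IsTrig K w) (hK : K ≤ K') : IsTrig K' w := by
  obtain ⟨p, hp, hw⟩ := h
  refine ⟨X ^ (K' - K) * p, ?_, fun z hz => ?_⟩
  · grw [natDegree_mul_le, natDegree_X_pow, hp]; omega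
  · rw [eval_mul, hw z hz, eval_pow, eval_X, ← mul_assoc, ← pow_add, Nat.sub_add_cancel hK]

theorem add {K : ℕ} {v w : ℂ → ℝ} (hv : IsTrig K v) (hw : IsTrig K w) :
    IsTrig K fun z => v z + w z := by
  obtain ⟨p, hp, hpv⟩ := hv
  obtain ⟨q, hq, hqw⟩ := hw
  refine ⟨p + q, (natDegree_add_le _ _).trans (max_le hp hq), fun z hz => ?_⟩
  rw [eval_add, hpv z hz, hqw z hz]; push_cast; ring

theorem mul {K K' : ℕ} {v w : ℂ → ℝ} (hv : IsTrig K v) (hw : IsTrig K' w) :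
    IsTrig (K + K') fun z => v z * w z := by
  obtain ⟨p, hp, hpv⟩ := hv
  obtain ⟨q, hq, hqw⟩ := hw
  refine ⟨p * q, ?_, fun z hz => ?_⟩
  · grw [natDegree_mul_le, hp, hq]; omega
  · rw [eval_mul, hpv z hz, hqw z hz]; push_cast; ring

theorem const_mul {K : ℕ} {w : ℂ → ℝ} (c : ℝ) (hw : IsTrig K w) : IsTrig K fun z => c * w z := by
  simpa using (const c).mul hw

theorem pow {K : ℕ} {w : ℂ → ℝ} (hw : IsTrig K w) (k : ℕ) : IsTrig (k * K) fun z => w z ^ k := by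
  induction k with
  | zero => simpa using const 1
  | succ k ih => simpa only [pow_succ, Nat.succ_mul] using ih.mul hw

theorem sum {K : ℕ} {ι : Type*} (s : Finset ι) {w : ι → ℂ → ℝ} (h : ∀ i ∈ s, IsTrig K (w i)) :
    IsTrig K fun z => ∑ i ∈ s, w i z := by
  classical
  induction s using Finset.induction_on with
  | empty => simpa using (const 0).mono (Nat.zero_le K)
  | insert a s ha ih =>
    simp only [Finset.sum_insert ha]
    exact (h a (by simp)).add (ih fun i hi => h i (by simp [hi]))

theorem one_sub {K : ℕ} {w : ℂ → ℝ} (hw : IsTrig K w) : IsTrig K fun z => 1 - w z := by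
  simpa [sub_eq_add_neg] using ((const 1).mono (Nat.zero_le K)).add (hw.const_mul (-1))

/-- The squared modulus of a polynomial is a trigonometric polynomial on the unit circle. -/
theorem normSq {K : ℕ} {f : ℂ[X]} (hf : f.natDegree ≤ K) : IsTrig K fun z => ‖f.eval z‖ ^ 2 := by
  refine ⟨f * conjRev K f, ?_, fun z hz => ?_⟩
  · have : (conjRev K f).natDegree ≤ K :=
      natDegree_reflect_le.trans (max_le le_rfl (natDegree_map_le.trans hf))
    grw [natDegree_mul_le, hf, this]; omega
  · rw [eval_mul, eval_conjRev_circle hf hz, mul_left_comm, Complex.mul_conj']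
    push_cast; rfl

end IsTrig

/-- The Fejér–Riesz theorem for strictly positive trigonometric polynomials. The roots of the
associated polynomial come in pairs `a`, `1 / conj a` off the unit circle; each pair splits off a
factor `‖z - a‖ ^ 2`, which lowers the degree by one. -/
theorem fejer_riesz (K : ℕ) : ∀ w : ℂ → ℝ, IsTrig K w → (∀ z : ℂ, ‖z‖ = 1 → 0 < w z) →
    ∃ q : ℂ[X], q.natDegree ≤ K ∧ ∀ z : ℂ, ‖z‖ = 1 → ‖q.eval z‖ ^ 2 = w z := by
  induction K with
  | zero =>
    rintro w ⟨p, hp, hw⟩ hpos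
    have hpc := eq_C_of_natDegree_le_zero hp
    have hc : ∀ z : ℂ, ‖z‖ = 1 → w z = w 1 := fun z hz => by
      have h1 := hw z hz
      have h2 := hw 1 (by simp)
      rw [hpc] at h1 h2
      simp only [eval_C, pow_zero, one_mul] at h1 h2
      exact_mod_cast h1.symm.trans h2
    refine ⟨C ((√(w 1) : ℝ) : ℂ), by simp, fun z hz => ?_⟩
    rw [eval_C, Complex.norm_real, Real.norm_of_nonneg (Real.sqrt_nonneg _),
      Real.sq_sqrt (hpos 1 (by simp)).le, hc z hz]
  | succ K ih =>
    rintro w ⟨p, hp, hw⟩ hpos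
    have hsym : conjRev (2 * (K + 1)) p = p := poly_eq_of_unitCircle fun z hz => by
      have hz0 : z * conj z = 1 := by rw [Complex.mul_conj', hz]; simp
      rw [eval_conjRev_circle hp hz, hw z hz, map_mul, map_pow, Complex.conj_ofReal, two_mul,
        pow_add, mul_assoc, ← mul_assoc (z ^ (K + 1)) (conj z ^ _), ← mul_pow, hz0, one_pow,
        one_mul]
    by_cases h0 : p.coeff 0 = 0
    · obtain ⟨p', rfl⟩ := X_dvd_iff.mpr h0
      refine (ih w ⟨p', ?_, fun z hz => ?_⟩ hpos).imp fun q hq => ⟨hq.1.trans (by omega), hq.2⟩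
      · by_cases hp' : p' = 0
        · simp [hp']
        have htop : (X * p').coeff (2 * (K + 1)) = 0 := by
          rw [← hsym, coeff_conjRev _ le_rfl, Nat.sub_self, h0, map_zero]
        have h1 : (X * p').natDegree ≠ 2 * (K + 1) := fun h => by
          rw [← h, coeff_natDegree, leadingCoeff_eq_zero] at htop
          simp [hp'] at htop
        rw [natDegree_X_mul hp'] at hp h1
        omega
      · have hz0 : z ≠ 0 := by rintro rfl; simp at hz
        have := hw z hz
        rw [eval_mul, eval_X, pow_succ'] at this
        exact mul_left_cancel₀ hz0 (this.trans (mul_assoc _ _ _))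
    · have htop : p.coeff (2 * (K + 1)) ≠ 0 := by
        rw [← hsym, coeff_conjRev _ le_rfl, Nat.sub_self]
        simpa using h0
      have hdeg : p.natDegree = 2 * (K + 1) := le_antisymm hp (le_natDegree_of_ne_zero htop)
      obtain ⟨a, ha⟩ := IsAlgClosed.exists_root p (by
        rw [degree_eq_natDegree (by rintro rfl; simp at h0), hdeg]
        exact_mod_cast (by omega : 2 * (K + 1) ≠ 0))
      have ha0 : a ≠ 0 := by
        rintro rfl
        exact h0 (by rw [coeff_zero_eq_eval_zero]; exact ha)
      have ha1 : ‖a‖ ≠ 1 := fun h => by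
        have := hw a h
        rw [ha.eq_zero] at this
        have h2 := (hpos a h).ne'
        simp_all
      set b : ℂ := (conj a)⁻¹ with hb
      have hca : conj a ≠ 0 := by simpa using ha0
      have hab : b ≠ a := fun h => by
        have h2 : a * conj a = 1 := by
          nth_rewrite 1 [← h]
          exact inv_mul_cancel₀ hca
        rw [Complex.mul_conj'] at h2
        have h3 : ‖a‖ ^ 2 = 1 := by exact_mod_cast h2
        exact ha1 ((pow_eq_one_iff_of_nonneg (norm_nonneg a) two_ne_zero).mp h3)
      have hbr : p.IsRoot b := by
        have h := eval_conjRev hp ha0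
        rw [hsym, ha.eq_zero] at h
        have := (mul_eq_zero.mp h.symm).resolve_left (pow_ne_zero _ ha0)
        simpa using this
      obtain ⟨p₁, rfl⟩ := dvd_iff_isRoot.mpr ha
      have hb₁ : p₁.IsRoot b := by
        have h : (X - C a).eval b * p₁.eval b = 0 := by rw [← eval_mul]; exact hbr
        refine (mul_eq_zero.mp h).resolve_left ?_
        simpa [sub_eq_zero] using hab
      obtain ⟨p₂, rfl⟩ := dvd_iff_isRoot.mpr hb₁
      have hp₂ : p₂ ≠ 0 := by rintro rfl; simp at h0
      have hdeg₂ : p₂.natDegree ≤ 2 * K := by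
        rw [natDegree_mul (X_sub_C_ne_zero a) (mul_ne_zero (X_sub_C_ne_zero b) hp₂),
          natDegree_mul (X_sub_C_ne_zero b) hp₂, natDegree_X_sub_C, natDegree_X_sub_C] at hdeg
        omega
      have hza : ∀ z : ℂ, ‖z‖ = 1 → z - a ≠ 0 := fun z hz h => ha1 (by
        rw [← sub_eq_zero.mp h]; exact hz)
      obtain ⟨q, hq, hqw⟩ := ih (fun z => w z / ‖z - a‖ ^ 2)
        ⟨C (-(conj a)⁻¹) * p₂, (natDegree_C_mul_le _ _).trans hdeg₂, fun z hz => by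
          have hz0 : z * conj z = 1 := by rw [Complex.mul_conj', hz]; simp
          have hzne : z ≠ 0 := by rintro rfl; simp at hz0
          have h1 := hw z hz
          have h2 : (‖z - a‖ : ℂ) ≠ 0 := by simpa using hza z hz
          have h3 : (‖z - a‖ : ℂ) ^ 2 = (z - a) * (conj z - conj a) := by
            rw [← Complex.mul_conj', map_sub]
          have h4 : z - b = -b * z * (conj z - conj a) := by
            have h5 : b * conj a = 1 := inv_mul_cancel₀ hca
            linear_combination b * hz0 - z * h5
          simp only [eval_mul, eval_sub, eval_X, eval_C] at h1 ⊢
          push_cast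
          rw [← mul_div_assoc, eq_div_iff (pow_ne_zero 2 h2), h3]
          rw [h4] at h1
          refine mul_left_cancel₀ hzne ?_
          rw [← hb]
          linear_combination h1⟩
        (fun z hz => div_pos (hpos z hz) (pow_pos (norm_pos_iff.mpr (hza z hz)) 2))
      refine ⟨(X - C a) * q, ?_, fun z hz => ?_⟩
      · grw [natDegree_mul_le, natDegree_X_sub_C, hq]; omega
      · rw [eval_mul, norm_mul, mul_pow, hqw z hz]
        simp only [eval_sub, eval_X, eval_C]
        have := pow_ne_zero 2 (norm_ne_zero_iff.mpr (hza z hz))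
        rw [mul_comm, div_mul_cancel₀ _ this]

end

section

open Polynomial ComplexConjugate

/-! ### Generalized quantum signal processing -/

/-- The special unitary matrix with first column `(α, β)`. -/
def frame (α β : ℂ) (h : ‖α‖ ^ 2 + ‖β‖ ^ 2 = 1) : Matrix.unitaryGroup Bool ℂ :=
  ⟨Matrix.of fun i j => if j then (if i then conj α else -conj β) else (if i then β else α), by
    have h' : α * conj α + β * conj β = 1 := by
      rw [Complex.mul_conj', Complex.mul_conj']; exact_mod_cast h
    rw [Matrix.mem_unitaryGroup_iff]
    ext i j
    cases i <;> cases j <;>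
      simp [Matrix.mul_apply, Matrix.star_apply] <;>
      first | linear_combination h' | linear_combination 0 * h'⟩

/-- The signal amplitudes after the rotations `M₀, M₁, …`, when between two consecutive rotations
the amplitude of `|1⟩` is multiplied by `z`. -/
def signalAmp (M₀ : Matrix.unitaryGroup Bool ℂ) (Ms : List (Matrix.unitaryGroup Bool ℂ)) (z : ℂ) :
    Bool → ℂ :=
  Ms.foldl (fun v M => M.1 *ᵥ fun b => (if b then z else 1) * v b) fun b => M₀.1 b false

/-- Two orthogonal vectors of `ℂ²`, one or both of which may vanish, are multiples of the columns of
a special unitary matrix. -/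
theorem exists_frame_orthogonal (a b c d : ℂ) (h : conj a * c + conj b * d = 0) :
    ∃ α β : ℂ, ‖α‖ ^ 2 + ‖β‖ ^ 2 = 1 ∧ conj α * c + conj β * d = 0 ∧ -β * a + α * b = 0 := by
  have key : ∀ x y : ℂ, (x ≠ 0 ∨ y ≠ 0) → ∃ r : ℝ,
      ‖(r : ℂ) * x‖ ^ 2 + ‖(r : ℂ) * y‖ ^ 2 = 1 := fun x y hxy => by
    have hpos : 0 < ‖x‖ ^ 2 + ‖y‖ ^ 2 := by
      rcases hxy with h | h
      · have := norm_pos_iff.mpr h; positivity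
      · have := norm_pos_iff.mpr h; positivity
    refine ⟨(√(‖x‖ ^ 2 + ‖y‖ ^ 2))⁻¹, ?_⟩
    rw [norm_mul, norm_mul, mul_pow, mul_pow, ← mul_add, Complex.norm_real, Real.norm_eq_abs,
      sq_abs, inv_pow, Real.sq_sqrt hpos.le, inv_mul_cancel₀ hpos.ne']
  by_cases h1 : a ≠ 0 ∨ b ≠ 0
  · obtain ⟨r, hr⟩ := key a b h1
    refine ⟨r * a, r * b, hr, ?_, by ring⟩
    simp only [map_mul, Complex.conj_ofReal]
    linear_combination (r : ℂ) * h
  · push Not at h1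
    by_cases h2 : c ≠ 0 ∨ d ≠ 0
    · obtain ⟨r, hr⟩ := key (-conj d) (conj c) (by simpa [or_comm] using h2)
      refine ⟨r * -conj d, r * conj c, hr, ?_, by simp [h1]⟩
      simp only [map_mul, map_neg, Complex.conj_ofReal, Complex.conj_conj]
      ring
    · push Not at h2
      exact ⟨1, 0, by simp, by simp [h2], by simp [h1]⟩

/-- Generalized quantum signal processing: a pair of polynomials of degree at most `K` that is
normalized on the unit circle is realized by `K + 1` rotations. The extreme coefficient vectors of
the pair are orthogonal, so that one rotation lowers the degree. -/
theorem exists_signalAmp (K : ℕ) : ∀ P Q : ℂ[X], P.natDegree ≤ K → Q.natDegree ≤ K →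
    (∀ z : ℂ, ‖z‖ = 1 → ‖P.eval z‖ ^ 2 + ‖Q.eval z‖ ^ 2 = 1) →
    ∃ (M₀ : Matrix.unitaryGroup Bool ℂ) (Ms : List (Matrix.unitaryGroup Bool ℂ)),
      Ms.length = K ∧ ∀ z, signalAmp M₀ Ms z = fun b => if b then Q.eval z else P.eval z := by
  induction K with
  | zero =>
    intro P Q hP hQ h
    rw [eq_C_of_natDegree_le_zero hP, eq_C_of_natDegree_le_zero hQ] at h ⊢
    have h1 := h 1 (by simp)
    rw [eval_C, eval_C] at h1
    refine ⟨frame _ _ h1, [], rfl, fun z => ?_⟩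
    funext b
    cases b <;> simp [signalAmp, frame]
  | succ K ih =>
    intro P Q hP hQ h
    have horth : conj (P.coeff 0) * P.coeff (K + 1) + conj (Q.coeff 0) * Q.coeff (K + 1) = 0 := by
      have hpoly : P * conjRev (K + 1) P + Q * conjRev (K + 1) Q = X ^ (K + 1) :=
        poly_eq_of_unitCircle fun z hz => by
          have h1 : ((‖P.eval z‖ ^ 2 + ‖Q.eval z‖ ^ 2 : ℝ) : ℂ) = 1 := by rw [h z hz]; simp
          push_cast at h1
          rw [← Complex.mul_conj', ← Complex.mul_conj'] at h1
          simp only [eval_add, eval_mul, eval_pow, eval_X, eval_conjRev_circle hP hz,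
            eval_conjRev_circle hQ hz]
          linear_combination z ^ (K + 1) * h1
      have hdeg : ∀ F : ℂ[X], F.natDegree ≤ K + 1 → (conjRev (K + 1) F).natDegree ≤ K + 1 :=
        fun F hF => natDegree_reflect_le.trans (max_le le_rfl (natDegree_map_le.trans hF))
      have hc := congrArg (fun F : ℂ[X] => F.coeff (K + 1 + (K + 1))) hpoly
      simp only [coeff_add, coeff_X_pow] at hc
      rw [coeff_mul_add_eq_of_natDegree_le hP (hdeg P hP),
        coeff_mul_add_eq_of_natDegree_le hQ (hdeg Q hQ),
        coeff_conjRev _ le_rfl, coeff_conjRev _ le_rfl, Nat.sub_self, if_neg (by omega)] at hc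
      linear_combination hc
    obtain ⟨α, β, hn, h1, h2⟩ := exists_frame_orthogonal _ _ _ _ horth
    have hn' : α * conj α + β * conj β = 1 := by
      rw [Complex.mul_conj', Complex.mul_conj']; exact_mod_cast hn
    set P' : ℂ[X] := C (conj α) * P + C (conj β) * Q with hP'
    set R : ℂ[X] := C (-β) * P + C α * Q with hR
    have hlin : ∀ (a b : ℂ), (C a * P + C b * Q).natDegree ≤ K + 1 := fun a b =>
      (natDegree_add_le _ _).trans
        (max_le ((natDegree_C_mul_le _ _).trans hP) ((natDegree_C_mul_le _ _).trans hQ))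
    have hR0 : X * R.divX = R := by
      have h3 := X_mul_divX_add R
      have h4 : R.coeff 0 = 0 := by simpa [hR] using h2
      rwa [h4, C_0, add_zero] at h3
    have hRz : ∀ z, z * R.divX.eval z = -β * P.eval z + α * Q.eval z := fun z => by
      have h3 := congrArg (eval z) hR0
      rw [eval_mul, eval_X] at h3
      rw [h3, hR]
      simp
    have hPz : ∀ z, P'.eval z = conj α * P.eval z + conj β * Q.eval z := fun z => by simp [hP']
    obtain ⟨M₀, Ms, hlen, hM⟩ := ih P' R.divX
      (by
        refine Nat.le_of_lt_succ (lt_of_le_of_ne (hlin _ _) fun hd => ?_)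
        have h3 : P'.coeff (K + 1) = 0 := by simpa [hP'] using h1
        rw [← Nat.succ_eq_add_one, ← hd, coeff_natDegree, leadingCoeff_eq_zero] at h3
        rw [h3] at hd
        simp at hd)
      (by rw [natDegree_divX_eq_natDegree_tsub_one]; have := hlin (-β) α; rw [← hR] at this; omega)
      (fun z hz => by
        have h3 : ‖R.divX.eval z‖ = ‖z * R.divX.eval z‖ := by rw [norm_mul, hz, one_mul]
        rw [h3, hRz, hPz, ← h z hz]
        have h4 : ∀ w : ℂ, ((‖w‖ ^ 2 : ℝ) : ℂ) = w * conj w := fun w => by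
          rw [Complex.mul_conj']; push_cast; rfl
        apply Complex.ofReal_injective
        rw [Complex.ofReal_add, Complex.ofReal_add, h4, h4, h4, h4]
        simp only [map_add, map_mul, map_neg, Complex.conj_conj]
        linear_combination (P.eval z * conj (P.eval z) + Q.eval z * conj (Q.eval z)) * hn')
    refine ⟨M₀, Ms ++ [frame α β hn], by simp [hlen], fun z => ?_⟩
    have h3 : signalAmp M₀ (Ms ++ [frame α β hn]) z =
        (frame α β hn).1 *ᵥ fun b => (if b then z else 1) * signalAmp M₀ Ms z b := by
      simp [signalAmp]
    rw [h3, hM z]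
    funext b
    cases b
    · simp [Matrix.mulVec, dotProduct, frame, hRz, hPz]
      linear_combination P.eval z * hn'
    · simp [Matrix.mulVec, dotProduct, frame, hRz, hPz]
      linear_combination Q.eval z * hn'

end

section

open Polynomial ComplexConjugate

/-! ### Polynomial approximation of a step function on the unit circle -/

/-- Parseval's identity for the values of a polynomial at the points `z * ζ ^ j`. -/
theorem sum_norm_sq_eval_rootsOfUnity {L : ℕ} {ζ : ℂ} (hζ : IsPrimitiveRoot ζ L) (hL : 0 < L)
    {f : ℂ[X]} (hf : f.natDegree < L) {z : ℂ} (hz : ‖z‖ = 1) :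
    ∑ j ∈ Finset.range L, ‖f.eval (z * ζ ^ j)‖ ^ 2 = L * ∑ k ∈ Finset.range L, ‖f.coeff k‖ ^ 2 := by
  have hζ1 : ‖ζ‖ = 1 := hζ.norm'_eq_one hL.ne'
  have hζc : ζ * conj ζ = 1 := by rw [Complex.mul_conj', hζ1]; simp
  have hzc : z * conj z = 1 := by rw [Complex.mul_conj', hz]; simp
  have horth : ∀ k ∈ Finset.range L, ∀ l ∈ Finset.range L,
      ∑ j ∈ Finset.range L, (ζ ^ k * conj ζ ^ l) ^ j = if k = l then (L : ℂ) else 0 := by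
    intro k hk l hl
    split_ifs with h
    · subst h
      simp [← mul_pow, hζc]
    · have hx : ζ ^ k * conj ζ ^ l ≠ 1 := fun hx => h <| by
        refine hζ.pow_inj (Finset.mem_range.mp hk) (Finset.mem_range.mp hl) ?_
        calc ζ ^ k = ζ ^ k * (ζ * conj ζ) ^ l := by rw [hζc, one_pow, mul_one]
          _ = ζ ^ k * conj ζ ^ l * ζ ^ l := by rw [mul_pow]; ring
          _ = ζ ^ l := by rw [hx, one_mul]
      have hgeom := geom_sum_mul (ζ ^ k * conj ζ ^ l) L
      have hL1 : (ζ ^ k * conj ζ ^ l) ^ L = 1 := by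
        rw [mul_pow, ← pow_mul, ← pow_mul, mul_comm k, mul_comm l, pow_mul, pow_mul,
          ← map_pow, hζ.pow_eq_one]
        simp
      rw [hL1, sub_self] at hgeom
      exact (mul_eq_zero.mp hgeom).resolve_right (sub_ne_zero.mpr hx)
  apply Complex.ofReal_injective
  push_cast
  have hexp : ∀ j, ((‖f.eval (z * ζ ^ j)‖ : ℂ) ^ 2) =
      ∑ k ∈ Finset.range L, ∑ l ∈ Finset.range L,
        (f.coeff k * conj (f.coeff l) * (z ^ k * conj z ^ l)) * (ζ ^ k * conj ζ ^ l) ^ j := by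
    intro j
    rw [← Complex.mul_conj', eval_eq_sum_range' hf, map_sum, Finset.sum_mul_sum]
    refine Finset.sum_congr rfl fun k _ => Finset.sum_congr rfl fun l _ => ?_
    simp only [map_mul, map_pow]
    ring
  simp only [hexp]
  rw [Finset.sum_comm, Finset.mul_sum]
  refine Finset.sum_congr rfl fun k hk => ?_
  rw [Finset.sum_comm, Finset.sum_eq_single k]
  · rw [← Finset.mul_sum, horth k hk k hk, if_pos rfl, ← mul_pow, hzc, ← Complex.mul_conj']
    simp; ring
  · intro l hl hlk
    rw [← Finset.mul_sum, horth k hk l hl, if_neg hlk.symm, mul_zero]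
  · exact fun h => absurd hk h

/-- A normalized kernel, the square of a geometric sum, that is concentrated near `1`: its second
moment is `O(1 / m ^ 2)`. -/
theorem exists_concentrated_kernel {m : ℕ} (hm : 0 < m) {ζ : ℂ} (hζ : IsPrimitiveRoot ζ (2 * m)) :
    ∃ f : ℂ[X], f.natDegree ≤ 2 * m ∧ ∀ z : ℂ, ‖z‖ = 1 →
      ∑ j ∈ Finset.range (2 * m), ‖f.eval (z * ζ ^ j)‖ ^ 2 = 1 ∧
      ∑ j ∈ Finset.range (2 * m), ‖z * ζ ^ j - 1‖ ^ 2 * ‖f.eval (z * ζ ^ j)‖ ^ 2 ≤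
        4 / (m : ℝ) ^ 2 := by
  set g : ℂ[X] := ∑ k ∈ Finset.range m, X ^ k with hg
  have hgc : ∀ k, g.coeff k = if k < m then 1 else 0 := fun k => by
    simp [hg, coeff_X_pow]
  have hgdeg : g.natDegree ≤ m - 1 := by
    rw [natDegree_le_iff_coeff_eq_zero]
    intro k hk
    rw [hgc, if_neg (by omega)]
  have hgd : (g ^ 2).natDegree < 2 * m := by
    have := natDegree_pow_le_of_le 2 hgdeg
    omega
  have hgX : (X - 1) * g = X ^ m - 1 := mul_geom_sum X m
  -- the coefficients of `(X - 1) * g ^ 2` are `-1` up to degree `m - 1` and `1` from there on, so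
  -- that the second moment of the kernel is known exactly by Parseval's identity
  set h : ℂ[X] := (X - 1) * g ^ 2 with hh
  have hh' : h = g * X ^ m - g := by rw [hh, pow_two, ← mul_assoc, hgX]; ring
  have hhc : ∀ k ∈ Finset.range (2 * m), ‖h.coeff k‖ ^ 2 = 1 := fun k hk => by
    have hk := Finset.mem_range.mp hk
    rw [hh', coeff_sub, coeff_mul_X_pow']
    by_cases hkm : k < m
    · simp [hgc, hkm, Nat.not_le.mpr hkm]
    · have h1 : m ≤ k := by omega
      have h2 : k - m < m := by omega
      simp [hgc, hkm, h1, h2]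
  have hhd : h.natDegree < 2 * m := by
    have h1 : (X - 1 : ℂ[X]).natDegree ≤ 1 := by
      simpa using (natDegree_X_sub_C (1 : ℂ)).le
    have h2 := natDegree_pow_le_of_le 2 hgdeg
    have h3 := natDegree_mul_le (p := (X - 1 : ℂ[X])) (q := g ^ 2)
    rw [← hh] at h3
    omega
  set N : ℝ := ∑ k ∈ Finset.range (2 * m), ‖(g ^ 2).coeff k‖ ^ 2 with hN
  have hmR : (0 : ℝ) < m := by exact_mod_cast hm
  -- Cauchy–Schwarz, since the coefficients of `g ^ 2` sum to `m ^ 2`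
  have hNm : (m : ℝ) ^ 3 ≤ 2 * N := by
    have h1 : (g ^ 2).eval 1 = (m : ℂ) ^ 2 := by simp [hg, eval_finsetSum]
    rw [eval_eq_sum_range' hgd] at h1
    simp only [one_pow, mul_one] at h1
    have h2 : (m : ℝ) ^ 2 ≤ ∑ k ∈ Finset.range (2 * m), ‖(g ^ 2).coeff k‖ := by
      have := norm_sum_le (Finset.range (2 * m)) fun k => (g ^ 2).coeff k
      rw [h1] at this
      simpa using this
    have h3 := sq_sum_le_card_mul_sum_sq (s := Finset.range (2 * m))
      (f := fun k => ‖(g ^ 2).coeff k‖)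
    rw [Finset.card_range, ← hN] at h3
    push_cast at h3
    have h4 : ((m : ℝ) ^ 2) ^ 2 ≤ 2 * m * N := (pow_le_pow_left₀ (by positivity) h2 2).trans h3
    have h5 : (m : ℝ) * m ^ 3 ≤ m * (2 * N) := by nlinarith
    exact le_of_mul_le_mul_left h5 hmR
  have hN0 : 0 < N := by
    have : 0 < (m : ℝ) ^ 3 := by positivity
    linarith
  have h2m : (0 : ℝ) < 2 * m := by positivity
  set r : ℝ := (√(2 * m * N))⁻¹ with hr
  have hr2 : r ^ 2 = (2 * m * N)⁻¹ := by
    rw [hr, inv_pow, Real.sq_sqrt (by positivity)]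
  have hev : ∀ y, ‖(C (r : ℂ) * g ^ 2).eval y‖ ^ 2 = r ^ 2 * ‖(g ^ 2).eval y‖ ^ 2 := fun y => by
    rw [eval_mul, eval_C, norm_mul, mul_pow, Complex.norm_real, Real.norm_eq_abs, sq_abs]
  refine ⟨C (r : ℂ) * g ^ 2, (natDegree_C_mul_le _ _).trans hgd.le, fun z hz => ⟨?_, ?_⟩⟩
  · simp only [hev]
    rw [← Finset.mul_sum, sum_norm_sq_eval_rootsOfUnity hζ (by omega) hgd hz, ← hN, hr2]
    push_cast
    exact inv_mul_cancel₀ (by positivity)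
  · have h1 : ∀ y, ‖y - 1‖ ^ 2 * ‖(C (r : ℂ) * g ^ 2).eval y‖ ^ 2 = r ^ 2 * ‖h.eval y‖ ^ 2 :=
      fun y => by
        rw [hev, hh, eval_mul, norm_mul, mul_pow]
        simp only [eval_sub, eval_X, eval_one]
        ring
    simp only [h1]
    rw [← Finset.mul_sum, sum_norm_sq_eval_rootsOfUnity hζ (by omega) hhd hz,
      Finset.sum_congr rfl hhc, hr2]
    simp only [Finset.sum_const, Finset.card_range, nsmul_eq_mul, mul_one]
    push_cast
    rw [inv_mul_le_iff₀ (by positivity)]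
    have : 2 * (m : ℝ) * N * (4 / m ^ 2) = 8 * N / m := by field_simp; ring
    rw [this, le_div_iff₀ hmR]
    nlinarith

/-- A trigonometric polynomial with values in `[0, 1]` that separates two regions of the circle
with a constant error. -/
theorem exists_rough_step {m : ℕ} (hm : 0 < m) (u₀ : ℝ) :
    ∃ B : ℂ → ℝ, IsTrig (2 * m) B ∧ (∀ z, ‖z‖ = 1 → 0 ≤ B z ∧ B z ≤ 1) ∧
      ∀ γ : ℝ, 0 < γ → ∀ z, ‖z‖ = 1 →
        (u₀ + γ ≤ z.re → B z ≤ 4 / (m * γ) ^ 2) ∧ (z.re ≤ u₀ - γ → 1 - B z ≤ 4 / (m * γ) ^ 2) := by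
  classical
  have hζ := Complex.isPrimitiveRoot_exp (2 * m) (by omega)
  set ζ := Complex.exp (2 * Real.pi * Complex.I / ((2 * m : ℕ) : ℂ))
  have hζ1 : ‖ζ‖ = 1 := hζ.norm'_eq_one (by omega)
  obtain ⟨f, hf, hker⟩ := exists_concentrated_kernel hm hζ
  set J := (Finset.range (2 * m)).filter fun j => (ζ ^ j).re < u₀ with hJ
  have hsub : J ⊆ Finset.range (2 * m) := Finset.filter_subset _ _
  have hcompl : ∀ z, ‖z‖ = 1 → 1 - ∑ j ∈ J, ‖f.eval (z * ζ ^ j)‖ ^ 2 =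
      ∑ j ∈ Finset.range (2 * m) \ J, ‖f.eval (z * ζ ^ j)‖ ^ 2 := fun z hz => by
    rw [← (hker z hz).1, ← Finset.sum_sdiff hsub]; ring
  -- Markov's inequality: the kernel has little mass at distance at least `γ` from `1`.
  have tail : ∀ γ : ℝ, 0 < γ → ∀ z, ‖z‖ = 1 → ∀ s ⊆ Finset.range (2 * m),
      (∀ j ∈ s, γ ≤ ‖z * ζ ^ j - 1‖) →
      ∑ j ∈ s, ‖f.eval (z * ζ ^ j)‖ ^ 2 ≤ 4 / (m * γ) ^ 2 := by
    intro γ hγ z hz s hs hfar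
    have h1 : γ ^ 2 * ∑ j ∈ s, ‖f.eval (z * ζ ^ j)‖ ^ 2 ≤ 4 / (m : ℝ) ^ 2 := by
      rw [Finset.mul_sum]
      refine le_trans ?_ (hker z hz).2
      refine (Finset.sum_le_sum fun j hj => ?_).trans
        (Finset.sum_le_sum_of_subset_of_nonneg hs fun _ _ _ => by positivity)
      have := hfar j hj
      gcongr
    rw [mul_pow, ← div_div, le_div_iff₀ (by positivity)]
    linarith
  -- `z * ζ ^ j` is near `1` only if `z` is near the conjugate of `ζ ^ j`, which has the same real
  -- part as `ζ ^ j`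
  have hdist : ∀ z, ‖z‖ = 1 → ∀ j, |z.re - (ζ ^ j).re| ≤ ‖z * ζ ^ j - 1‖ := fun z hz j => by
    have hj : ‖ζ ^ j‖ = 1 := by rw [norm_pow, hζ1, one_pow]
    have h1 : ζ ^ j * conj (ζ ^ j) = 1 := by rw [Complex.mul_conj', hj]; simp
    have h2 : z * ζ ^ j - 1 = ζ ^ j * (z - conj (ζ ^ j)) := by linear_combination h1
    rw [h2, norm_mul, hj, one_mul]
    have h3 := Complex.abs_re_le_norm (z - conj (ζ ^ j))
    rwa [Complex.sub_re, Complex.conj_re] at h3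
  refine ⟨fun z => ∑ j ∈ J, ‖f.eval (z * ζ ^ j)‖ ^ 2, ?_, fun z hz => ⟨by positivity, ?_⟩,
    fun γ hγ z hz => ⟨fun h => ?_, fun h => ?_⟩⟩
  · refine IsTrig.sum _ fun j _ => ?_
    have h1 : (f.comp (X * C (ζ ^ j))).natDegree ≤ 2 * m := by
      refine natDegree_comp_le.trans ?_
      have h2 : (X * C (ζ ^ j)).natDegree ≤ 1 := by
        simpa using natDegree_mul_le (p := (X : ℂ[X])) (q := C (ζ ^ j))
      nlinarith
    simpa using IsTrig.normSq h1
  · rw [← sub_nonneg, hcompl z hz]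
    positivity
  · refine tail γ hγ z hz J hsub fun j hj => ?_
    have h1 := (Finset.mem_filter.mp hj).2
    have h2 := (le_abs_self _).trans (hdist z hz j)
    linarith
  · simp only [hcompl z hz]
    refine tail γ hγ z hz _ Finset.sdiff_subset fun j hj => ?_
    rw [Finset.mem_sdiff, hJ, Finset.mem_filter] at hj
    have h1 : u₀ ≤ (ζ ^ j).re := not_lt.mp fun h => hj.2 ⟨hj.1, h⟩
    have h2 := (neg_le_abs _).trans (hdist z hz j)
    linarith

/-- The probability that at least half of `2 * s` independent coins of bias `x` show heads. -/
def majority (s : ℕ) (x : ℝ) : ℝ :=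
  ∑ k ∈ (Finset.range (2 * s + 1)).filter (s ≤ ·),
    x ^ k * (1 - x) ^ (2 * s - k) * (2 * s).choose k

theorem one_sub_majority (s : ℕ) (x : ℝ) : 1 - majority s x =
    ∑ k ∈ (Finset.range (2 * s + 1)).filter (¬ s ≤ ·),
      x ^ k * (1 - x) ^ (2 * s - k) * (2 * s).choose k := by
  have h := add_pow x (1 - x) (2 * s)
  rw [add_sub_cancel, one_pow, ← Finset.sum_filter_add_sum_filter_not _ (s ≤ ·)] at h
  exact sub_eq_of_eq_add' h

theorem majority_mem {x : ℝ} (hx : 0 ≤ x) (hx1 : x ≤ 1) (s : ℕ) :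
    0 ≤ majority s x ∧ majority s x ≤ 1 := by
  have h1 : 0 ≤ 1 - x := sub_nonneg.mpr hx1
  refine ⟨by unfold majority; positivity, ?_⟩
  rw [← sub_nonneg, one_sub_majority]
  positivity

/-- The binomial coefficients of `2 * s` sum to `4 ^ s`. -/
theorem sum_choose_mul_le (s : ℕ) (p : ℕ → Prop) [DecidablePred p] {F : ℕ → ℝ} {c : ℝ}
    (hc : 0 ≤ c) (h : ∀ k ≤ 2 * s, p k → F k ≤ c ^ s) :
    ∑ k ∈ (Finset.range (2 * s + 1)).filter p, F k * (2 * s).choose k ≤ (4 * c) ^ s := by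
  calc _ ≤ ∑ k ∈ (Finset.range (2 * s + 1)).filter p, c ^ s * (2 * s).choose k := by
        refine Finset.sum_le_sum fun k hk => ?_
        obtain ⟨h1, h2⟩ := Finset.mem_filter.mp hk
        have := h k (Nat.lt_succ_iff.mp (Finset.mem_range.mp h1)) h2
        gcongr
    _ ≤ ∑ k ∈ Finset.range (2 * s + 1), c ^ s * (2 * s).choose k :=
        Finset.sum_le_sum_of_subset_of_nonneg (Finset.filter_subset _ _)
          fun _ _ _ => by positivity
    _ = (4 * c) ^ s := by
        rw [← Finset.mul_sum]
        have : ∑ k ∈ Finset.range (2 * s + 1), ((2 * s).choose k : ℝ) = 2 ^ (2 * s) := by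
          exact_mod_cast Nat.sum_range_choose (2 * s)
        rw [this, pow_mul, mul_pow, mul_comm]
        norm_num

/-- The error of the majority vote is exponentially small in the number of coins. -/
theorem majority_le {x : ℝ} (hx : 0 ≤ x) (hx1 : x ≤ 1) (s : ℕ) :
    majority s x ≤ (4 * x) ^ s := by
  have h1 : 0 ≤ 1 - x := sub_nonneg.mpr hx1
  refine sum_choose_mul_le s _ hx fun k _ hk => ?_
  calc x ^ k * (1 - x) ^ (2 * s - k) ≤ x ^ s * 1 :=
        mul_le_mul (pow_le_pow_of_le_one hx hx1 hk) (pow_le_one₀ h1 (by linarith))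
          (by positivity) (by positivity)
    _ = x ^ s := mul_one _

theorem one_sub_majority_le {x : ℝ} (hx : 0 ≤ x) (hx1 : x ≤ 1) (s : ℕ) :
    1 - majority s x ≤ (4 * (1 - x)) ^ s := by
  have h1 : 0 ≤ 1 - x := sub_nonneg.mpr hx1
  rw [one_sub_majority]
  refine sum_choose_mul_le s _ h1 fun k _ hk => ?_
  calc x ^ k * (1 - x) ^ (2 * s - k) ≤ 1 * (1 - x) ^ s :=
        mul_le_mul (pow_le_one₀ hx hx1) (pow_le_pow_of_le_one h1 (by linarith) (by omega))
          (by positivity) zero_le_one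
    _ = (1 - x) ^ s := one_mul _

theorem IsTrig.majority {K : ℕ} {B : ℂ → ℝ} (hB : IsTrig K B) (s : ℕ) :
    IsTrig (2 * s * K) fun z => majority s (B z) := by
  refine IsTrig.sum _ fun k hk => ?_
  have hk' : k ≤ 2 * s := Nat.lt_succ_iff.mp (Finset.mem_range.mp (Finset.mem_filter.mp hk).1)
  have h := (((hB.pow k).mul (hB.one_sub.pow (2 * s - k))).const_mul ((2 * s).choose k : ℝ))
  rw [← Nat.add_mul, Nat.add_sub_cancel' hk'] at h
  simpa only [mul_comm] using h

/-- A normalized pair of polynomials of degree `O(γ⁻¹ log (2 / δ))`, one of which is `δ`-small on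
the part of the unit circle right of `u₀`, and the other on the part left of `u₀`. -/
theorem exists_step_pair : ∃ C : ℝ, 0 < C ∧ ∀ γ u₀ δ : ℝ, 0 < γ → γ ≤ 1 → 0 < δ → δ ≤ 1 →
    ∃ (K : ℕ) (P Q : ℂ[X]), (K : ℝ) ≤ C * (1 / γ * Real.log (2 / δ)) ∧
      P.natDegree ≤ K ∧ Q.natDegree ≤ K ∧
      (∀ z : ℂ, ‖z‖ = 1 → ‖P.eval z‖ ^ 2 + ‖Q.eval z‖ ^ 2 = 1) ∧
      ∀ z : ℂ, ‖z‖ = 1 →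
        (u₀ + γ ≤ z.re → ‖Q.eval z‖ ≤ δ) ∧ (z.re ≤ u₀ - γ → ‖P.eval z‖ ≤ δ) := by
  refine ⟨144, by norm_num, fun γ u₀ δ hγ hγ1 hδ hδ1 => ?_⟩
  set l := Real.log (2 / δ) with hl
  have hl2 : 1 ≤ 2 * l := by
    have h1 : Real.log 2 ≤ l := Real.log_le_log (by norm_num) (by rw [le_div_iff₀ hδ]; linarith)
    have := Real.log_two_gt_d9
    linarith
  -- `m` makes the error of the rough step at most `1 / 16`, which the majority polynomial of order
  -- `s` turns into `(4 / 16) ^ s ≤ δ ^ 2 / 4`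
  set m := ⌈8 / γ⌉₊ with hm
  set s := ⌈2 * l⌉₊ with hs
  have hm8 : 8 ≤ m * γ := by rw [← div_le_iff₀ hγ]; exact Nat.le_ceil _
  have hm0 : 0 < m := Nat.ceil_pos.mpr (by positivity)
  have hmle : (m : ℝ) ≤ 9 * (1 / γ) := by
    have h1 := Nat.ceil_lt_add_one (a := 8 / γ) (by positivity)
    have h2 : 1 ≤ 1 / γ := by rw [le_div_iff₀ hγ]; linarith
    have h3 : 8 / γ = 8 * (1 / γ) := by ring
    rw [← hm] at h1
    linarith
  have hsle : (s : ℝ) ≤ 4 * l := by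
    have h1 := Nat.ceil_lt_add_one (a := 2 * l) (by linarith)
    rw [← hs] at h1
    linarith
  have herr : ((1 : ℝ) / 4) ^ s ≤ δ ^ 2 / 4 := by
    have h1 : (1 : ℝ) / 4 ≤ Real.exp (-1) := by
      rw [Real.exp_neg, one_div]
      have := Real.exp_one_lt_d9
      exact inv_anti₀ (Real.exp_pos 1) (by linarith)
    calc ((1 : ℝ) / 4) ^ s ≤ Real.exp (-1) ^ s := by gcongr
      _ = Real.exp (-(s : ℝ)) := by rw [← Real.exp_nat_mul]; ring_nf
      _ ≤ Real.exp (-(2 * l)) := by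
          have : 2 * l ≤ (s : ℝ) := Nat.le_ceil _
          gcongr
      _ = δ ^ 2 / 4 := by
          rw [Real.exp_neg, two_mul, Real.exp_add, hl, Real.exp_log (by positivity)]
          field_simp
          norm_num
  obtain ⟨B, hB, hB01, hBγ⟩ := exists_rough_step hm0 u₀
  have hsmall : 4 / (m * γ) ^ 2 ≤ 1 / 16 := by
    rw [div_le_iff₀ (by positivity)]
    nlinarith
  set τ := δ ^ 2 / 4 with hτ
  have hτ0 : 0 < τ := by positivity
  have hτ1 : τ ≤ 1 / 4 := by rw [hτ]; nlinarith
  -- shrink the range to `[τ, 1 - τ]`, for strict positivity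
  set w : ℂ → ℝ := fun z => (1 - 2 * τ) * majority s (B z) + τ with hw
  have hwt : IsTrig (2 * s * (2 * m)) w :=
    ((hB.majority s).const_mul _).add ((IsTrig.const τ).mono (Nat.zero_le _))
  have hw0 : ∀ z, ‖z‖ = 1 → 0 < w z := fun z hz => by
    have := (majority_mem (hB01 z hz).1 (hB01 z hz).2 s).1
    have h2 : 0 ≤ 1 - 2 * τ := by linarith
    positivity
  have hw1 : ∀ z, ‖z‖ = 1 → 0 < 1 - w z := fun z hz => by
    have := (majority_mem (hB01 z hz).1 (hB01 z hz).2 s).2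
    have h2 : 0 ≤ 1 - 2 * τ := by linarith
    have h3 : 1 - w z = (1 - 2 * τ) * (1 - majority s (B z)) + τ := by rw [hw]; ring
    rw [h3]
    have h4 := sub_nonneg.mpr this
    positivity
  obtain ⟨Q, hQ, hQw⟩ := fejer_riesz _ w hwt hw0
  obtain ⟨P, hP, hPw⟩ := fejer_riesz _ (fun z => 1 - w z) hwt.one_sub hw1
  have hpow : ∀ x : ℝ, 0 ≤ x → x ≤ 4 / (m * γ) ^ 2 → (4 * x) ^ s ≤ δ ^ 2 / 4 :=
    fun x hx0 hx => (pow_le_pow_left₀ (by positivity) (by linarith) s).trans herr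
  refine ⟨2 * s * (2 * m), P, Q, ?_, hP, hQ, fun z hz => by rw [hPw z hz, hQw z hz]; ring,
    fun z hz => ⟨fun h => ?_, fun h => ?_⟩⟩
  · have hl0 : 0 ≤ l := by linarith
    push_cast
    calc (2 * s * (2 * m) : ℝ) = 4 * (s * m) := by ring
      _ ≤ 4 * (4 * l * (9 * (1 / γ))) := by gcongr
      _ = 144 * (1 / γ * l) := by ring
  · have h1 := hpow _ (hB01 z hz).1 ((hBγ γ hγ z hz).1 h)
    have h2 := majority_le (hB01 z hz).1 (hB01 z hz).2 s
    have h3 := (majority_mem (hB01 z hz).1 (hB01 z hz).2 s).1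
    refine le_of_sq_le_sq ?_ hδ.le
    rw [hQw z hz, hw]
    nlinarith
  · have h1 := hpow _ (sub_nonneg.mpr (hB01 z hz).2) ((hBγ γ hγ z hz).2 h)
    have h2 := one_sub_majority_le (hB01 z hz).1 (hB01 z hz).2 s
    have h3 := (majority_mem (hB01 z hz).1 (hB01 z hz).2 s).2
    refine le_of_sq_le_sq ?_ hδ.le
    rw [hPw z hz, hw]
    nlinarith

end

section

open ComplexConjugate

/-! ### Operators on wires -/

section Act

variable {N : ℕ}

theorem act_apply (V : Matrix (Bits N) (Bits N) ℂ) (ψ : QState N) (x : Bits N) :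
    act V ψ x = ∑ y, V x y * ψ y := rfl

theorem act_eq_toEuclideanLin (V : Matrix (Bits N) (Bits N) ℂ) (ψ : QState N) :
    act V ψ = Matrix.toEuclideanLin V ψ := rfl

theorem act_mul (V W : Matrix (Bits N) (Bits N) ℂ) (ψ : QState N) :
    act (V * W) ψ = act V (act W ψ) := by
  simp [act, Matrix.mulVec_mulVec]

theorem act_one (ψ : QState N) : act 1 ψ = ψ := by simp [act]

theorem inner_act_left (V : Matrix (Bits N) (Bits N) ℂ) (φ ψ : QState N) :
    inner ℂ (act Vᴴ φ) ψ = inner ℂ φ (act V ψ) := by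
  rw [act_eq_toEuclideanLin, act_eq_toEuclideanLin, Matrix.toEuclideanLin_conjTranspose_eq_adjoint,
    LinearMap.adjoint_inner_left]

theorem ket_apply (x y : Bits N) : ket x y = if y = x then 1 else 0 := by
  simp [ket, PiLp.single_apply]

theorem state_eq_sum_ket (ψ : QState N) : ψ = ∑ x, ψ x • ket x := by
  ext y
  simp [ket_apply]

theorem norm_ket (x : Bits N) : ‖ket x‖ = 1 := by simp [ket]

theorem inner_ket_left (x : Bits N) (ψ : QState N) : inner ℂ (ket x) ψ = ψ x := by
  rw [ket, EuclideanSpace.inner_single_left, map_one, one_mul]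

/-- An operator on selected wires, in coordinates: `Function.extend e z x` replaces the bits of `x`
on the selected wires by `z`. -/
theorem act_onWires_apply {k : ℕ} (e : Fin k ↪ Fin N) (V : Matrix (Bits k) (Bits k) ℂ)
    (ψ : QState N) (x : Bits N) :
    act (onWires e V) ψ x =
      ∑ z : Bits k, V (fun j => x (e j)) z * ψ (Function.extend e z x) := by
  have he := e.injective
  have hext : ∀ z : Bits k, (fun j => Function.extend e z x (e j)) = z := fun z =>
    funext fun j => he.extend_apply z x j
  rw [act_apply]
  symm
  refine Finset.sum_of_injOn (fun z => Function.extend e z x) ?_ (by simp) ?_ ?_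
  · intro z _ z' _ h
    have h' : Function.extend e z x = Function.extend e z' x := h
    rw [← hext z, ← hext z', h']
  · intro y _ hy
    have : ¬ ∀ i, (∀ j, e j ≠ i) → x i = y i := fun h => hy
      ⟨fun j => y (e j), by simp, by
        funext i
        by_cases hi : ∃ j, e j = i
        · obtain ⟨j, rfl⟩ := hi
          exact he.extend_apply _ _ _
        · simp only [Function.extend_apply' _ _ _ hi]
          exact h i (by simpa using hi)⟩
    simp [onWires, this]
  · intro z _
    have h1 : ∀ i, (∀ j, e j ≠ i) → x i = Function.extend e z x i := fun i hi => by
      rw [Function.extend_apply' _ _ _ (by simpa using hi)]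
    simp only [onWires, Matrix.of_apply, if_pos h1, hext]

theorem onWires_conjTranspose {k : ℕ} (e : Fin k ↪ Fin N) (V : Matrix (Bits k) (Bits k) ℂ) :
    onWires e Vᴴ = (onWires e V)ᴴ := by
  ext x y
  simp only [onWires, Matrix.of_apply, Matrix.conjTranspose_apply, eq_comm]
  split_ifs <;> simp

theorem act_onWires_mul {k : ℕ} (e : Fin k ↪ Fin N) (V W : Matrix (Bits k) (Bits k) ℂ)
    (ψ : QState N) : act (onWires e (V * W)) ψ = act (onWires e V) (act (onWires e W) ψ) := by
  have he := e.injective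
  ext x
  simp only [act_onWires_apply, he.extend_apply, Matrix.mul_apply, Finset.mul_sum, Finset.sum_mul]
  rw [Finset.sum_comm]
  refine Finset.sum_congr rfl fun z _ => Finset.sum_congr rfl fun z' _ => ?_
  have : Function.extend e z' (Function.extend e z x) = Function.extend e z' x := by
    funext i
    by_cases hi : ∃ j, e j = i
    · obtain ⟨j, rfl⟩ := hi
      simp [he.extend_apply]
    · simp [Function.extend_apply' _ _ _ hi]
  rw [this, mul_assoc]

theorem act_onWires_one {k : ℕ} (e : Fin k ↪ Fin N) (ψ : QState N) :
    act (onWires e 1) ψ = ψ := by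
  ext x
  rw [act_onWires_apply, Finset.sum_eq_single fun j => x (e j)]
  · have : Function.extend e (fun j => x (e j)) x = x := by
      funext i
      by_cases hi : ∃ j, e j = i
      · obtain ⟨j, rfl⟩ := hi
        exact e.injective.extend_apply _ _ _
      · simp [Function.extend_apply' _ _ _ hi]
    simp [this]
  · intro z _ hz
    simp [Matrix.one_apply_ne hz.symm]
  · simp

theorem inner_act_onWires {k : ℕ} (e : Fin k ↪ Fin N) (V : Matrix.unitaryGroup (Bits k) ℂ)
    (φ ψ : QState N) :
    inner ℂ (act (onWires e V.1) φ) (act (onWires e V.1) ψ) = inner ℂ φ ψ := by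
  have h : V.1ᴴ * V.1 = 1 := Matrix.UnitaryGroup.star_mul_self V
  rw [← inner_act_left, ← onWires_conjTranspose, ← act_onWires_mul, h, act_onWires_one]

end Act

/-! ### Two-qubit gates and reversible classical gates -/

/-- The rotation of qubit `1` by `M b`, where `b` is the value of qubit `0`. -/
def rotMat (M : Bool → Matrix.unitaryGroup Bool ℂ) : Matrix (Bits 2) (Bits 2) ℂ :=
  Matrix.of fun x y => if x 0 = y 0 then (M (x 0)).1 (x 1) (y 1) else 0

theorem sum_bits_two (F : Bits 2 → ℂ) : ∑ z, F z = ∑ a : Bool, ∑ b : Bool, F ![a, b] := by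
  rw [← Fintype.sum_prod_type', ← (finTwoArrowEquiv Bool).symm.sum_comp]
  rfl

theorem rotMat_mem (M : Bool → Matrix.unitaryGroup Bool ℂ) :
    rotMat M ∈ Matrix.unitaryGroup (Bits 2) ℂ := by
  rw [Matrix.mem_unitaryGroup_iff]
  have hM : ∀ c i j, ∑ b, (M c).1 i b * star ((M c).1 j b) = if i = j then 1 else 0 :=
    fun c i j => by
      have h := congrFun₂ (Matrix.mem_unitaryGroup_iff.mp (M c).2) i j
      rwa [Matrix.mul_apply, Matrix.one_apply] at h
  ext x y
  rw [Matrix.mul_apply, sum_bits_two, Finset.sum_eq_single (x 0)]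
  · by_cases h : x 0 = y 0
    · have h2 : x = y ↔ x 1 = y 1 :=
        ⟨fun h => by rw [h], fun h' => funext fun i => by fin_cases i <;> assumption⟩
      simp [rotMat, Matrix.star_apply, Matrix.one_apply, h2, ← h, ← hM (x 0)]
    · have h2 : x ≠ y := fun h' => h (by rw [h'])
      simp [rotMat, Matrix.star_apply, h2, Ne.symm h]
  · intro c _ hc
    simp [rotMat, Ne.symm hc]
  · simp

/-- The pair of wires `a`, `t`. -/
def pairEmb {N : ℕ} (a t : Fin N) (h : a ≠ t) : Fin 2 ↪ Fin N :=
  ⟨![a, t], by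
    intro i j hij
    fin_cases i <;> fin_cases j <;> simp_all [h.symm]⟩

@[simp] theorem pairEmb_zero {N : ℕ} (a t : Fin N) (h : a ≠ t) : pairEmb a t h 0 = a := rfl

@[simp] theorem pairEmb_one {N : ℕ} (a t : Fin N) (h : a ≠ t) : pairEmb a t h 1 = t := rfl

section Gates

variable {ι : Type} {w : ι → ℕ} {N : ℕ}

/-- The two-qubit gate that rotates the wire `t` by `M b`, where `b` is the value of wire `a`. -/
def rotGate (a t : Fin N) (h : a ≠ t) (M : Bool → Matrix.unitaryGroup Bool ℂ) : Gate w N :=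
  .elem 2 le_rfl (pairEmb a t h) ⟨rotMat M, rotMat_mem M⟩

theorem extend_pairEmb (a t : Fin N) (h : a ≠ t) (x : Bits N) (b : Bool) :
    Function.extend (pairEmb a t h) ![x a, b] x = Function.update x t b := by
  have hinj := (pairEmb a t h).injective
  have h0 := hinj.extend_apply ![x a, b] x 0
  have h1 := hinj.extend_apply ![x a, b] x 1
  rw [pairEmb_zero] at h0
  rw [pairEmb_one] at h1
  funext i
  by_cases hit : i = t
  · subst hit; rw [h1]; simp
  · rw [Function.update_of_ne hit]
    by_cases hia : i = a
    · subst hia; rw [h0]; simp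
    · refine Function.extend_apply' _ _ _ ?_
      rintro ⟨j, hj⟩
      fin_cases j
      · exact hia hj.symm
      · exact hit hj.symm

theorem act_rotGate (O : Oracles w) (a t : Fin N) (h : a ≠ t)
    (M : Bool → Matrix.unitaryGroup Bool ℂ) (ψ : QState N) (x : Bits N) :
    act ((rotGate a t h M : Gate w N).toMatrix O) ψ x =
      ∑ b, (M (x a)).1 (x t) b * ψ (Function.update x t b) := by
  simp only [rotGate, Gate.toMatrix]
  rw [act_onWires_apply, sum_bits_two, Finset.sum_eq_single (x a)]
  · refine Finset.sum_congr rfl fun b _ => ?_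
    rw [extend_pairEmb]
    simp [rotMat]
  · intro c _ hc
    simp [rotMat, Ne.symm hc]
  · simp

/-- The unitary matrix with eigenvalues `1` on `|+⟩` and `α` on `|-⟩`. -/
def flipPow (α : ℂ) (h : α * conj α = 1) : Matrix.unitaryGroup Bool ℂ :=
  ⟨Matrix.of fun i j => if i = j then (1 + α) / 2 else (1 - α) / 2, by
    rw [Matrix.mem_unitaryGroup_iff]
    ext i j
    cases i <;> cases j <;>
      simp [Matrix.mul_apply, Matrix.star_apply, map_ofNat] <;>
      first | linear_combination h / 2 | linear_combination -h / 2⟩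

/-- A reversible classical gate on three different wires, which adds `f` of the bits `a` and `b` to
the bit `t`. -/
structure CGate (N : ℕ) where
  a : Fin N
  b : Fin N
  t : Fin N
  f : Bool → Bool → Bool
  hab : a ≠ b
  hat : a ≠ t
  hbt : b ≠ t

/-- The effect of a classical gate on bit strings. -/
def CGate.step (G : CGate N) (x : Bits N) : Bits N :=
  Function.update x G.t (xor (x G.t) (G.f (x G.a) (x G.b)))

/-- The sign `(-1) ^ b`. -/
def sgn (b : Bool) : ℂ := if b then -1 else 1

theorem sgn_mul_conj (b : Bool) : sgn b * conj (sgn b) = 1 := by cases b <;> simp [sgn]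

/-- Whether `f`, as a polynomial over the field of two elements, has a quadratic term. -/
def quadPart (f : Bool → Bool → Bool) : Bool :=
  xor (xor (f false false) (f false true)) (xor (f true false) (f true true))

/-- The eigenvalues on `|-⟩` of the three powers of the bit flip into which `t ↦ t + f a b` is
decomposed; they are controlled by `a`, `b` and `a + b`. -/
def phaseA (f : Bool → Bool → Bool) (a : Bool) : ℂ :=
  sgn (xor (f false false) (a && xor (f false false) (f true false))) *
    (if a && quadPart f then Complex.I else 1)

/-- See `phaseA`. -/
def phaseB (f : Bool → Bool → Bool) (b : Bool) : ℂ :=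
  sgn (b && xor (f false false) (f false true)) * (if b && quadPart f then Complex.I else 1)

/-- See `phaseA`. -/
def phaseAB (f : Bool → Bool → Bool) (c : Bool) : ℂ := if c && quadPart f then -Complex.I else 1

theorem phaseA_mul_conj (f : Bool → Bool → Bool) (a : Bool) :
    phaseA f a * conj (phaseA f a) = 1 := by
  rw [phaseA, map_mul, mul_mul_mul_comm, sgn_mul_conj]
  split_ifs <;> simp

theorem phaseB_mul_conj (f : Bool → Bool → Bool) (a : Bool) :
    phaseB f a * conj (phaseB f a) = 1 := by
  rw [phaseB, map_mul, mul_mul_mul_comm, sgn_mul_conj]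
  split_ifs <;> simp

theorem phaseAB_mul_conj (f : Bool → Bool → Bool) (a : Bool) :
    phaseAB f a * conj (phaseAB f a) = 1 := by
  rw [phaseAB]
  split_ifs <;> simp

theorem phase_mul (f : Bool → Bool → Bool) (a b : Bool) :
    phaseA f a * phaseAB f (xor a b) * phaseB f b = sgn (f a b) := by
  unfold phaseA phaseAB phaseB quadPart sgn
  cases a <;> cases b <;> cases h00 : f false false <;> cases h01 : f false true <;>
    cases h10 : f true false <;> cases h11 : f true true <;> simp

/-- The five two-qubit gates that perform a classical gate. -/
def CGate.circ (G : CGate N) : Circuit w N :=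
  [rotGate G.b G.t G.hbt fun v => flipPow (phaseB G.f v) (phaseB_mul_conj _ _),
    rotGate G.a G.b G.hab fun v => flipPow (sgn v) (sgn_mul_conj _),
    rotGate G.b G.t G.hbt fun v => flipPow (phaseAB G.f v) (phaseAB_mul_conj _ _),
    rotGate G.a G.b G.hab fun v => flipPow (sgn v) (sgn_mul_conj _),
    rotGate G.a G.t G.hat fun v => flipPow (phaseA G.f v) (phaseA_mul_conj _ _)]

theorem run_cons (O : Oracles w) (g : Gate w N) (c : Circuit w N) (ψ : QState N) :
    Circuit.run O (g :: c) ψ = Circuit.run O c (act (g.toMatrix O) ψ) := by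
  simp only [Circuit.run, Circuit.toMatrix, act_mul]

theorem run_nil (O : Oracles w) (ψ : QState N) : Circuit.run O ([] : Circuit w N) ψ = ψ :=
  act_one ψ

theorem run_append (O : Oracles w) (c c' : Circuit w N) (ψ : QState N) :
    Circuit.run O (c ++ c') ψ = Circuit.run O c' (Circuit.run O c ψ) := by
  induction c generalizing ψ with
  | nil => rw [List.nil_append, run_nil]
  | cons g c ih => rw [List.cons_append, run_cons, run_cons, ih]

/-- On the eigenvectors `|±⟩` of the bit flip the signs `1`, `(-1) ^ v` give a controlled bit flip.
-/
theorem act_cnot (O : Oracles w) (a t : Fin N) (h : a ≠ t) (ψ : QState N) (x : Bits N) :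
    act ((rotGate a t h fun v => flipPow (sgn v) (sgn_mul_conj _) : Gate w N).toMatrix O) ψ x =
      ψ (Function.update x t (xor (x t) (x a))) := by
  rw [act_rotGate]
  cases ha : x a <;> cases ht : x t <;> simp [flipPow, sgn]

/-- The three rotations of the target multiply the amplitude on `|-⟩` by `(-1) ^ f a b`, which is
the effect of a controlled bit flip. -/
theorem run_circ (O : Oracles w) (G : CGate N) (ψ : QState N) (x : Bits N) :
    Circuit.run O G.circ ψ x = ψ (G.step x) := by
  obtain ⟨a, b, t, f, hab, hat, hbt⟩ := G
  have hmul : ∀ α β γ : ℂ, ∀ (hα hβ hγ) (i : Bool) (F : Bool → ℂ),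
      ∑ k, (flipPow α hα).1 i k * ∑ l, (flipPow β hβ).1 k l * ∑ m, (flipPow γ hγ).1 l m * F m =
      (1 + α * β * γ) / 2 * F i + (1 - α * β * γ) / 2 * F (!i) := by
    intro α β γ hα hβ hγ i F
    cases i <;> simp [flipPow] <;> ring
  simp only [CGate.circ, run_cons, run_nil, CGate.step]
  simp only [act_rotGate O a t, act_cnot, act_rotGate O b t]
  have h1 : ∀ β γ δ : Bool, Function.update
      (Function.update (Function.update (Function.update x t β) b (xor (x b) (x a))) t γ) b (x b) =
      Function.update x t γ := by
    intro β γ _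
    funext i
    by_cases hit : i = t
    · subst hit; simp [hbt.symm]
    · by_cases hib : i = b
      · subst hib; simp [hit]
      · simp [hit, hib]
  simp only [Function.update_self, Function.update_of_ne hat, Function.update_of_ne hbt,
    Function.update_of_ne hbt.symm, Function.update_of_ne hab, Bool.xor_assoc, Bool.xor_self,
    Bool.xor_false, h1 _ _ true, Function.update_idem]
  refine (hmul _ _ _ (phaseA_mul_conj _ _) (phaseAB_mul_conj _ _)
    (phaseB_mul_conj _ _) (x t) fun d => ψ (Function.update x t d)).trans ?_
  rw [Bool.xor_comm (x b), phase_mul]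
  cases f (x a) (x b) <;> cases x t <;> simp [sgn]

end Gates

end

section

open ComplexConjugate

/-! ### Programs -/

section Programs

variable {ι : Type} {w : ι → ℕ} {N : ℕ}

theorem CGate.step_step (G : CGate N) (x : Bits N) : G.step (G.step x) = x := by
  simp [CGate.step, G.hat, G.hbt]

theorem CGate.step_of_ne (G : CGate N) (x : Bits N) {i : Fin N} (h : i ≠ G.t) :
    G.step x i = x i := Function.update_of_ne h _ _

/-- The instructions from which the algorithm is composed: classical gates, rotations of the
wire `t` that may depend on the wire `a`, and calls to a black box. -/
inductive Op (w : ι → ℕ) (N : ℕ) : Type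
  | cl (G : CGate N) : Op w N
  | rot (a t : Fin N) (h : a ≠ t) (M : Bool → Matrix.unitaryGroup Bool ℂ) : Op w N
  | qry (o : ι) (dagger : Bool) (e : Fin (w o) ↪ Fin N) : Op w N

/-- The gates that perform an instruction. -/
def Op.circ : Op w N → Circuit w N
  | .cl G => G.circ
  | .rot a t h M => [rotGate a t h M]
  | .qry o dagger e => [.query o dagger e]

/-- The inverse instruction. -/
def Op.inv : Op w N → Op w N
  | .cl G => .cl G
  | .rot a t h M => .rot a t h fun b => (M b)⁻¹
  | .qry o dagger e => .qry o (!dagger) e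

/-- The wires that an instruction may change. -/
def Op.Writes : Op w N → Fin N → Prop
  | .cl G, i => i = G.t
  | .rot _ t _ _, i => i = t
  | .qry _ _ e, i => i ∈ Set.range e

/-- The wires that an instruction uses. -/
def Op.Touches : Op w N → Fin N → Prop
  | .cl G, i => i = G.a ∨ i = G.b ∨ i = G.t
  | .rot a t _ _, i => i = a ∨ i = t
  | .qry _ _ e, i => i ∈ Set.range e

theorem Op.writes_inv (g : Op w N) (i : Fin N) : g.inv.Writes i ↔ g.Writes i := by
  cases g <;> rfl

theorem Op.touches_inv (g : Op w N) (i : Fin N) : g.inv.Touches i ↔ g.Touches i := by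
  cases g <;> rfl

theorem Op.inv_inv (g : Op w N) : g.inv.inv = g := by
  cases g <;> simp [Op.inv]

/-- The state that an instruction produces from `ψ`. -/
def Op.sem (O : Oracles w) (g : Op w N) (ψ : QState N) : QState N := Circuit.run O g.circ ψ

theorem sem_cl (O : Oracles w) (G : CGate N) (ψ : QState N) (x : Bits N) :
    (Op.cl G).sem O ψ x = ψ (G.step x) := run_circ O G ψ x

theorem sem_rot (O : Oracles w) (a t : Fin N) (h : a ≠ t)
    (M : Bool → Matrix.unitaryGroup Bool ℂ) (ψ : QState N) (x : Bits N) :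
    (Op.rot a t h M : Op w N).sem O ψ x =
      ∑ b, (M (x a)).1 (x t) b * ψ (Function.update x t b) := by
  rw [Op.sem, Op.circ, run_cons, run_nil, act_rotGate]

theorem sem_qry (O : Oracles w) (o : ι) (dagger : Bool) (e : Fin (w o) ↪ Fin N) (ψ : QState N) :
    (Op.qry o dagger e : Op w N).sem O ψ = act (onWires e (maybeDagger dagger (O o).1)) ψ := by
  rw [Op.sem, Op.circ, run_cons, run_nil, Gate.toMatrix]

theorem maybeDagger_mul (V : Matrix.unitaryGroup (Bits N) ℂ) (b : Bool) :
    maybeDagger (!b) V.1 * maybeDagger b V.1 = 1 := by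
  cases b
  · exact Matrix.UnitaryGroup.star_mul_self V
  · exact Matrix.mem_unitaryGroup_iff.mp V.2

theorem sum_star_mul (M : Matrix.unitaryGroup Bool ℂ) (i j : Bool) :
    ∑ b, M⁻¹.1 i b * M.1 b j = if i = j then 1 else 0 := by
  have h := congrFun₂ (Matrix.UnitaryGroup.star_mul_self M) i j
  rwa [Matrix.mul_apply, Matrix.one_apply] at h

theorem Op.sem_inv_sem (O : Oracles w) (g : Op w N) (ψ : QState N) :
    g.inv.sem O (g.sem O ψ) = ψ := by
  ext x
  cases g with
  | cl G => rw [Op.inv, sem_cl, sem_cl, CGate.step_step]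
  | rot a t h M =>
    simp only [Op.inv, sem_rot, Function.update_self, Function.update_of_ne h,
      Function.update_idem, Finset.mul_sum, ← mul_assoc]
    rw [Finset.sum_comm]
    simp only [← Finset.sum_mul, sum_star_mul]
    simp
  | qry o dagger e =>
    rw [Op.inv, sem_qry, sem_qry, ← act_onWires_mul, maybeDagger_mul, act_onWires_one]

theorem run_add (O : Oracles w) (c : Circuit w N) (φ ψ : QState N) :
    Circuit.run O c (φ + ψ) = Circuit.run O c φ + Circuit.run O c ψ := by
  simp only [Circuit.run, act_eq_toEuclideanLin, map_add]

theorem run_smul (O : Oracles w) (c : Circuit w N) (r : ℂ) (ψ : QState N) :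
    Circuit.run O c (r • ψ) = r • Circuit.run O c ψ := by
  simp only [Circuit.run, act_eq_toEuclideanLin, map_smul]

theorem inner_rotGate (O : Oracles w) (a t : Fin N) (h : a ≠ t)
    (M : Bool → Matrix.unitaryGroup Bool ℂ) (φ ψ : QState N) :
    inner ℂ (act ((rotGate a t h M : Gate w N).toMatrix O) φ)
      (act ((rotGate a t h M : Gate w N).toMatrix O) ψ) = inner ℂ φ ψ :=
  inner_act_onWires _ ⟨rotMat M, rotMat_mem M⟩ φ ψ

theorem Op.inner_sem (O : Oracles w) (g : Op w N) (φ ψ : QState N) :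
    inner ℂ (g.sem O φ) (g.sem O ψ) = inner ℂ φ ψ := by
  cases g with
  | cl G => simp only [Op.sem, Op.circ, CGate.circ, run_cons, run_nil, inner_rotGate]
  | rot a t h M => simp only [Op.sem, Op.circ, run_cons, run_nil, inner_rotGate]
  | qry o dagger e =>
    rw [sem_qry, sem_qry]
    cases dagger
    · exact inner_act_onWires e (O o) φ ψ
    · exact inner_act_onWires e (O o)⁻¹ φ ψ

/-- A list of instructions, the first one being performed first. -/
abbrev Prog (w : ι → ℕ) (N : ℕ) : Type := List (Op w N)

namespace Prog

/-- The circuit of a program. -/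
def circ (P : Prog w N) : Circuit w N := P.flatMap Op.circ

/-- The inverse program. -/
def inv (P : Prog w N) : Prog w N := (P.map Op.inv).reverse

/-- The wires that a program may change. -/
def Writes (P : Prog w N) (i : Fin N) : Prop := ∃ g ∈ P, g.Writes i

/-- The wires that a program uses. -/
def Touches (P : Prog w N) (i : Fin N) : Prop := ∃ g ∈ P, g.Touches i

/-- The linear operator that a program performs. -/
def sem (O : Oracles w) (P : Prog w N) : QState N →ₗ[ℂ] QState N where
  toFun ψ := Circuit.run O P.circ ψ
  map_add' := run_add O _
  map_smul' := run_smul O _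

theorem sem_nil (O : Oracles w) (ψ : QState N) : sem O ([] : Prog w N) ψ = ψ := run_nil O ψ

theorem sem_append (O : Oracles w) (P Q : Prog w N) (ψ : QState N) :
    sem O (P ++ Q) ψ = sem O Q (sem O P ψ) := by
  simp [sem, circ, run_append]

theorem sem_cons (O : Oracles w) (g : Op w N) (P : Prog w N) (ψ : QState N) :
    sem O (g :: P) ψ = sem O P (g.sem O ψ) := by
  simp [sem, circ, run_append, Op.sem]

theorem inv_inv (P : Prog w N) : inv (inv P) = P := by
  simp [inv, Function.comp_def, Op.inv_inv]

theorem writes_inv {P : Prog w N} {i : Fin N} : (inv P).Writes i ↔ P.Writes i := by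
  simp [Writes, inv, Op.writes_inv]

theorem touches_inv {P : Prog w N} {i : Fin N} : (inv P).Touches i ↔ P.Touches i := by
  simp [Touches, inv, Op.touches_inv]

theorem writes_append {P Q : Prog w N} {i : Fin N} :
    (P ++ Q).Writes i ↔ P.Writes i ∨ Q.Writes i := by
  simp [Writes, or_and_right, exists_or]

theorem sem_inv_sem (O : Oracles w) (P : Prog w N) (ψ : QState N) :
    sem O (inv P) (sem O P ψ) = ψ := by
  induction P generalizing ψ with
  | nil => simp [inv, sem_nil]
  | cons g P ih =>
    have : inv (g :: P) = inv P ++ [g.inv] := by simp [inv]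
    rw [this, sem_append, sem_cons O g P, ih, sem_cons, sem_nil, Op.sem_inv_sem]

theorem sem_sem_inv (O : Oracles w) (P : Prog w N) (ψ : QState N) :
    sem O P (sem O (inv P) ψ) = ψ := by
  simpa only [inv_inv] using sem_inv_sem O (inv P) ψ

theorem inner_sem (O : Oracles w) (P : Prog w N) (φ ψ : QState N) :
    inner ℂ (sem O P φ) (sem O P ψ) = inner ℂ φ ψ := by
  induction P generalizing φ ψ with
  | nil => simp only [sem_nil]
  | cons g P ih => rw [sem_cons, sem_cons, ih, Op.inner_sem]

theorem norm_sem (O : Oracles w) (P : Prog w N) (ψ : QState N) : ‖sem O P ψ‖ = ‖ψ‖ := by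
  rw [norm_eq_sqrt_re_inner (𝕜 := ℂ), norm_eq_sqrt_re_inner (𝕜 := ℂ), inner_sem]

end Prog

/-! ### Wires that are not changed -/

/-- The state `ψ` is a superposition of basis states whose bit `i` is `b`. -/
def FixedAt (i : Fin N) (b : Bool) (ψ : QState N) : Prop := ∀ x, x i ≠ b → ψ x = 0

/-- Flip the bit `i`. -/
def flipBit (i : Fin N) (x : Bits N) : Bits N := Function.update x i (!x i)

@[simp] theorem flipBit_flipBit (i : Fin N) (x : Bits N) : flipBit i (flipBit i x) = x := by
  simp [flipBit]

theorem flipBit_self (i : Fin N) (x : Bits N) : flipBit i x i = !x i := by simp [flipBit]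

theorem flipBit_of_ne {i j : Fin N} (h : j ≠ i) (x : Bits N) : flipBit i x j = x j := by
  simp [flipBit, h]

theorem flipBit_update {i t : Fin N} (h : t ≠ i) (x : Bits N) (b : Bool) :
    Function.update (flipBit i x) t b = flipBit i (Function.update x t b) := by
  rw [flipBit, flipBit, Function.update_comm h, Function.update_of_ne h.symm]

/-- The operator that flips the qubit `i`. -/
def flip (i : Fin N) : QState N →ₗ[ℂ] QState N where
  toFun ψ := WithLp.toLp 2 fun x => ψ (flipBit i x)
  map_add' _ _ := rfl
  map_smul' _ _ := rfl

@[simp] theorem flip_apply (i : Fin N) (ψ : QState N) (x : Bits N) :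
    flip i ψ x = ψ (flipBit i x) := rfl

theorem flip_ket (i : Fin N) (x : Bits N) : flip i (ket x) = ket (flipBit i x) := by
  ext y
  simp only [flip_apply, ket_apply]
  congr 1
  exact propext ⟨fun h => by rw [← h, flipBit_flipBit], fun h => by rw [h, flipBit_flipBit]⟩

theorem norm_flip (i : Fin N) (ψ : QState N) : ‖flip i ψ‖ = ‖ψ‖ := by
  rw [EuclideanSpace.norm_eq, EuclideanSpace.norm_eq]
  congr 1
  exact Equiv.sum_comp (Function.Involutive.toPerm (flipBit i) (flipBit_flipBit i))
    fun x => ‖ψ x‖ ^ 2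

/-- An instruction commutes with a bit flip on a wire that it does not use. -/
theorem Op.sem_flip (O : Oracles w) (g : Op w N) {i : Fin N} (h : ¬ g.Touches i) (ψ : QState N) :
    g.sem O (flip i ψ) = flip i (g.sem O ψ) := by
  ext x
  cases g with
  | cl G =>
    simp only [Op.Touches, not_or] at h
    simp only [flip_apply, sem_cl, CGate.step, flipBit_of_ne (Ne.symm h.1),
      flipBit_of_ne (Ne.symm h.2.1), flipBit_of_ne (Ne.symm h.2.2), flipBit_update (Ne.symm h.2.2)]
  | rot a t hat M =>
    simp only [Op.Touches, not_or] at h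
    simp only [flip_apply, sem_rot, flipBit_of_ne (Ne.symm h.1), flipBit_of_ne (Ne.symm h.2),
      flipBit_update (Ne.symm h.2)]
  | qry o dagger e =>
    have h' : ∀ j, e j ≠ i := fun j hj => h ⟨j, hj⟩
    simp only [flip_apply, sem_qry, act_onWires_apply, flipBit_of_ne (h' _)]
    refine Finset.sum_congr rfl fun z _ => ?_
    refine congrArg (fun y => _ * ψ y) (funext fun j => ?_)
    by_cases hj : ∃ k, e k = j
    · obtain ⟨k, rfl⟩ := hj
      rw [flipBit_of_ne (h' k), e.injective.extend_apply, e.injective.extend_apply]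
    · have hi : ¬ ∃ k, e k = i := fun ⟨k, hk⟩ => h' k hk
      by_cases hji : j = i
      · subst hji
        rw [flipBit_self, Function.extend_apply' _ _ _ hi, Function.extend_apply' _ _ _ hi,
          flipBit_self]
      · rw [flipBit_of_ne hji, Function.extend_apply' _ _ _ hj, Function.extend_apply' _ _ _ hj,
          flipBit_of_ne hji]

/-- An instruction preserves the value of a wire that it may use as a control but does not write to.
-/
theorem Op.fixedAt_sem (O : Oracles w) (g : Op w N) {i : Fin N} (h : ¬ g.Writes i) {b : Bool}
    {ψ : QState N} (hψ : FixedAt i b ψ) : FixedAt i b (g.sem O ψ) := by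
  intro x hx
  cases g with
  | cl G => rw [sem_cl]; exact hψ _ (by rwa [CGate.step_of_ne G x h])
  | rot a t hat M =>
    rw [sem_rot]
    refine Finset.sum_eq_zero fun c _ => ?_
    rw [hψ _ (by rwa [Function.update_of_ne h]), mul_zero]
  | qry o dagger e =>
    rw [sem_qry, act_onWires_apply]
    refine Finset.sum_eq_zero fun c _ => ?_
    rw [hψ _ (by rwa [Function.extend_apply' _ _ _ h]), mul_zero]

theorem Prog.sem_flip (O : Oracles w) (P : Prog w N) {i : Fin N} (h : ¬ P.Touches i)
    (ψ : QState N) : P.sem O (flip i ψ) = flip i (P.sem O ψ) := by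
  induction P generalizing ψ with
  | nil => simp only [Prog.sem_nil]
  | cons g P ih =>
    rw [Prog.sem_cons, Prog.sem_cons, Op.sem_flip O g fun hg => h ⟨g, by simp, hg⟩]
    exact ih (fun ⟨g', hg', h'⟩ => h ⟨g', by simp [hg'], h'⟩) _

theorem Prog.fixedAt_sem (O : Oracles w) (P : Prog w N) {i : Fin N} (h : ¬ P.Writes i) {b : Bool}
    {ψ : QState N} (hψ : FixedAt i b ψ) : FixedAt i b (P.sem O ψ) := by
  induction P generalizing ψ with
  | nil => simpa only [Prog.sem_nil]
  | cons g P ih =>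
    rw [Prog.sem_cons]
    exact ih (fun ⟨g', hg', h'⟩ => h ⟨g', by simp [hg'], h'⟩)
      (Op.fixedAt_sem O g (fun hg => h ⟨g, by simp, hg⟩) hψ)

theorem fixedAt_ket (i : Fin N) (x : Bits N) : FixedAt i (x i) (ket x) := fun y hy => by
  rw [ket_apply, if_neg fun h => hy (by rw [h])]

theorem FixedAt.add {i : Fin N} {b : Bool} {φ ψ : QState N} (hφ : FixedAt i b φ)
    (hψ : FixedAt i b ψ) : FixedAt i b (φ + ψ) := fun x hx => by
  rw [PiLp.add_apply, hφ x hx, hψ x hx, add_zero]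

theorem FixedAt.smul {i : Fin N} {b : Bool} {ψ : QState N} (hψ : FixedAt i b ψ) (r : ℂ) :
    FixedAt i b (r • ψ) := fun x hx => by
  rw [PiLp.smul_apply, hψ x hx, smul_zero]

theorem FixedAt.flip_self {i : Fin N} {b : Bool} {ψ : QState N} (hψ : FixedAt i b ψ) :
    FixedAt i (!b) (flip i ψ) := fun x hx => by
  rw [flip_apply]
  refine hψ _ ?_
  rw [flipBit_self]
  simpa using hx

theorem FixedAt.flip_of_ne {i j : Fin N} (h : i ≠ j) {b : Bool} {ψ : QState N}
    (hψ : FixedAt i b ψ) : FixedAt i b (flip j ψ) := fun x hx => by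
  rw [flip_apply]
  exact hψ _ (by rwa [flipBit_of_ne h])

/-! ### Classical programs -/

/-- The effect of a list of classical gates on bit strings. -/
def crun (c : List (CGate N)) (x : Bits N) : Bits N := c.foldl (fun y G => G.step y) x

/-- The program that performs a list of classical gates. -/
def cprog (c : List (CGate N)) : Prog w N := c.map Op.cl

@[simp] theorem crun_nil (x : Bits N) : crun [] x = x := rfl

@[simp] theorem crun_cons (G : CGate N) (c : List (CGate N)) (x : Bits N) :
    crun (G :: c) x = crun c (G.step x) := rfl

theorem crun_append (c c' : List (CGate N)) (x : Bits N) :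
    crun (c ++ c') x = crun c' (crun c x) := List.foldl_append ..

theorem crun_reverse_crun (c : List (CGate N)) (x : Bits N) : crun c.reverse (crun c x) = x := by
  induction c generalizing x with
  | nil => rfl
  | cons G c ih =>
    rw [List.reverse_cons, crun_append, crun_cons, crun_nil, crun_cons, ih, CGate.step_step]

theorem inv_cprog (c : List (CGate N)) : Prog.inv (cprog c : Prog w N) = cprog c.reverse := by
  simp [Prog.inv, cprog, Function.comp_def, Op.inv]

theorem cprog_append (c c' : List (CGate N)) :
    (cprog (c ++ c') : Prog w N) = cprog c ++ cprog c' := List.map_append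

/-- Classical programs permute amplitudes. -/
theorem sem_cprog_crun (O : Oracles w) (c : List (CGate N)) (ψ : QState N) (x : Bits N) :
    Prog.sem O (cprog c) ψ (crun c x) = ψ x := by
  induction c generalizing ψ x with
  | nil => rw [cprog, List.map_nil, Prog.sem_nil, crun_nil]
  | cons G c ih =>
    rw [cprog, List.map_cons, Prog.sem_cons, crun_cons]
    have := ih ((Op.cl G).sem O ψ) (G.step x)
    rw [sem_cl, CGate.step_step] at this
    exact this

theorem sem_cprog_ket (O : Oracles w) (c : List (CGate N)) (x : Bits N) :
    Prog.sem O (cprog c) (ket x) = ket (crun c x) := by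
  ext y
  have hy : y = crun c (crun c.reverse y) := by
    simpa using (crun_reverse_crun c.reverse y).symm
  have h : crun c.reverse y = x ↔ y = crun c x :=
    ⟨fun h => by rw [← h]; exact hy, fun h => by rw [h, crun_reverse_crun]⟩
  rw [ket_apply, hy, sem_cprog_crun, ket_apply, ← hy]
  simp only [h]

theorem crun_of_ne {c : List (CGate N)} {i : Fin N} (h : ∀ G ∈ c, i ≠ G.t) (x : Bits N) :
    crun c x i = x i := by
  induction c generalizing x with
  | nil => rfl
  | cons G c ih =>
    rw [crun_cons, ih (fun G' hG' => h G' (by simp [hG'])), CGate.step_of_ne G x (h G (by simp))]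

/-- In a list of classical gates of which none changes a wire that an earlier one uses, the final
values of the wires satisfy the equations that the gates express. -/
theorem crun_eq {c : List (CGate N)}
    (hc : c.Pairwise fun G G' => G'.t ≠ G.a ∧ G'.t ≠ G.b ∧ G'.t ≠ G.t) (x : Bits N) :
    ∀ G ∈ c, crun c x G.t = xor (x G.t) (G.f (crun c x G.a) (crun c x G.b)) := by
  induction c generalizing x with
  | nil => simp
  | cons H c ih =>
    rw [List.pairwise_cons] at hc
    intro G hG
    rw [crun_cons]
    rcases List.mem_cons.mp hG with rfl | hG
    · rw [crun_of_ne (fun G' hG' => ((hc.1 G' hG').1).symm),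
        crun_of_ne (fun G' hG' => ((hc.1 G' hG').2.1).symm),
        crun_of_ne (fun G' hG' => ((hc.1 G' hG').2.2).symm)]
      rw [CGate.step_of_ne _ _ G.hat, CGate.step_of_ne _ _ G.hbt]
      exact Function.update_self _ _ _
    · rw [ih hc.2 _ G hG, CGate.step_of_ne _ _ (hc.1 G hG).2.2]

/-- Conjugating a sign flip by a classical program: the sign depends on a computed bit. -/
theorem sem_cprog_reverse_sign (O : Oracles w) (c : List (CGate N)) (P : Prog w N)
    (s : Bits N → ℂ) (hP : ∀ ψ x, P.sem O ψ x = s x * ψ x) (ψ : QState N) (x : Bits N) :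
    Prog.sem O (cprog c ++ P ++ cprog c.reverse) ψ x = s (crun c x) * ψ x := by
  rw [Prog.sem_append, Prog.sem_append]
  have h := sem_cprog_crun O c.reverse (P.sem O ((cprog c : Prog w N).sem O ψ)) (crun c x)
  rw [crun_reverse_crun] at h
  rw [h, hP, sem_cprog_crun]

end Programs

end

section

open ComplexConjugate

/-! ### The controlled walk operator -/

section Walk

variable {ι : Type} {w : ι → ℕ} {N : ℕ}

/-- The reflection `(-1) ^ x_f`. -/
def signAt (f : Fin N) : QState N →ₗ[ℂ] QState N where
  toFun ψ := WithLp.toLp 2 fun x => sgn (x f) * ψ x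
  map_add' φ ψ := by ext x; simp [mul_add]
  map_smul' r ψ := by ext x; simp [mul_left_comm]

@[simp] theorem signAt_apply (f : Fin N) (ψ : QState N) (x : Bits N) :
    signAt f ψ x = sgn (x f) * ψ x := rfl

theorem sgn_mul_self (b : Bool) : sgn b * sgn b = 1 := by cases b <;> simp [sgn]

theorem signAt_signAt (f : Fin N) (ψ : QState N) : signAt f (signAt f ψ) = ψ := by
  ext x; simp [← mul_assoc, sgn_mul_self]

theorem norm_signAt (f : Fin N) (ψ : QState N) : ‖signAt f ψ‖ = ‖ψ‖ := by
  rw [EuclideanSpace.norm_eq, EuclideanSpace.norm_eq]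
  congr 1
  refine Finset.sum_congr rfl fun x _ => ?_
  rw [signAt_apply, norm_mul]
  cases x f <;> simp [sgn]

theorem FixedAt.signAt {i : Fin N} {b : Bool} {ψ : QState N} (hψ : FixedAt i b ψ) (f : Fin N) :
    FixedAt i b (signAt f ψ) := fun x hx => by rw [signAt_apply, hψ x hx, mul_zero]

/-- The states that agree with the basis state `x₀` on the wires in `F`. -/
def Adm (F : Set (Fin N)) (x₀ : Bits N) (ψ : QState N) : Prop := ∀ i ∈ F, FixedAt i (x₀ i) ψ

theorem adm_ket (F : Set (Fin N)) (x₀ : Bits N) : Adm F x₀ (ket x₀) := fun i _ => fixedAt_ket i x₀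

theorem Adm.add {F : Set (Fin N)} {x₀ : Bits N} {φ ψ : QState N} (hφ : Adm F x₀ φ)
    (hψ : Adm F x₀ ψ) : Adm F x₀ (φ + ψ) := fun i hi => (hφ i hi).add (hψ i hi)

theorem Adm.smul {F : Set (Fin N)} {x₀ : Bits N} {ψ : QState N} (hψ : Adm F x₀ ψ) (r : ℂ) :
    Adm F x₀ (r • ψ) := fun i hi => (hψ i hi).smul r

theorem Adm.sub {F : Set (Fin N)} {x₀ : Bits N} {φ ψ : QState N} (hφ : Adm F x₀ φ)
    (hψ : Adm F x₀ ψ) : Adm F x₀ (φ - ψ) := by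
  have := hφ.add (hψ.smul (-1))
  rwa [neg_one_smul, ← sub_eq_add_neg] at this

theorem Adm.signAt {F : Set (Fin N)} {x₀ : Bits N} {ψ : QState N} (hψ : Adm F x₀ ψ) (f : Fin N) :
    Adm F x₀ (signAt f ψ) := fun i hi => (hψ i hi).signAt f

theorem Adm.sem {F : Set (Fin N)} {x₀ : Bits N} {ψ : QState N} (hψ : Adm F x₀ ψ) (O : Oracles w)
    {P : Prog w N} (hP : ∀ i ∈ F, ¬ P.Writes i) : Adm F x₀ (P.sem O ψ) :=
  fun i hi => P.fixedAt_sem O (hP i hi) (hψ i hi)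

/-- The walk operator `A R A† Z`. -/
def walk (A R Z : Prog w N) : Prog w N := Z ++ Prog.inv A ++ R ++ A

/-- What the ingredients of the controlled walk operator have to satisfy: the wires in `F` are not
changed by the state preparation `A`, the program `R` performs the reflection about the basis state
`x₀` when the control wire `g` is set, and `Z` performs the reflection `(-1) ^ x_f` when the
wire `g` is set. -/
structure WalkData (O : Oracles w) (A R Z : Prog w N) (F : Set (Fin N)) (x₀ : Bits N)
    (g f : Fin N) : Prop where
  g_mem : g ∈ F
  x₀_g : x₀ g = false
  ne : f ≠ g
  A_writes : ∀ i ∈ F, ¬ A.Writes i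
  A_touches : ¬ A.Touches g
  sem_Z : ∀ ψ x, Z.sem O ψ x = (if x g && x f then -1 else 1) * ψ x
  sem_R : ∃ s : Bits N → ℂ, (∀ ψ x, R.sem O ψ x = s x * ψ x) ∧
    ∀ x, (∀ i ∈ F, i ≠ g → x i = x₀ i) →
      s x = if x g then (if x = flipBit g x₀ then 1 else -1) else 1

namespace WalkData

variable {O : Oracles w} {A R Z : Prog w N} {F : Set (Fin N)} {x₀ : Bits N} {g f : Fin N}

theorem fixedAt_g (H : WalkData O A R Z F x₀ g f) {v : QState N} (hv : Adm F x₀ v) :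
    FixedAt g false v := by
  have := hv g H.g_mem
  rwa [H.x₀_g] at this

theorem apply_eq_zero {v : QState N} (hv : Adm F x₀ v) {x : Bits N}
    (h : ¬ ∀ i ∈ F, x i = x₀ i) : v x = 0 := by
  push Not at h
  obtain ⟨i, hi, hx⟩ := h
  exact hv i hi x hx

/-- The walk is controlled: it does nothing while the signal qubit is `|0⟩`. -/
theorem sem_walk_of_adm (H : WalkData O A R Z F x₀ g f) {v : QState N} (hv : Adm F x₀ v) :
    (walk A R Z).sem O v = v := by
  obtain ⟨s, hs, hs'⟩ := H.sem_R
  rw [walk, Prog.sem_append, Prog.sem_append, Prog.sem_append]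
  have h1 : Z.sem O v = v := by
    ext x
    rw [H.sem_Z]
    by_cases hx : x g = false
    · simp [hx]
    · rw [H.fixedAt_g hv x hx, mul_zero]
  have hχ : Adm F x₀ ((Prog.inv A).sem O v) :=
    hv.sem O fun i hi h => H.A_writes i hi (Prog.writes_inv.mp h)
  have h2 : R.sem O ((Prog.inv A).sem O v) = (Prog.inv A).sem O v := by
    ext x
    rw [hs]
    by_cases hx : ∀ i ∈ F, x i = x₀ i
    · have hg := hx g H.g_mem
      rw [hs' x fun i hi _ => hx i hi, hg, H.x₀_g]
      simp
    · rw [apply_eq_zero hχ hx, mul_zero]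
  rw [h1, h2, Prog.sem_sem_inv]

/-- While the signal qubit is `|1⟩`, the walk is the product of the reflection `Z` and the
reflection `2 |ψ⟩⟨ψ| - 1` about the state `ψ = A |x₀⟩`. -/
theorem sem_walk_flip (H : WalkData O A R Z F x₀ g f) {v : QState N} (hv : Adm F x₀ v) :
    (walk A R Z).sem O (flip g v) =
      flip g ((2 * inner ℂ (A.sem O (ket x₀)) (signAt f v)) • A.sem O (ket x₀) - signAt f v) := by
  obtain ⟨s, hs, hs'⟩ := H.sem_R
  have hy := hv.signAt f
  set y := signAt f v with hyd
  rw [walk, Prog.sem_append, Prog.sem_append, Prog.sem_append]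
  have h1 : Z.sem O (flip g v) = flip g y := by
    ext x
    rw [H.sem_Z, flip_apply, flip_apply, hyd, signAt_apply, flipBit_of_ne H.ne]
    by_cases hx : x g = true
    · simp [hx, sgn]
    · rw [H.fixedAt_g hv _ (by simpa [flipBit_self] using hx), mul_zero, mul_zero]
  have hAinv : ¬ (Prog.inv A).Touches g := fun h => H.A_touches (Prog.touches_inv.mp h)
  have hχ : Adm F x₀ ((Prog.inv A).sem O y) :=
    hy.sem O fun i hi h => H.A_writes i hi (Prog.writes_inv.mp h)
  rw [h1, Prog.sem_flip O _ hAinv]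
  set χ := (Prog.inv A).sem O y with hχd
  have hinner : inner ℂ (A.sem O (ket x₀)) y = χ x₀ := by
    rw [← inner_ket_left, ← Prog.inner_sem O A (ket x₀) χ, hχd, Prog.sem_sem_inv]
  have h2 : R.sem O (flip g χ) = flip g ((2 * χ x₀) • ket x₀ - χ) := by
    ext x
    rw [hs, flip_apply, flip_apply, PiLp.sub_apply, PiLp.smul_apply, ket_apply]
    by_cases hx : ∀ i ∈ F, flipBit g x i = x₀ i
    · have hg := hx g H.g_mem
      rw [flipBit_self, H.x₀_g, Bool.not_eq_false'] at hg
      rw [hs' x fun i hi hig => by rw [← hx i hi, flipBit_of_ne hig], hg, if_pos rfl]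
      by_cases hxx : flipBit g x = x₀
      · rw [if_pos hxx, if_pos (by rw [← hxx, flipBit_flipBit]), hxx]
        simp only [smul_eq_mul]
        ring
      · rw [if_neg hxx, if_neg fun h => hxx (by rw [h, flipBit_flipBit])]
        simp
    · have h0 : flipBit g x ≠ x₀ := fun h => hx fun i _ => by rw [h]
      rw [apply_eq_zero hχ hx, if_neg h0]
      simp
  rw [h2, Prog.sem_flip O _ H.A_touches, map_sub, map_smul, hχd, Prog.sem_sem_inv, ← hχd, hinner]

end WalkData

/-! ### Signal processing of the walk operator -/

/-- The rotation of the signal qubit `g`; the wire `d` is a spectator. -/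
def signalRot (d g : Fin N) (h : d ≠ g) (M : Matrix.unitaryGroup Bool ℂ) : Op w N :=
  .rot d g h fun _ => M

/-- Rotations of the signal qubit `g` that alternate with the program `W`. -/
def signalProg (W : Prog w N) (d g : Fin N) (h : d ≠ g) (M₀ : Matrix.unitaryGroup Bool ℂ)
    (Ms : List (Matrix.unitaryGroup Bool ℂ)) : Prog w N :=
  signalRot d g h M₀ :: Ms.flatMap fun M => W ++ [signalRot d g h M]

theorem sem_signalRot (O : Oracles w) {d g : Fin N} (h : d ≠ g)
    (M : Matrix.unitaryGroup Bool ℂ) {v : QState N} (hv : FixedAt g false v) (a : Bool → ℂ) :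
    (signalRot d g h M : Op w N).sem O (a false • v + a true • flip g v) =
      (M.1 *ᵥ a) false • v + (M.1 *ᵥ a) true • flip g v := by
  have hup : ∀ x, v (Function.update x g true) = 0 := fun x => hv _ (by simp)
  have hfl : ∀ x b, flipBit g (Function.update x g b) = Function.update x g (!b) := fun x b => by
    simp [flipBit]
  ext x
  simp only [signalRot, sem_rot, PiLp.add_apply, PiLp.smul_apply, flip_apply, smul_eq_mul,
    Fintype.sum_bool, hfl, hup, Bool.not_true, Bool.not_false, mul_zero, add_zero, zero_add,
    Matrix.mulVec, dotProduct]
  cases hx : x g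
  · have h1 : Function.update x g false = x := by rw [← hx, Function.update_eq_self]
    have h2 : v (flipBit g x) = 0 := hv _ (by simp [flipBit_self, hx])
    rw [h1, h2]
    ring
  · have h1 : Function.update x g false = flipBit g x := by rw [flipBit, hx]; rfl
    have h2 : v x = 0 := hv _ (by simp [hx])
    rw [h1, h2]
    ring

/-- On an eigenvector of the walk with eigenvalue `z` the program acts on the signal qubit alone,
and produces the signal amplitudes at `z`. -/
theorem sem_signalProg (O : Oracles w) {W : Prog w N} {d g : Fin N} (h : d ≠ g)
    (M₀ : Matrix.unitaryGroup Bool ℂ) (Ms : List (Matrix.unitaryGroup Bool ℂ)) {v : QState N}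
    (hv : FixedAt g false v) (h0 : W.sem O v = v) {z : ℂ}
    (h1 : W.sem O (flip g v) = z • flip g v) :
    (signalProg W d g h M₀ Ms).sem O v =
      signalAmp M₀ Ms z false • v + signalAmp M₀ Ms z true • flip g v := by
  have key : ∀ a : Bool → ℂ,
      Prog.sem O (Ms.flatMap fun M => W ++ [signalRot d g h M])
        (a false • v + a true • flip g v) =
      (Ms.foldl (fun v M => M.1 *ᵥ fun b => (if b then z else 1) * v b) a) false • v +
      (Ms.foldl (fun v M => M.1 *ᵥ fun b => (if b then z else 1) * v b) a) true • flip g v := by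
    induction Ms with
    | nil => intro a; exact Prog.sem_nil O _
    | cons M Ms ih =>
      intro a
      rw [List.flatMap_cons, Prog.sem_append, Prog.sem_append, Prog.sem_cons, Prog.sem_nil,
        map_add, map_smul, map_smul, h0, h1]
      have := sem_signalRot O h M hv fun b => (if b then z else 1) * a b
      simp only [Bool.false_eq_true, if_false, if_true, one_mul] at this
      rw [smul_smul, mul_comm (a true), this, ih]
      rfl
  rw [signalProg, Prog.sem_cons]
  have h2 := sem_signalRot O h M₀ hv fun b => if b then 0 else 1
  simp only [Bool.false_eq_true, if_false, if_true, one_smul, zero_smul, add_zero] at h2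
  rw [h2, key]
  have h3 : M₀.1 *ᵥ (fun b => if b then 0 else 1) = fun b => M₀.1 b false := by
    funext b
    simp [Matrix.mulVec, dotProduct]
  simp only [signalAmp, ← h3]

namespace WalkData

variable {O : Oracles w} {A R Z : Prog w N} {F : Set (Fin N)} {x₀ : Bits N} {g f : Fin N}

/-- The state `ψ = A |x₀⟩` lies in the invariant plane spanned by `ψ` and `Z ψ`, on which the
walk operator has the eigenvalues `z` with `|z| = 1` and real part `⟨ψ, Z ψ⟩`. Signal processing
multiplies the eigencomponents by the corresponding signal amplitudes. -/
theorem exists_signal_components (H : WalkData O A R Z F x₀ g f) {d : Fin N} (hd : d ≠ g)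
    (M₀ : Matrix.unitaryGroup Bool ℂ) (Ms : List (Matrix.unitaryGroup Bool ℂ)) {u : ℝ}
    (hu : inner ℂ (A.sem O (ket x₀)) (signAt f (A.sem O (ket x₀))) = (u : ℂ)) :
    ∃ ψ : Bool → QState N, (∀ b, Adm F x₀ (ψ b)) ∧
      (signalProg (walk A R Z) d g hd M₀ Ms).sem O (A.sem O (ket x₀)) =
        ψ false + flip g (ψ true) ∧
      ∀ b δ, (∀ z : ℂ, ‖z‖ = 1 → z.re = u → ‖signalAmp M₀ Ms z b‖ ≤ δ) → ‖ψ b‖ ≤ 2 * δ := by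
  set Ψ := A.sem O (ket x₀) with hΨ
  set Φ := signAt f Ψ with hΦ
  have hAΨ : Adm F x₀ Ψ := (adm_ket F x₀).sem O H.A_writes
  have hAΦ : Adm F x₀ Φ := hAΨ.signAt f
  have hnΨ : ‖Ψ‖ = 1 := by rw [hΨ, Prog.norm_sem, norm_ket]
  have hnΦ : ‖Φ‖ = 1 := by rw [hΦ, norm_signAt, hnΨ]
  have hΨΨ : inner ℂ Ψ Ψ = (1 : ℂ) := by rw [inner_self_eq_norm_sq_to_K, hnΨ]; simp
  have hΦΦ : inner ℂ Φ Φ = (1 : ℂ) := by rw [inner_self_eq_norm_sq_to_K, hnΦ]; simp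
  have hu' : inner ℂ Φ Ψ = (u : ℂ) := by rw [← inner_conj_symm, hu, Complex.conj_ofReal]
  have hu1 : |u| ≤ 1 := by
    have := norm_inner_le_norm (𝕜 := ℂ) Ψ Φ
    rwa [hu, hnΨ, hnΦ, Complex.norm_real, mul_one] at this
  -- the eigenvectors in the invariant plane
  have heig : ∀ z : ℂ, ‖z‖ = 1 → z.re = u →
      (walk A R Z).sem O (flip g (Ψ - conj z • Φ)) = z • flip g (Ψ - conj z • Φ) := by
    intro z hz hzu
    have hzz : z * conj z = 1 := by rw [Complex.mul_conj', hz]; simp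
    have hzs : z + conj z = 2 * (u : ℂ) := by rw [Complex.add_conj, hzu]; push_cast; rfl
    rw [H.sem_walk_flip (hAΨ.sub (hAΦ.smul _)), ← map_smul (flip g) z, ← hΨ]
    congr 1
    rw [map_sub, map_smul, hΦ, signAt_signAt, ← hΦ, inner_sub_right, inner_smul_right, hu, hΨΨ,
      mul_one, smul_sub, smul_smul, hzz, one_smul]
    have : z = 2 * (u - conj z) + conj z := by linear_combination hzs
    nth_rewrite 3 [this]
    rw [add_smul]
    abel
  have hsig : ∀ z : ℂ, ‖z‖ = 1 → z.re = u → ∀ c : ℂ,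
      (signalProg (walk A R Z) d g hd M₀ Ms).sem O (c • (Ψ - conj z • Φ)) =
        (c * signalAmp M₀ Ms z false) • (Ψ - conj z • Φ) +
          flip g ((c * signalAmp M₀ Ms z true) • (Ψ - conj z • Φ)) := by
    intro z hz hzu c
    have hv : Adm F x₀ (Ψ - conj z • Φ) := hAΨ.sub (hAΦ.smul _)
    rw [map_smul, sem_signalProg O hd M₀ Ms (H.fixedAt_g hv) (H.sem_walk_of_adm hv)
      (heig z hz hzu), smul_add, smul_smul, smul_smul, map_smul]
  have hnv : ∀ z : ℂ, ‖z‖ = 1 → z.re = u → ‖Ψ - conj z • Φ‖ ^ 2 = 2 * (1 - u ^ 2) := by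
    intro z hz hzu
    rw [@norm_sub_sq ℂ, inner_smul_right, hu, norm_smul, RCLike.norm_conj, hz, hnΨ, hnΦ]
    simp [hzu]
    ring
  rcases eq_or_lt_of_le hu1 with h1 | h1
  · -- the degenerate case: `Ψ` is itself an eigenvector
    have hu2 : u ^ 2 = 1 := by rw [← sq_abs, h1, one_pow]
    have hz : ‖(u : ℂ)‖ = 1 := by rw [Complex.norm_real, Real.norm_eq_abs, h1]
    have h2 := hnv u hz (Complex.ofReal_re u)
    rw [hu2, sub_self, mul_zero, sq_eq_zero_iff, norm_eq_zero, Complex.conj_ofReal,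
      sub_eq_zero] at h2
    have hΦu : Φ = (u : ℂ) • Ψ := by
      rw [h2, smul_smul]
      have : (u : ℂ) * u = 1 := by rw [← pow_two]; exact_mod_cast hu2
      rw [this, one_smul]
    have hw : (walk A R Z).sem O (flip g Ψ) = (u : ℂ) • flip g Ψ := by
      rw [H.sem_walk_flip hAΨ, ← map_smul (flip g), ← hΨ, ← hΦ, hu]
      congr 1
      rw [hΦu, two_mul, add_smul, add_sub_cancel_right]
    refine ⟨fun b => signalAmp M₀ Ms u b • Ψ, fun b => hAΨ.smul _, ?_, fun b δ hδ => ?_⟩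
    · rw [sem_signalProg O hd M₀ Ms (H.fixedAt_g hAΨ) (H.sem_walk_of_adm hAΨ) hw, map_smul]
    · have h3 := hδ u hz (Complex.ofReal_re u)
      rw [norm_smul, hnΨ, mul_one]
      linarith [norm_nonneg (signalAmp M₀ Ms u b)]
  · have hpos : 0 < 1 - u ^ 2 := by rw [← sq_abs]; nlinarith [abs_nonneg u]
    set s := √(1 - u ^ 2) with hs
    have hs0 : 0 < s := Real.sqrt_pos.mpr hpos
    have hs2 : s ^ 2 = 1 - u ^ 2 := Real.sq_sqrt hpos.le
    set z : ℂ := ⟨u, s⟩ with hzd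
    have hz : ‖z‖ = 1 := by
      rw [← pow_eq_one_iff_of_nonneg (norm_nonneg z) two_ne_zero, ← Complex.normSq_eq_norm_sq,
        Complex.normSq_mk]
      linarith [hs2]
    have hz' : ‖conj z‖ = 1 := by rw [RCLike.norm_conj, hz]
    have hzi : z - conj z = 2 * s * Complex.I := by
      rw [Complex.sub_conj]; push_cast; ring
    have hne : z - conj z ≠ 0 := by
      rw [hzi]
      have : (s : ℂ) ≠ 0 := by exact_mod_cast hs0.ne'
      simp [this]
    have hnz : ‖z - conj z‖ = 2 * s := by
      rw [hzi]; simp [abs_of_pos hs0]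
    -- the expansion of `Ψ` in the two eigenvectors
    have hsplit : Ψ = (z / (z - conj z)) • (Ψ - conj z • Φ) +
        (-conj z / (z - conj z)) • (Ψ - conj (conj z) • Φ) := by
      have h2 : z / (z - conj z) + -conj z / (z - conj z) = 1 := by
        rw [← add_div, ← sub_eq_add_neg, div_self hne]
      have h3 : z / (z - conj z) * conj z + -conj z / (z - conj z) * z = 0 := by ring
      rw [Complex.conj_conj, smul_sub, smul_sub, smul_smul, smul_smul]
      calc Ψ = (z / (z - conj z) + -conj z / (z - conj z)) • Ψ -
            (z / (z - conj z) * conj z + -conj z / (z - conj z) * z) • Φ := by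
              rw [h2, h3, one_smul, zero_smul, sub_zero]
        _ = _ := by rw [add_smul, add_smul]; abel
    have hbound : ∀ y : ℂ, ‖y‖ = 1 → y.re = u → ∀ c a : ℂ, ‖c‖ = 1 →
        ‖(c / (z - conj z) * a) • (Ψ - conj y • Φ)‖ ≤ ‖a‖ := by
      intro y hy hyu c a hc
      have h2 : ‖Ψ - conj y • Φ‖ ≤ 2 * s :=
        le_of_sq_le_sq (by rw [hnv y hy hyu, mul_pow, hs2]; linarith) (by positivity)
      rw [norm_smul, norm_mul, norm_div, hc, hnz]
      calc 1 / (2 * s) * ‖a‖ * ‖Ψ - conj y • Φ‖ ≤ 1 / (2 * s) * ‖a‖ * (2 * s) := by gcongr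
        _ = ‖a‖ := by field_simp
    refine ⟨fun b => (z / (z - conj z) * signalAmp M₀ Ms z b) • (Ψ - conj z • Φ) +
        (-conj z / (z - conj z) * signalAmp M₀ Ms (conj z) b) • (Ψ - conj (conj z) • Φ),
      fun b => ((hAΨ.sub (hAΦ.smul _)).smul _).add ((hAΨ.sub (hAΦ.smul _)).smul _), ?_,
      fun b δ hδ => ?_⟩
    · conv_lhs => rw [hsplit]
      rw [map_add, hsig z hz rfl, hsig (conj z) hz' rfl, map_add (flip g)]
      exact add_add_add_comm _ _ _ _
    · have h2 := (hbound z hz rfl z _ hz).trans (hδ z hz rfl)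
      have h3 := (hbound (conj z) hz' rfl (-conj z) _ (by rw [norm_neg, hz'])).trans
        (hδ (conj z) hz' rfl)
      linarith [norm_add_le ((z / (z - conj z) * signalAmp M₀ Ms z b) • (Ψ - conj z • Φ))
        ((-conj z / (z - conj z) * signalAmp M₀ Ms (conj z) b) • (Ψ - conj (conj z) • Φ))]

end WalkData

end Walk

end

section

open ComplexConjugate

/-! ### Computing, copying and uncomputing the decision -/

section Core

variable {ι : Type} {w : ι → ℕ} {N : ℕ}

/-- The wires `g`, `q`, `o`: add to the wire `o` the bit `g`, unless the wire `q` is set. -/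
def copyGate (g q o : Fin N) (hgq : g ≠ q) (hgo : g ≠ o) (hqo : q ≠ o) : CGate N :=
  ⟨g, q, o, fun a b => a && !b, hgq, hgo, hqo⟩

/-- Run `U`, copy the decision, and undo `U`. -/
def copyDecision (U : Prog w N) (G : CGate N) : Prog w N := U ++ [Op.cl G] ++ Prog.inv U

theorem sem_copy_of_control {O : Oracles w} {g q o : Fin N} (hgq : g ≠ q) (hgo : g ≠ o)
    (hqo : q ≠ o) {ψ : QState N} (hψ : FixedAt q true ψ) :
    (Op.cl (copyGate g q o hgq hgo hqo) : Op w N).sem O ψ = ψ := by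
  ext x
  rw [sem_cl]
  by_cases hx : x q = true
  · simp [copyGate, CGate.step, hx]
  · rw [hψ x hx, hψ]
    rwa [CGate.step_of_ne _ _ hqo]

theorem sem_copy_of_not {O : Oracles w} {g q o : Fin N} (hgq : g ≠ q) (hgo : g ≠ o) (hqo : q ≠ o)
    {ψ : QState N} (hψ : FixedAt g false ψ) :
    (Op.cl (copyGate g q o hgq hgo hqo) : Op w N).sem O ψ = ψ := by
  ext x
  rw [sem_cl]
  by_cases hx : x g = false
  · simp [copyGate, CGate.step, hx]
  · rw [hψ x hx, hψ]
    rwa [CGate.step_of_ne _ _ hgo]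

theorem sem_copy_flip {O : Oracles w} {g q o : Fin N} (hgq : g ≠ q) (hgo : g ≠ o) (hqo : q ≠ o)
    {ψ : QState N} (hg : FixedAt g true ψ) (hq : FixedAt q false ψ) :
    (Op.cl (copyGate g q o hgq hgo hqo) : Op w N).sem O ψ = flip o ψ := by
  ext x
  rw [sem_cl, flip_apply]
  by_cases hx : x g = true ∧ x q = false
  · simp [copyGate, CGate.step, hx, flipBit]
  · rw [not_and_or] at hx
    rcases hx with hx | hx
    · rw [hg, hg]
      · rwa [flipBit_of_ne hgo]
      · rwa [CGate.step_of_ne _ _ hgo]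
    · rw [hq, hq]
      · rwa [flipBit_of_ne hqo]
      · rwa [CGate.step_of_ne _ _ hqo]

/-- If one of the two components of the state before the copy is small, then the decision is
copied without disturbing the state much, and undoing `U` restores the other wires. -/
theorem decide_bounds {O : Oracles w} {g q o : Fin N} (hgq : g ≠ q) (hgo : g ≠ o) (hqo : q ≠ o)
    {U : Prog w N} {x₀ : Bits N} (hU : ¬ U.Touches o) {ψ₀ ψ₁ : QState N}
    (hg₀ : FixedAt g false ψ₀) (hg₁ : FixedAt g true ψ₁) (hq₀ : FixedAt q (x₀ q) ψ₀)
    (hq₁ : FixedAt q (x₀ q) ψ₁) (hsem : U.sem O (ket x₀) = ψ₀ + ψ₁) :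
    (x₀ q = true → (copyDecision U (copyGate g q o hgq hgo hqo)).sem O (ket x₀) = ket x₀) ∧
    (x₀ q = false →
      ‖(copyDecision U (copyGate g q o hgq hgo hqo)).sem O (ket x₀) - ket x₀‖ ≤ 2 * ‖ψ₁‖ ∧
      ‖(copyDecision U (copyGate g q o hgq hgo hqo)).sem O (ket x₀) - ket (flipBit o x₀)‖ ≤
        2 * ‖ψ₀‖) := by
  have hadd : ∀ φ ψ : QState N, (Op.cl (copyGate g q o hgq hgo hqo) : Op w N).sem O (φ + ψ) =
      (Op.cl (copyGate g q o hgq hgo hqo) : Op w N).sem O φ +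
        (Op.cl (copyGate g q o hgq hgo hqo) : Op w N).sem O ψ := run_add O _
  have hrun : (copyDecision U (copyGate g q o hgq hgo hqo)).sem O (ket x₀) =
      (Prog.inv U).sem O ((Op.cl (copyGate g q o hgq hgo hqo) : Op w N).sem O (ψ₀ + ψ₁)) := by
    rw [copyDecision, Prog.sem_append, Prog.sem_append, hsem, Prog.sem_cons, Prog.sem_nil]
  constructor
  · intro hx
    rw [hx] at hq₀ hq₁
    rw [hrun, sem_copy_of_control hgq hgo hqo (hq₀.add hq₁), ← hsem, Prog.sem_inv_sem]
  · intro hx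
    rw [hx] at hq₁
    have hback : ∀ φ χ : QState N, ‖(Prog.inv U).sem O φ - χ‖ = ‖φ - U.sem O χ‖ := fun φ χ => by
      rw [← Prog.norm_sem O U, map_sub, Prog.sem_sem_inv]
    rw [hrun, hadd, sem_copy_of_not hgq hgo hqo hg₀, sem_copy_flip hgq hgo hqo hg₁ hq₁, hback,
      hback, ← flip_ket, Prog.sem_flip O U hU, hsem, map_add]
    constructor
    · rw [add_sub_add_left_eq_sub]
      linarith [norm_sub_le (flip o ψ₁) ψ₁, norm_flip o ψ₁]
    · rw [add_sub_add_right_eq_sub]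
      linarith [norm_sub_le ψ₀ (flip o ψ₀), norm_flip o ψ₀]

/-! ### Running time of programs -/

theorem time_append (T : ℝ) (c c' : Circuit w N) :
    Circuit.time T (c ++ c') = Circuit.time T c + Circuit.time T c' := by
  simp [Circuit.time]

/-- The running time of a program. -/
def Prog.time (T : ℝ) (P : Prog w N) : ℝ := Circuit.time T P.circ

theorem Prog.time_nil (T : ℝ) : Prog.time T ([] : Prog w N) = 0 := rfl

theorem Prog.time_append (T : ℝ) (P Q : Prog w N) :
    Prog.time T (P ++ Q) = Prog.time T P + Prog.time T Q := by
  rw [Prog.time, Prog.circ, List.flatMap_append, QSim.time_append]; rfl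

theorem Prog.time_cons (T : ℝ) (g : Op w N) (P : Prog w N) :
    Prog.time T (g :: P) = Circuit.time T g.circ + Prog.time T P := by
  rw [Prog.time, Prog.circ, List.flatMap_cons, QSim.time_append]; rfl

theorem time_cl (T : ℝ) (G : CGate N) : Circuit.time T (Op.cl G : Op w N).circ = 5 := by
  simp only [Op.circ, CGate.circ, Circuit.time, rotGate, Gate.time, List.map_cons, List.map_nil,
    List.sum_cons, List.sum_nil]
  norm_num

theorem time_rot (T : ℝ) (a t : Fin N) (h : a ≠ t) (M : Bool → Matrix.unitaryGroup Bool ℂ) :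
    Circuit.time T (Op.rot a t h M : Op w N).circ = 1 := by
  simp [Op.circ, Circuit.time, rotGate, Gate.time]

theorem time_qry (T : ℝ) (o : ι) (b : Bool) (e : Fin (w o) ↪ Fin N) :
    Circuit.time T (Op.qry o b e : Op w N).circ = T := by
  simp [Op.circ, Circuit.time, Gate.time]

theorem Prog.time_inv (T : ℝ) (P : Prog w N) : Prog.time T (Prog.inv P) = Prog.time T P := by
  induction P with
  | nil => rfl
  | cons g P ih =>
    have h : Prog.inv (g :: P) = Prog.inv P ++ [g.inv] := by simp [Prog.inv]
    rw [h, Prog.time_append, ih, Prog.time_cons, Prog.time_nil, Prog.time_cons, add_zero, add_comm]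
    congr 1
    cases g
    · rfl
    · simp [Op.inv, time_rot]
    · simp [Op.inv, time_qry]

theorem Prog.time_cprog (T : ℝ) (c : List (CGate N)) :
    Prog.time T (cprog c : Prog w N) = 5 * c.length := by
  induction c with
  | nil => simp [cprog, Prog.time_nil]
  | cons G c ih =>
    rw [cprog, List.map_cons, Prog.time_cons, time_cl]
    rw [cprog] at ih
    rw [ih]
    push_cast [List.length_cons]
    ring

theorem Prog.time_flatMap_le {α : Type*} (T B : ℝ) (l : List α) (P : α → Prog w N)
    (h : ∀ a, Prog.time T (P a) ≤ B) : Prog.time T (l.flatMap P) ≤ l.length * B := by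
  induction l with
  | nil => simp [Prog.time_nil]
  | cons a l ih =>
    rw [List.flatMap_cons, Prog.time_append]
    push_cast [List.length_cons]
    linarith [h a]

theorem Prog.time_map_rot {α : Type*} (T : ℝ) (l : List α) (P : α → Op w N)
    (h : ∀ a, Circuit.time T (P a).circ = 1) : Prog.time T (l.map P) = l.length := by
  induction l with
  | nil => simp [Prog.time_nil]
  | cons a l ih =>
    rw [List.map_cons, Prog.time_cons, h a, ih]
    push_cast [List.length_cons]
    ring

/-! ### Hadamard gates and sign gates -/

/-- The amplitude `1 / √2`. -/
def invSqrtTwo : ℂ := ((√2)⁻¹ : ℝ)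

theorem invSqrtTwo_mul_self : invSqrtTwo * invSqrtTwo = 1 / 2 := by
  rw [invSqrtTwo, ← Complex.ofReal_mul, ← mul_inv, Real.mul_self_sqrt (by norm_num)]
  norm_num

theorem norm_invSqrtTwo_sq : ‖invSqrtTwo‖ ^ 2 = 1 / 2 := by
  rw [invSqrtTwo, Complex.norm_real, Real.norm_eq_abs, sq_abs, inv_pow,
    Real.sq_sqrt (by norm_num)]
  norm_num

/-- The Hadamard matrix. -/
def hadamard : Matrix.unitaryGroup Bool ℂ :=
  ⟨Matrix.of fun i j => invSqrtTwo * sgn (i && j), by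
    have h := invSqrtTwo_mul_self
    have hc : conj invSqrtTwo = invSqrtTwo := Complex.conj_ofReal _
    rw [Matrix.mem_unitaryGroup_iff]
    ext i j
    cases i <;> cases j <;>
      (simp [Matrix.mul_apply, Matrix.star_apply, sgn, hc, h]; try norm_num)⟩

/-- The matrix `diag(1, -1)`. -/
def pauliZ : Matrix.unitaryGroup Bool ℂ :=
  ⟨Matrix.of fun i j => if i = j then sgn i else 0, by
    rw [Matrix.mem_unitaryGroup_iff]
    ext i j
    cases i <;> cases j <;> simp [Matrix.mul_apply, Matrix.star_apply, sgn]⟩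

/-- The Hadamard gate on the wire `a`; the wire `d` is a spectator. -/
def had (d a : Fin N) (h : d ≠ a) : Op w N := .rot d a h fun _ => hadamard

theorem sem_had (O : Oracles w) {d a : Fin N} (h : d ≠ a) (ψ : QState N) (x : Bits N) :
    (had d a h : Op w N).sem O ψ x =
      invSqrtTwo * (ψ (Function.update x a false) + sgn (x a) * ψ (Function.update x a true)) := by
  rw [had, sem_rot, Fintype.sum_bool]
  simp only [hadamard, Matrix.of_apply, Bool.and_true, Bool.and_false, sgn, Bool.false_eq_true,
    if_false]
  ring

/-- The sign gate on the wire `a`; the wire `d` is a spectator. -/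
def signOp (d a : Fin N) (h : d ≠ a) : Op w N := .rot d a h fun _ => pauliZ

theorem sem_signOp (O : Oracles w) {d a : Fin N} (h : d ≠ a) (ψ : QState N) (x : Bits N) :
    (signOp d a h : Op w N).sem O ψ x = sgn (x a) * ψ x := by
  rw [signOp, sem_rot, Finset.sum_eq_single (x a)]
  · simp [pauliZ]
  · intro b _ hb
    simp [pauliZ, hb.symm]
  · simp

/-- The sign gate on the wire `a` controlled by the wire `g`. -/
def ctrlSignOp (g a : Fin N) (h : g ≠ a) : Op w N := .rot g a h fun b => if b then pauliZ else 1

theorem sem_ctrlSignOp (O : Oracles w) {g a : Fin N} (h : g ≠ a) (ψ : QState N) (x : Bits N) :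
    (ctrlSignOp g a h : Op w N).sem O ψ x = (if x g && x a then -1 else 1) * ψ x := by
  rw [ctrlSignOp, sem_rot, Finset.sum_eq_single (x a)]
  · cases x g <;> simp [pauliZ, sgn]
  · intro b _ hb
    cases x g <;> simp [pauliZ, hb.symm, Matrix.one_apply_ne]
  · simp

/-- Set the bits in the list to zero. -/
def clearBits (l : List (Fin N)) (x : Bits N) : Bits N := fun i => if i ∈ l then false else x i

/-- Hadamard gates on qubits that are `|0⟩`. -/
theorem sem_hads {α : Type*} (O : Oracles w) (d : Fin N) (k : α → Fin N) (h : ∀ a, d ≠ k a)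
    (l : List α) (hl : (l.map k).Nodup) (ψ : QState N)
    (hψ : ∀ a ∈ l, FixedAt (k a) false ψ) (x : Bits N) :
    Prog.sem O (l.map fun a => (had d (k a) (h a) : Op w N)) ψ x =
      invSqrtTwo ^ l.length * ψ (clearBits (l.map k) x) := by
  induction l generalizing ψ with
  | nil => simp [show clearBits [] x = x by funext i; simp [clearBits], Prog.sem_nil]
  | cons a l ih =>
    rw [List.map_cons, List.nodup_cons] at hl
    rw [List.map_cons, Prog.sem_cons, ih hl.2, sem_had,
      hψ a (by simp) (Function.update _ (k a) true) (by simp), mul_zero, add_zero,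
      List.length_cons, pow_succ, mul_assoc]
    · refine congrArg (fun y => _ * (_ * ψ y)) (funext fun i => ?_)
      by_cases hi : i = k a
      · subst hi; simp [clearBits]
      · simp [clearBits, hi]
    · intro a' ha'
      refine Op.fixedAt_sem O _ ?_ (hψ a' (by simp [ha']))
      intro hk
      exact hl.1 (by
        have : k a' = k a := hk
        rw [← this]
        exact List.mem_map_of_mem ha')

/-! ### Loading data -/

/-- The value of the observable `(-1) ^ x_f` after a program that permutes the basis states that
occur in `ψ`. -/
theorem inner_signAt_sem (O : Oracles w) (P : Prog w N) (f : Fin N) (ψ : QState N)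
    (τ : Bits N → Bits N) (h : ∀ x, ψ x ≠ 0 → P.sem O (ket x) = ket (τ x)) :
    inner ℂ (P.sem O ψ) (signAt f (P.sem O ψ)) = ∑ x, ((‖ψ x‖ ^ 2 : ℝ) : ℂ) * sgn (τ x f) := by
  have h1 : signAt f (P.sem O ψ) =
      P.sem O (WithLp.toLp 2 fun x => sgn (τ x f) * ψ x) := by
    conv_lhs => rw [state_eq_sum_ket ψ]
    rw [state_eq_sum_ket (WithLp.toLp 2 fun x => sgn (τ x f) * ψ x)]
    simp only [map_sum, map_smul]
    refine Finset.sum_congr rfl fun x _ => ?_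
    by_cases hx : ψ x = 0
    · simp [hx]
    · rw [h x hx, mul_comm, mul_smul]
      congr 1
      ext y
      rw [signAt_apply, PiLp.smul_apply, ket_apply, smul_eq_mul]
      split_ifs with hy
      · rw [hy]
      · simp
  rw [h1, Prog.inner_sem, PiLp.inner_apply]
  refine Finset.sum_congr rfl fun x _ => ?_
  rw [RCLike.inner_apply, mul_assoc, Complex.mul_conj']
  push_cast
  ring

theorem tensor_apply {M K : ℕ} (φ : QState M) (ψ : QState K) (x : Bits (M + K)) :
    tensor φ ψ x = φ (fun i => x (Fin.castAdd K i)) * ψ (fun j => x (Fin.natAdd M j)) := rfl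

theorem tensor_ket_ket {M K : ℕ} (x : Bits M) (y : Bits K) :
    tensor (ket x) (ket y) = ket (Fin.append x y) := by
  ext z
  rw [tensor_apply, ket_apply, ket_apply, ket_apply]
  by_cases h : z = Fin.append x y
  · subst h; simp
  · rw [if_neg h, mul_eq_zero]
    by_contra! hne
    refine h (funext fun i => ?_)
    have h1 : (fun i => z (Fin.castAdd K i)) = x := by by_contra h'; simp [h'] at hne
    have h2 : (fun j => z (Fin.natAdd M j)) = y := by by_contra h'; simp [h'] at hne
    refine Fin.addCases (fun i => ?_) (fun j => ?_) i
    · rw [Fin.append_left, ← h1]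
    · rw [Fin.append_right, ← h2]

/-- The action of an operator on selected wires of a basis state. -/
theorem act_onWires_ket {k : ℕ} (e : Fin k ↪ Fin N) (V : Matrix (Bits k) (Bits k) ℂ) (x : Bits N) :
    act (onWires e V) (ket x) =
      ∑ z, act V (ket fun j => x (e j)) z • ket (Function.extend e z x) := by
  have he := e.injective
  ext y
  have hV : ∀ z, act V (ket fun j => x (e j)) z = V z fun j => x (e j) := fun z => by
    simp [act_apply, ket_apply]
  rw [act_onWires_apply]
  simp only [hV, WithLp.ofLp_sum, WithLp.ofLp_smul, Finset.sum_apply, Pi.smul_apply, smul_eq_mul,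
    ket_apply, mul_ite, mul_one, mul_zero]
  by_cases h : ∀ i, (∀ j, e j ≠ i) → x i = y i
  · have h1 : ∀ z, Function.extend e z y = x ↔ z = fun j => x (e j) := fun z => by
      constructor
      · intro hz
        funext j
        rw [← hz, he.extend_apply]
      · rintro rfl
        funext i
        by_cases hi : ∃ j, e j = i
        · obtain ⟨j, rfl⟩ := hi
          rw [he.extend_apply]
        · rw [Function.extend_apply' _ _ _ hi, h i (by simpa using hi)]
    have h2 : ∀ z, y = Function.extend e z x ↔ z = fun j => y (e j) := fun z => by
      constructor
      · intro hz
        funext j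
        rw [hz, he.extend_apply]
      · rintro rfl
        funext i
        by_cases hi : ∃ j, e j = i
        · obtain ⟨j, rfl⟩ := hi
          rw [he.extend_apply]
        · rw [Function.extend_apply' _ _ _ hi, h i (by simpa using hi)]
    simp [h1, h2]
  · have h1 : ∀ z, Function.extend e z y ≠ x := fun z hz => h fun i hi => by
      rw [← hz, Function.extend_apply' _ _ _ (by simpa using hi)]
    have h2 : ∀ z, y ≠ Function.extend e z x := fun z hz => h fun i hi => by
      rw [hz, Function.extend_apply' _ _ _ (by simpa using hi)]
    simp [h1, h2]

/-- The wires of a query: an index register, a data register and a workspace. -/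
def loadEmb {k l m : ℕ} (a : Fin k → Fin N) (b : Fin l → Fin N) (c : Fin m → Fin N)
    (h : Function.Injective (Fin.append (Fin.append a b) c)) : Fin (k + l + m) ↪ Fin N :=
  ⟨Fin.append (Fin.append a b) c, h⟩

theorem CGate.step_extend {k : ℕ} (G : CGate N) {b : Fin k → Fin N} (hb : Function.Injective b)
    (ha : ∀ j, b j ≠ G.a) (hb' : ∀ j, b j ≠ G.b) (ht : ∀ j, b j ≠ G.t) (z : Bits k) (x : Bits N) :
    G.step (Function.extend b z x) = Function.extend b z (G.step x) := by
  have hext : ∀ i, (∀ j, b j ≠ i) → ∀ x : Bits N, Function.extend b z x i = x i := fun i hi x =>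
    Function.extend_apply' _ _ _ (by simpa using hi)
  rw [CGate.step, hext _ ha, hext _ hb', hext _ ht]
  funext i
  by_cases hi : ∃ j, b j = i
  · obtain ⟨j, rfl⟩ := hi
    rw [Function.update_of_ne (ht j), hb.extend_apply, hb.extend_apply]
  · rw [Function.extend_apply' _ _ _ hi]
    by_cases hit : i = G.t
    · subst hit; simp [CGate.step]
    · rw [Function.update_of_ne hit, CGate.step_of_ne _ _ hit, Function.extend_apply' _ _ _ hi]

/-- A classical program commutes with replacing bits on wires that it does not use. -/
theorem crun_extend {k : ℕ} (c : List (CGate N)) {b : Fin k → Fin N} (hb : Function.Injective b)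
    (h : ∀ G ∈ c, ∀ j, b j ≠ G.a ∧ b j ≠ G.b ∧ b j ≠ G.t) (z : Bits k) (x : Bits N) :
    crun c (Function.extend b z x) = Function.extend b z (crun c x) := by
  induction c generalizing x with
  | nil => rfl
  | cons G c ih =>
    rw [crun_cons, crun_cons, CGate.step_extend G hb (fun j => (h G (by simp) j).1)
      (fun j => (h G (by simp) j).2.1) (fun j => (h G (by simp) j).2.2),
      ih fun G' hG' => h G' (by simp [hG'])]

/-- A black box whose index wires hold `i`, while its data and work wires hold zeros, writes the
state `φ` into the data wires. -/
theorem act_load {k l m : ℕ} (V : Matrix (Bits (k + l + m)) (Bits (k + l + m)) ℂ)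
    (a : Fin k → Fin N) (b : Fin l → Fin N) (r : Fin m → Fin N)
    (he : Function.Injective (Fin.append (Fin.append a b) r)) {i : Bits k} {φ : QState l}
    (hV : act V (tensor (tensor (ket i) (zeroKet l)) (zeroKet m)) =
      tensor (tensor (ket i) φ) (zeroKet m)) {x : Bits N}
    (ha : ∀ j, x (a j) = i j) (hb : ∀ j, x (b j) = false) (hr : ∀ j, x (r j) = false) :
    act (onWires (loadEmb a b r he) V) (ket x) = ∑ z, φ z • ket (Function.extend b z x) := by
  have hbinj : Function.Injective b := fun j j' h => by
    have := @he (Fin.castAdd m (Fin.natAdd k j)) (Fin.castAdd m (Fin.natAdd k j'))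
      (by simpa using h)
    simpa using this
  have hin : (fun j => x (loadEmb a b r he j)) =
      Fin.append (Fin.append i fun _ => false) fun _ => false := by
    funext j
    induction j using Fin.addCases with
    | left j =>
      induction j using Fin.addCases with
      | left j =>
        simp [loadEmb, ha]
      | right j =>
        simp [loadEmb, hb]
    | right j =>
      simp [loadEmb, hr]
  rw [act_onWires_ket, hin, ← tensor_ket_ket, ← tensor_ket_ket]
  have hV' : act V (tensor (tensor (ket i) (ket fun _ => false)) (ket fun _ => false)) =
    tensor (tensor (ket i) φ) (zeroKet m) := hV
  rw [hV']
  symm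
  refine Finset.sum_of_injOn (fun z => Fin.append (Fin.append i z) fun _ => false) ?_ (by simp)
    ?_ ?_
  · intro z _ z' _ h
    funext j
    have := congrFun h (Fin.castAdd m (Fin.natAdd k j))
    simpa using this
  · intro Z _ hZ
    rw [tensor_apply, tensor_apply, zeroKet, ket_apply, ket_apply]
    by_cases h1 : (fun j => Z (Fin.castAdd m (Fin.castAdd l j))) = i
    · by_cases h2 : (fun j => Z (Fin.natAdd (k + l) j)) = fun _ => false
      · refine absurd ⟨fun j => Z (Fin.castAdd m (Fin.natAdd k j)), by simp, ?_⟩ hZ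
        funext j
        induction j using Fin.addCases with
        | left j =>
          induction j using Fin.addCases with
          | left j =>
            simp [← h1]
          | right j =>
            simp
        | right j =>
          simpa using (congrFun h2 j).symm
      · rw [if_neg h2]; simp
    · rw [if_neg h1]; simp
  · intro z _
    have h1 : tensor (tensor (ket i) φ) (zeroKet m)
        (Fin.append (Fin.append i z) fun _ => false) = φ z := by
      simp [tensor_apply, zeroKet, ket_apply]
    have h2 : Function.extend (loadEmb a b r he) (Fin.append (Fin.append i z) fun _ => false) x =
        Function.extend b z x := by
      have hoff : ∀ y, (∀ j, b j ≠ y) → Function.extend b z x y = x y := fun y hy =>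
        Function.extend_apply' _ _ _ (by simpa using hy)
      funext y
      by_cases hy : ∃ j, loadEmb a b r he j = y
      · obtain ⟨j, rfl⟩ := hy
        rw [(loadEmb a b r he).injective.extend_apply]
        have hne : ∀ J J', J ≠ J' →
            Fin.append (Fin.append a b) r J ≠ Fin.append (Fin.append a b) r J' :=
          fun J J' h h' => h (he h')
        induction j using Fin.addCases with
        | left j =>
          induction j using Fin.addCases with
          | left j =>
            rw [hoff]
            · simp [loadEmb, ha]
            · intro j'
              have := hne (Fin.castAdd m (Fin.natAdd k j')) (Fin.castAdd m (Fin.castAdd l j))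
                (by simp [Fin.ext_iff]; omega)
              simpa [loadEmb] using this
          | right j =>
            have : loadEmb a b r he (Fin.castAdd m (Fin.natAdd k j)) = b j := by simp [loadEmb]
            rw [this, hbinj.extend_apply]
            simp
        | right j =>
          rw [hoff]
          · simp [loadEmb, hr]
          · intro j'
            have := hne (Fin.castAdd m (Fin.natAdd k j')) (Fin.natAdd (k + l) j)
              (by simp [Fin.ext_iff]; omega)
            simpa [loadEmb] using this
      · rw [Function.extend_apply' _ _ _ hy, hoff]
        intro j hj
        exact hy ⟨Fin.castAdd m (Fin.natAdd k j), by simpa [loadEmb] using hj⟩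
    rw [h1, h2]

/-- A query between a classical computation of the index and its uncomputation: the black box
loads the state `φ` into the data register. -/
theorem sem_load (O : Oracles w) {k l m : ℕ} (q : Op w N) (c : List (CGate N))
    (V : Matrix (Bits (k + l + m)) (Bits (k + l + m)) ℂ)
    (a : Fin k → Fin N) (b : Fin l → Fin N) (r : Fin m → Fin N)
    (he : Function.Injective (Fin.append (Fin.append a b) r))
    (hq : ∀ ψ, q.sem O ψ = act (onWires (loadEmb a b r he) V) ψ)
    (hc : ∀ G ∈ c, ∀ j, b j ≠ G.a ∧ b j ≠ G.b ∧ b j ≠ G.t) {i : Bits k} {φ : QState l}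
    (hV : act V (tensor (tensor (ket i) (zeroKet l)) (zeroKet m)) =
      tensor (tensor (ket i) φ) (zeroKet m)) {x : Bits N}
    (ha : ∀ j, crun c x (a j) = i j) (hb : ∀ j, crun c x (b j) = false)
    (hr : ∀ j, crun c x (r j) = false) :
    Prog.sem O (cprog c ++ [q] ++ cprog c.reverse) (ket x) =
      ∑ z, φ z • ket (Function.extend b z x) := by
  have hbinj : Function.Injective b := fun j j' h => by
    have := @he (Fin.castAdd m (Fin.natAdd k j)) (Fin.castAdd m (Fin.natAdd k j'))
      (by simpa using h)
    simpa using this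
  rw [Prog.sem_append, Prog.sem_append, sem_cprog_ket, Prog.sem_cons, Prog.sem_nil, hq,
    act_load V a b r he hV ha hb hr]
  simp only [map_sum, map_smul, sem_cprog_ket, ← crun_extend c hbinj hc, crun_reverse_crun]

end Core

end

section

open ComplexConjugate

/-! ### The expectation of the sampled sign -/

/-- The bit `x i` at the largest position `i` with `k i = true`, or `false` if there is none. For
uniformly random `k` this bit is set with probability `bitsVal x / 2 ^ b`. -/
def sampleBit : (b : ℕ) → (k x : Fin b → Bool) → Bool
  | 0, _, _ => false
  | b + 1, k, x =>
    if k (Fin.last b) then x (Fin.last b)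
    else sampleBit b (fun i => k i.castSucc) fun i => x i.castSucc

/-- The recursion by which a circuit computes the sampled bit. -/
theorem eq_sampleBit {b : ℕ} (k x : Fin b → Bool) (T : Fin (b + 1) → Bool) (h0 : T 0 = false)
    (hs : ∀ i : Fin b, T i.succ = xor (k i && x i) (!k i && T i.castSucc)) :
    T (Fin.last b) = sampleBit b k x := by
  induction b with
  | zero => exact h0
  | succ b ih =>
    have h1 := hs (Fin.last b)
    have h2 := ih (fun i => k i.castSucc) (fun i => x i.castSucc) (fun i => T i.castSucc) h0
      fun i => hs i.castSucc
    rw [Fin.succ_last] at h1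
    rw [h1, h2, sampleBit]
    cases k (Fin.last b) <;> simp

theorem bitsVal_succ {b : ℕ} (x : Bits (b + 1)) :
    bitsVal x = bitsVal (fun i => x i.castSucc) + if x (Fin.last b) then 2 ^ b else 0 := by
  simp [bitsVal, Fin.sum_univ_castSucc]

theorem sum_sampleBit (b : ℕ) (x : Fin b → Bool) :
    ∑ k : Fin b → Bool, (if sampleBit b k x then (1 : ℝ) else 0) = bitsVal x := by
  induction b with
  | zero => simp [sampleBit, bitsVal]
  | succ b ih =>
    rw [← (Fin.snocEquiv fun _ => Bool).sum_comp, Fintype.sum_prod_type, Fintype.sum_bool,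
      bitsVal_succ]
    simp only [Fin.snocEquiv, Equiv.coe_fn_mk, sampleBit, Fin.snoc_last, Fin.snoc_castSucc,
      if_true, Bool.false_eq_true, if_false, ih]
    cases x (Fin.last b) <;> simp [add_comm]

theorem bitsVal_castLE {b N : ℕ} (h : b ≤ N) (x : Bits N) (hx : bitsVal x < 2 ^ b) :
    bitsVal (fun i : Fin b => x (Fin.castLE h i)) = bitsVal x := by
  induction N with
  | zero =>
    obtain rfl : b = 0 := by omega
    rfl
  | succ N ih =>
    rcases Nat.eq_or_lt_of_le h with rfl | hlt
    · rfl
    · have hlast : x (Fin.last N) = false := by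
        by_contra hne
        have h1 : 2 ^ b ≤ 2 ^ N := Nat.pow_le_pow_right (by norm_num) (by omega)
        rw [bitsVal_succ, if_pos (by simpa using hne)] at hx
        omega
      have hv := bitsVal_succ x
      rw [hlast] at hv
      simp only [Bool.false_eq_true, if_false, add_zero] at hv
      rw [hv, ← ih (by omega) (fun i => x i.castSucc) (by rw [← hv]; exact hx)]
      rfl

/-- The sign `(-1) ^ b` as a real number. -/
def rsgn (b : Bool) : ℝ := if b then -1 else 1

theorem rsgn_cast (b : Bool) : ((rsgn b : ℝ) : ℂ) = sgn b := by cases b <;> simp [rsgn, sgn]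

/-- The expectation of the sampled sign. The outer sums run over the choice of the two data points,
the bit that records the interference, the fair coin and the random bits. The interference term
`c` extracts the product of the two amplitudes, and the coin `e` removes the contribution of the
outcomes in which a norm bit is not set. -/
theorem sum_sampled_sign {b : ℕ} {J : Type*} [Fintype J] (a : Bool → J → ℝ)
    (X : Bool → Fin b → Bool) :
    ∑ l : Bool, ∑ r : Bool, ∑ c : Bool, ∑ e : Bool, ∑ k₀ : Fin b → Bool, ∑ k₁ : Fin b → Bool,
      ∑ j, (1 / 2 : ℝ) ^ (5 + 2 * b) * (a l j + rsgn c * a r j) ^ 2 *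
        rsgn (if sampleBit b k₀ (X l) && sampleBit b k₁ (X r) then xor (xor l r) c else e) =
    1 / 4 * ∑ l : Bool, ∑ r : Bool, rsgn (xor l r) * (bitsVal (X l) / 2 ^ b) *
      (bitsVal (X r) / 2 ^ b) * ∑ j, a l j * a r j := by
  have hpow : (1 / 2 : ℝ) ^ (5 + 2 * b) * 8 = 1 / 4 * (1 / 2 ^ b) * (1 / 2 ^ b) := by
    rw [pow_add, two_mul, pow_add]
    simp only [one_div, inv_pow]
    ring
  have hF : ∀ l r : Bool, ∀ k₀ k₁ : Fin b → Bool, ∀ j,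
      ∑ c : Bool, ∑ e : Bool, (1 / 2 : ℝ) ^ (5 + 2 * b) * (a l j + rsgn c * a r j) ^ 2 *
        rsgn (if sampleBit b k₀ (X l) && sampleBit b k₁ (X r) then xor (xor l r) c else e) =
      1 / 4 * (rsgn (xor l r) * ((if sampleBit b k₀ (X l) then (1 : ℝ) else 0) * (1 / 2 ^ b)) *
        ((if sampleBit b k₁ (X r) then (1 : ℝ) else 0) * (1 / 2 ^ b)) * (a l j * a r j)) := by
    intro l r k₀ k₁ j
    simp only [Fintype.sum_bool]
    cases sampleBit b k₀ (X l) <;> cases sampleBit b k₁ (X r) <;> cases l <;> cases r <;>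
      simp [rsgn] <;> linear_combination (norm := (simp; ring)) (a _ j * a _ j) * hpow
  rw [Finset.mul_sum]
  refine Finset.sum_congr rfl fun l _ => ?_
  rw [Finset.mul_sum]
  refine Finset.sum_congr rfl fun r _ => ?_
  calc _ = ∑ k₀ : Fin b → Bool, ∑ k₁ : Fin b → Bool, ∑ j, ∑ c : Bool, ∑ e : Bool,
      (1 / 2 : ℝ) ^ (5 + 2 * b) * (a l j + rsgn c * a r j) ^ 2 *
        rsgn (if sampleBit b k₀ (X l) && sampleBit b k₁ (X r) then xor (xor l r) c else e) := by
        simp only [Fintype.sum_bool, Finset.sum_add_distrib]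
    _ = _ := by
        simp only [hF]
        simp only [← Finset.mul_sum, ← Finset.sum_mul, sum_sampleBit]
        ring

/-! ### Amplitude encodings -/

theorem natBits_injOn {N v v' : ℕ} (hv : v < 2 ^ N) (hv' : v' < 2 ^ N)
    (h : natBits N v = natBits N v') : v = v' := by
  refine Nat.eq_of_testBit_eq fun i => ?_
  by_cases hi : i < N
  · exact congrFun h ⟨i, hi⟩
  · rw [Nat.testBit_eq_false_of_lt, Nat.testBit_eq_false_of_lt]
    · exact hv'.trans_le (Nat.pow_le_pow_right (by norm_num) (by omega))
    · exact hv.trans_le (Nat.pow_le_pow_right (by norm_num) (by omega))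

theorem natBits_idx_injective (n : ℕ) :
    Function.Injective fun i : Fin n => natBits (idxWidth n) i := fun i j h => by
  have hlt : ∀ i : Fin n, (i : ℕ) < 2 ^ idxWidth n := fun i =>
    i.2.trans_le (Nat.le_pow_clog (by norm_num) n)
  exact Fin.ext (natBits_injOn (hlt i) (hlt j) h)

variable {n d : ℕ}

/-- The real amplitudes of the encoding of a data point. -/
def rowAmp (S : Matrix (Fin n) (Fin d) ℝ) (i : Fin n) (z : Bits (idxWidth d)) : ℝ :=
  ∑ j : Fin d, if z = natBits (idxWidth d) j then S i j / ‖row S i‖ else 0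

theorem rowState_apply (S : Matrix (Fin n) (Fin d) ℝ) (i : Fin n) (z : Bits (idxWidth d)) :
    rowState S i z = (rowAmp S i z : ℂ) := by
  simp only [rowState, rowAmp, idxKet, WithLp.ofLp_sum, WithLp.ofLp_smul, Finset.sum_apply,
    Pi.smul_apply, ket_apply, smul_eq_mul, mul_ite, mul_one, mul_zero]
  push_cast
  refine Finset.sum_congr rfl fun j _ => ?_
  split_ifs <;> simp

theorem sum_rowAmp_mul (S : Matrix (Fin n) (Fin d) ℝ) (i i' : Fin n) :
    ∑ z, rowAmp S i z * rowAmp S i' z =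
      inner ℝ (row S i) (row S i') / (‖row S i‖ * ‖row S i'‖) := by
  have h1 : ∀ (i : Fin n) (z : Bits (idxWidth d)), rowAmp S i z ≠ 0 →
      z ∈ Set.range fun j : Fin d => natBits (idxWidth d) j := by
    intro i z hz
    by_contra hne
    refine hz (Finset.sum_eq_zero fun j _ => if_neg fun h => hne ⟨j, h.symm⟩)
  have h2 : ∀ (i : Fin n) (j : Fin d), rowAmp S i (natBits (idxWidth d) j) =
      S i j / ‖row S i‖ := by
    intro i j
    rw [rowAmp, Finset.sum_eq_single j]
    · simp
    · intro j' _ hj'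
      exact if_neg fun h => hj' (natBits_idx_injective d h.symm)
    · simp
  rw [← Finset.sum_of_injOn (s := Finset.univ) (fun j : Fin d => natBits (idxWidth d) j)
    (f := fun j => S i j / ‖row S i‖ * (S i' j / ‖row S i'‖))
    (natBits_idx_injective d).injOn (by simp)]
  · rw [PiLp.inner_apply, Finset.sum_div]
    refine Finset.sum_congr rfl fun j _ => ?_
    simp [row]
    ring
  · intro z _ hz
    have : rowAmp S i z = 0 := by
      by_contra hne
      exact hz (by simpa using h1 i z hne)
    rw [this, zero_mul]
  · intro j _
    rw [h2, h2]

end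

section

open ComplexConjugate

/-! ### The wires of the algorithm -/

/-- The work qubits of the state preparation. `lft` and `rgt` select one of the two data points
for the two factors of an inner product, `mix` interferes their encodings, `coin` is a random bit,
`sel` is the selected data point, `par`, `both` and `dec` serve to compute the sampled sign, which
ends up in `dec`. The registers `idx`, `data`, `rwork`, `nrm`, `nwork` are those of the black boxes
(there is one norm register for each factor), and `rnd`, `lev` are used to turn a norm into a bit
that is set with probability proportional to the norm. -/
inductive Work (n d : ℕ) (L : AccessLayout) (b : ℕ) : Type
  | lft | rgt | mix | coin | sel | par | both | dec
  | idx (i : Fin (idxWidth n))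
  | data (j : Fin (idxWidth d))
  | rwork (j : Fin L.rowWork)
  | nwork (j : Fin L.normWork)
  | nrm (s : Bool) (j : Fin L.normBits)
  | rnd (s : Bool) (j : Fin b)
  | lev (s : Bool) (j : Fin (b + 1))

variable {n d : ℕ} {L : AccessLayout} {b : ℕ}

/-- A sum type with the elements of `Work`. -/
abbrev Work.Code (n d : ℕ) (L : AccessLayout) (b : ℕ) : Type :=
  Fin 8 ⊕ Fin (idxWidth n) ⊕ Fin (idxWidth d) ⊕ Fin L.rowWork ⊕ Fin L.normWork ⊕
    (Bool × Fin L.normBits) ⊕ (Bool × Fin b) ⊕ (Bool × Fin (b + 1))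

/-- The place of a work qubit in the sum type. -/
def Work.code : Work n d L b → Work.Code n d L b
  | .lft => .inl 0
  | .rgt => .inl 1
  | .mix => .inl 2
  | .coin => .inl 3
  | .sel => .inl 4
  | .par => .inl 5
  | .both => .inl 6
  | .dec => .inl 7
  | .idx i => .inr (.inl i)
  | .data j => .inr (.inr (.inl j))
  | .rwork j => .inr (.inr (.inr (.inl j)))
  | .nwork j => .inr (.inr (.inr (.inr (.inl j))))
  | .nrm s j => .inr (.inr (.inr (.inr (.inr (.inl (s, j))))))
  | .rnd s j => .inr (.inr (.inr (.inr (.inr (.inr (.inl (s, j)))))))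
  | .lev s j => .inr (.inr (.inr (.inr (.inr (.inr (.inr (s, j)))))))

/-- The work qubit at a place of the sum type. -/
def Work.decode : Work.Code n d L b → Work n d L b
  | .inl i => ![.lft, .rgt, .mix, .coin, .sel, .par, .both, .dec] i
  | .inr (.inl i) => .idx i
  | .inr (.inr (.inl j)) => .data j
  | .inr (.inr (.inr (.inl j))) => .rwork j
  | .inr (.inr (.inr (.inr (.inl j)))) => .nwork j
  | .inr (.inr (.inr (.inr (.inr (.inl (s, j)))))) => .nrm s j
  | .inr (.inr (.inr (.inr (.inr (.inr (.inl (s, j))))))) => .rnd s j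
  | .inr (.inr (.inr (.inr (.inr (.inr (.inr (s, j))))))) => .lev s j

theorem Work.decode_code (W : Work n d L b) : Work.decode W.code = W := by cases W <;> rfl

theorem Work.code_injective : Function.Injective (Work.code : Work n d L b → _) :=
  Function.LeftInverse.injective Work.decode_code

instance : Fintype (Work n d L b) := Fintype.ofInjective _ Work.code_injective

theorem card_work_le : Fintype.card (Work n d L b) ≤ 10 + idxWidth n + idxWidth d + L.rowWork +
    L.normWork + 2 * L.normBits + 4 * b := by
  refine (Fintype.card_le_of_injective _ Work.code_injective).trans ?_
  simp only [Fintype.card_sum, Fintype.card_prod, Fintype.card_fin, Fintype.card_bool]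
  omega

/-- The auxiliary qubits: the signal qubit `sig`, the qubit `eq` that records whether the two
indices are equal, a ladder of qubits to test whether all work qubits are `|0⟩`, and the work
qubits. -/
inductive Aux (n d : ℕ) (L : AccessLayout) (b : ℕ) : Type
  | sig | eq
  | lad (i : Fin (Fintype.card (Work n d L b) + 1))
  | work (W : Work n d L b)

/-- The place of an auxiliary qubit in a sum type. -/
def Aux.code : Aux n d L b →
    Bool ⊕ Fin (Fintype.card (Work n d L b) + 1) ⊕ Work n d L b
  | .sig => .inl false
  | .eq => .inl true
  | .lad i => .inr (.inl i)
  | .work W => .inr (.inr W)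

theorem Aux.code_injective : Function.Injective (Aux.code : Aux n d L b → _) := by
  intro a a' h
  cases a <;> cases a' <;> simp_all [Aux.code]

instance : Fintype (Aux n d L b) := Fintype.ofInjective _ Aux.code_injective

/-- The wires: the two index registers, the output qubit, and the auxiliary qubits. -/
inductive Wire (n d : ℕ) (L : AccessLayout) (b : ℕ) : Type
  | p (i : Fin (idxWidth n))
  | q (i : Fin (idxWidth n))
  | out
  | aux (ρ : Aux n d L b)

/-- The number of auxiliary qubits. -/
abbrev auxCount (n d : ℕ) (L : AccessLayout) (b : ℕ) : ℕ := Fintype.card (Aux n d L b)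

/-- The number of wires. -/
abbrev wireCount (n d : ℕ) (L : AccessLayout) (b : ℕ) : ℕ :=
  idxWidth n + idxWidth n + (1 + auxCount n d L b)

/-- The position of a wire. -/
def wr : Wire n d L b → Fin (wireCount n d L b)
  | .p i => Fin.castAdd _ (Fin.castAdd _ i)
  | .q i => Fin.castAdd _ (Fin.natAdd _ i)
  | .out => Fin.natAdd _ (Fin.castAdd _ 0)
  | .aux ρ => Fin.natAdd _ (Fin.natAdd _ (Fintype.equivFin _ ρ))

theorem wr_injective : Function.Injective (wr : Wire n d L b → _) := by
  intro a a' h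
  have hv := congrArg Fin.val h
  cases a <;> cases a' <;> simp only [wr, Fin.val_castAdd, Fin.val_natAdd] at hv
  case p.p i j => rw [Fin.ext hv]
  case q.q i j => rw [Fin.ext (Nat.add_left_cancel hv)]
  case aux.aux ρ σ =>
    rw [(Fintype.equivFin _).injective (Fin.ext (Nat.add_left_cancel (Nat.add_left_cancel hv)))]
  case out.out => rfl
  all_goals exfalso; clear h; omega

@[simp] theorem wr_inj {a a' : Wire n d L b} : wr a = wr a' ↔ a = a' := wr_injective.eq_iff

theorem wr_surjective : Function.Surjective (wr : Wire n d L b → _) := by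
  intro i
  induction i using Fin.addCases with
  | left i =>
    induction i using Fin.addCases with
    | left i => exact ⟨.p i, rfl⟩
    | right i => exact ⟨.q i, rfl⟩
  | right i =>
    induction i using Fin.addCases with
    | left i => exact ⟨.out, by rw [Subsingleton.elim i 0]; rfl⟩
    | right i => exact ⟨.aux ((Fintype.equivFin _).symm i), by simp [wr]⟩

/-- Basis labels are equal if they agree on every named wire. -/
theorem bits_ext {x y : Bits (wireCount n d L b)} (h : ∀ a : Wire n d L b, x (wr a) = y (wr a)) :
    x = y := funext fun i => by
  obtain ⟨a, rfl⟩ := wr_surjective i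
  exact h a

/-- The position of a work qubit. -/
abbrev wk (W : Work n d L b) : Fin (wireCount n d L b) := wr (.aux (.work W))

/-- The basis label with given bits. -/
def conf (v : Wire n d L b → Bool) : Bits (wireCount n d L b) :=
  Function.extend wr v fun _ => false

@[simp] theorem conf_wr (v : Wire n d L b → Bool) (a : Wire n d L b) : conf v (wr a) = v a :=
  wr_injective.extend_apply _ _ _

/-- The bits of the wires when the index registers hold `x` and `y`, the qubit `eq` holds `e`, and
all other qubits are `|0⟩`. -/
def baseVal (x y : Bits (idxWidth n)) (e : Bool) : Wire n d L b → Bool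
  | .p i => x i
  | .q i => y i
  | .aux .eq => e
  | _ => false

/-- The classical gate with the given function, inputs and target. -/
def cg (f : Bool → Bool → Bool) (a a' t : Wire n d L b) (h : a ≠ a' ∧ a ≠ t ∧ a' ≠ t) :
    CGate (wireCount n d L b) :=
  ⟨wr a, wr a', wr t, f, wr_injective.ne h.1, wr_injective.ne h.2.1, wr_injective.ne h.2.2⟩

section cg
variable (f : Bool → Bool → Bool) (a a' t : Wire n d L b) (h : a ≠ a' ∧ a ≠ t ∧ a' ≠ t)

@[simp] theorem cg_a : (cg f a a' t h).a = wr a := rfl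
@[simp] theorem cg_b : (cg f a a' t h).b = wr a' := rfl
@[simp] theorem cg_t : (cg f a a' t h).t = wr t := rfl
@[simp] theorem cg_f : (cg f a a' t h).f = f := rfl

end cg

/-! ### Copying an index into the index register of the black boxes -/

/-- Copy the index `q` or `p` into the index register, according to the qubit `s`. -/
def selIdx (s : Work n d L b) (hs : ∀ i, s ≠ .idx i) : List (CGate (wireCount n d L b)) :=
  (List.finRange (idxWidth n)).map (fun i =>
    cg (fun a c => !a && c) (.aux (.work s)) (.p i) (.aux (.work (.idx i)))
      (by simp [hs])) ++
  (List.finRange (idxWidth n)).map (fun i =>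
    cg (fun a c => a && c) (.aux (.work s)) (.q i) (.aux (.work (.idx i)))
      (by simp [hs]))

theorem pairwise_finRange_map {N k : ℕ} (G : Fin k → CGate N)
    (h : ∀ i j, i < j → (G j).t ≠ (G i).a ∧ (G j).t ≠ (G i).b ∧ (G j).t ≠ (G i).t) :
    ((List.finRange k).map G).Pairwise fun G G' => G'.t ≠ G.a ∧ G'.t ≠ G.b ∧ G'.t ≠ G.t :=
  List.pairwise_map.mpr ((List.pairwise_lt_finRange k).imp fun hij => h _ _ hij)

theorem crun_selIdx_of_ne {s : Work n d L b} (hs : ∀ i, s ≠ .idx i) {a : Wire n d L b}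
    (ha : ∀ i, a ≠ .aux (.work (.idx i))) (x : Bits (wireCount n d L b)) :
    crun (selIdx s hs) x (wr a) = x (wr a) := by
  refine crun_of_ne (fun G hG => ?_) x
  rw [selIdx, List.mem_append, List.mem_map, List.mem_map] at hG
  obtain ⟨i, -, rfl⟩ | ⟨i, -, rfl⟩ := hG <;> simp [ha]

theorem crun_selIdx {s : Work n d L b} (hs : ∀ i, s ≠ .idx i) (x : Bits (wireCount n d L b))
    (hx : ∀ i, x (wk (.idx i)) = false) (i : Fin (idxWidth n)) :
    crun (selIdx s hs) x (wk (.idx i)) = if x (wk s) then x (wr (.q i)) else x (wr (.p i)) := by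
  rw [selIdx, crun_append]
  have h1 : ∀ y : Bits (wireCount n d L b), _ := fun y =>
    crun_eq (c := (List.finRange (idxWidth n)).map
    (fun i => cg (n := n) (d := d) (L := L) (b := b) (fun a c => !a && c) (.aux (.work s)) (.p i)
      (.aux (.work (.idx i))) (by simp [hs])))
    (pairwise_finRange_map _ fun i j hij => by
      simp [(hs _).symm, hij.ne']) y _ (List.mem_map_of_mem (List.mem_finRange i))
  have h2 : ∀ y : Bits (wireCount n d L b), _ := fun y =>
    crun_eq (c := (List.finRange (idxWidth n)).map
    (fun i => cg (n := n) (d := d) (L := L) (b := b) (fun a c => a && c) (.aux (.work s)) (.q i)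
      (.aux (.work (.idx i))) (by simp [hs])))
    (pairwise_finRange_map _ fun i j hij => by
      simp [(hs _).symm, hij.ne']) y _ (List.mem_map_of_mem (List.mem_finRange i))
  simp only [cg_t, cg_a, cg_b, cg_f] at h1 h2
  rw [h2, h1]
  have e1 : ∀ (c : List (CGate (wireCount n d L b))) (y : Bits (wireCount n d L b))
      (a : Wire n d L b), (∀ G ∈ c, ∃ i, G.t = wk (.idx i)) → (∀ i, a ≠ .aux (.work (.idx i))) →
      crun c y (wr a) = y (wr a) := fun c y a hc ha =>
    crun_of_ne (fun G hG => by obtain ⟨i, hi⟩ := hc G hG; rw [hi]; simp [ha]) y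
  rw [e1, e1, e1, e1, e1, e1, hx]
  · cases x (wk s) <;> simp
  all_goals first
    | (intro G hG; obtain ⟨i, -, rfl⟩ := List.mem_map.mp hG; exact ⟨i, rfl⟩)
    | simp [hs]

end

section

open ComplexConjugate

/-! ### Loading a data point and its norm -/

variable {n d : ℕ} {L : AccessLayout} {b : ℕ}

theorem append_append_wk_injective {k l m : ℕ} {a : Fin k → Work n d L b}
    {a' : Fin l → Work n d L b} {a'' : Fin m → Work n d L b} (ha : Function.Injective a)
    (ha' : Function.Injective a') (ha'' : Function.Injective a'') (h : ∀ i j, a i ≠ a' j)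
    (h' : ∀ i j, a i ≠ a'' j) (h'' : ∀ i j, a' i ≠ a'' j) :
    Function.Injective (Fin.append (Fin.append (fun i => wk (a i)) fun i => wk (a' i))
      fun i => wk (a'' i)) := by
  have hwk : ∀ {W W' : Work n d L b}, wk W = wk W' → W = W' := fun h => by simpa using h
  rw [Fin.append_injective_iff, Fin.append_injective_iff]
  refine ⟨⟨fun i j hij => ha (hwk hij), fun i j hij => ha' (hwk hij),
    fun i j hij => h _ _ (hwk hij)⟩,
    fun i j hij => ha'' (hwk hij), fun i j hij => ?_⟩
  revert hij
  refine Fin.addCases (fun i => ?_) (fun i => ?_) i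
  · simpa using h' i j
  · simpa using h'' i j

/-- Select one of the two data points by the qubit `mix` and copy its index. -/
def rowIdx : List (CGate (wireCount n d L b)) :=
  [cg (fun a c => !a && c) (.aux (.work .mix)) (.aux (.work .lft)) (.aux (.work .sel)) (by simp),
    cg (fun a c => a && c) (.aux (.work .mix)) (.aux (.work .rgt)) (.aux (.work .sel)) (by simp)] ++
  selIdx .sel (by simp)

/-- Load the encoding of the data point that `mix` selects. -/
def rowLoad : Prog (L.width n d) (wireCount n d L b) :=
  cprog rowIdx ++
    [Op.qry AccessKind.row false (loadEmb (fun i => wk (.idx i)) (fun j => wk (.data j))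
      (fun j => wk (.rwork j)) (append_append_wk_injective (fun _ _ => by simp) (fun _ _ => by simp)
        (fun _ _ => by simp) (by simp) (by simp) (by simp)))] ++
    cprog rowIdx.reverse

/-- The qubit that selects the data point of a factor. -/
def side (s : Bool) : Work n d L b := if s then .rgt else .lft

theorem side_ne_idx (s : Bool) (i : Fin (idxWidth n)) :
    (side s : Work n d L b) ≠ .idx i := by
  cases s <;> simp [side]

/-- Load the norm of the data point of a factor. -/
def normLoad (s : Bool) : Prog (L.width n d) (wireCount n d L b) :=
  cprog (selIdx (side s) (side_ne_idx s)) ++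
    [Op.qry AccessKind.norm false (loadEmb (fun i => wk (.idx i)) (fun j => wk (.nrm s j))
      (fun j => wk (.nwork j)) (append_append_wk_injective (fun _ _ => by simp) (fun _ _ => by simp)
        (fun _ _ => by simp) (by simp) (by simp) (by simp)))] ++
    cprog (selIdx (side s) (side_ne_idx s)).reverse

theorem crun_rowIdx_of_ne {a : Wire n d L b} (ha : ∀ i, a ≠ .aux (.work (.idx i)))
    (ha' : a ≠ .aux (.work .sel)) (x : Bits (wireCount n d L b)) :
    crun rowIdx x (wr a) = x (wr a) := by
  rw [rowIdx, crun_append, crun_selIdx_of_ne _ ha]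
  exact crun_of_ne (fun G hG => by
    simp only [List.mem_cons, List.not_mem_nil, or_false] at hG
    rcases hG with rfl | rfl <;> simpa using ha') x

theorem crun_rowIdx (x : Bits (wireCount n d L b)) (hx : ∀ i, x (wk (.idx i)) = false)
    (hs : x (wk .sel) = false) (i : Fin (idxWidth n)) :
    crun rowIdx x (wk (.idx i)) =
      if (if x (wk .mix) then x (wk .rgt) else x (wk .lft)) then x (wr (.q i))
      else x (wr (.p i)) := by
  rw [rowIdx, crun_append, crun_selIdx]
  · simp [crun_cons, CGate.step, hs]
    cases x (wk .mix) <;> cases x (wk .lft) <;> cases x (wk .rgt) <;> simp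
  · intro i
    simp [crun_cons, CGate.step, hx]

theorem mem_selIdx {s : Work n d L b} {hs : ∀ i, s ≠ .idx i} {G : CGate (wireCount n d L b)}
    (hG : G ∈ selIdx s hs) : ∃ i, G.a = wk s ∧ (G.b = wr (.p i) ∨ G.b = wr (.q i)) ∧
      G.t = wk (.idx i) := by
  rw [selIdx, List.mem_append, List.mem_map, List.mem_map] at hG
  obtain ⟨i, -, rfl⟩ | ⟨i, -, rfl⟩ := hG
  · exact ⟨i, rfl, Or.inl rfl, rfl⟩
  · exact ⟨i, rfl, Or.inr rfl, rfl⟩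

theorem sem_qry_false {ι : Type} {w : ι → ℕ} {N : ℕ} (O : Oracles w) (o : ι)
    (e : Fin (w o) ↪ Fin N) (ψ : QState N) :
    (Op.qry o false e : Op w N).sem O ψ = act (onWires e (O o).1) ψ := by
  rw [sem_qry, maybeDagger, if_neg (by simp)]

theorem sem_qry_row (O : Oracles (L.width n d))
    (e : Fin (idxWidth n + idxWidth d + L.rowWork) ↪ Fin (wireCount n d L b))
    (ψ : QState (wireCount n d L b)) :
    (Op.qry (w := L.width n d) AccessKind.row false e).sem O ψ =
      act (onWires (k := idxWidth n + idxWidth d + L.rowWork) e (O AccessKind.row).1) ψ :=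
  sem_qry_false O AccessKind.row e ψ

theorem sem_qry_norm (O : Oracles (L.width n d))
    (e : Fin (idxWidth n + L.normBits + L.normWork) ↪ Fin (wireCount n d L b))
    (ψ : QState (wireCount n d L b)) :
    (Op.qry (w := L.width n d) AccessKind.norm false e).sem O ψ =
      act (onWires (k := idxWidth n + L.normBits + L.normWork) e (O AccessKind.norm).1) ψ :=
  sem_qry_false O AccessKind.norm e ψ

theorem sem_rowLoad {S : Matrix (Fin n) (Fin d) ℝ} {κ T : ℝ} {O : Oracles (L.width n d)}
    (hO : QuantumAccess L S κ T O) {p q : Fin n} {x : Bits (wireCount n d L b)}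
    (hp : ∀ i, x (wr (.p i)) = natBits (idxWidth n) p i)
    (hq : ∀ i, x (wr (.q i)) = natBits (idxWidth n) q i)
    (hi : ∀ i, x (wk (.idx i)) = false) (hs : x (wk .sel) = false)
    (hd : ∀ j, x (wk (.data j)) = false) (hr : ∀ j, x (wk (.rwork j)) = false) :
    rowLoad.sem O (ket x) =
      ∑ z, rowState S (if (if x (wk .mix) then x (wk .rgt) else x (wk .lft)) then q else p) z •
        ket (Function.extend (fun j => wk (.data j)) z x) := by
  rw [rowLoad]
  refine sem_load O (k := idxWidth n) (l := idxWidth d) (m := L.rowWork) _ rowIdx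
    (O AccessKind.row).1 (fun i => wk (.idx i)) (fun j => wk (.data j)) (fun j => wk (.rwork j)) _
    (sem_qry_row O _) ?_
    (hO.row_map (if (if x (wk .mix) then x (wk .rgt) else x (wk .lft)) then q else p)) ?_ ?_ ?_
  · intro G hG j
    rw [rowIdx, List.mem_append] at hG
    rcases hG with hG | hG
    · simp only [List.mem_cons, List.not_mem_nil, or_false] at hG
      rcases hG with rfl | rfl <;> simp
    · obtain ⟨i, h1, h2 | h2, h3⟩ := mem_selIdx hG <;> rw [h1, h2, h3] <;> simp
  · intro j
    rw [crun_rowIdx x hi hs, hp, hq]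
    split_ifs <;> rfl
  · intro j
    rw [crun_rowIdx_of_ne (by simp) (by simp), hd]
  · intro j
    rw [crun_rowIdx_of_ne (by simp) (by simp), hr]

theorem sem_normLoad {O : Oracles (L.width n d)}
    {X : Fin n → Bits L.normBits}
    (hX : ∀ i, act (O AccessKind.norm).1
      (tensor (tensor (idxKet i) (zeroKet L.normBits)) (zeroKet L.normWork)) =
        tensor (tensor (idxKet i) (ket (X i))) (zeroKet L.normWork))
    (s : Bool) {p q : Fin n} {x : Bits (wireCount n d L b)}
    (hp : ∀ i, x (wr (.p i)) = natBits (idxWidth n) p i)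
    (hq : ∀ i, x (wr (.q i)) = natBits (idxWidth n) q i)
    (hi : ∀ i, x (wk (.idx i)) = false)
    (hd : ∀ j, x (wk (.nrm s j)) = false) (hr : ∀ j, x (wk (.nwork j)) = false) :
    (normLoad s).sem O (ket x) =
      ket (Function.extend (fun j => wk (.nrm s j)) (X (if x (wk (side s)) then q else p)) x) := by
  rw [normLoad, sem_load O (k := idxWidth n) (l := L.normBits) (m := L.normWork) _
    (selIdx (side s) (side_ne_idx s)) (O AccessKind.norm).1
    (fun i => wk (.idx i)) (fun j => wk (.nrm s j))
    (fun j => wk (.nwork j)) _ (sem_qry_norm O _) ?_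
    (hX (if x (wk (side s)) then q else p)) ?_ ?_ ?_]
  · simp only [ket_apply, ite_smul, one_smul, zero_smul]
    rw [Finset.sum_ite_eq' Finset.univ]
    simp
  · intro G hG j
    obtain ⟨i, h1, h2 | h2, h3⟩ := mem_selIdx hG <;> rw [h1, h2, h3] <;> cases s <;> simp [side]
  · intro j
    rw [crun_selIdx _ x hi, hp, hq]
    split_ifs <;> rfl
  · intro j
    rw [crun_selIdx_of_ne _ (by simp), hd]
  · intro j
    rw [crun_selIdx_of_ne _ (by simp), hr]

/-! ### Computing the sampled sign -/

/-- The first part of the computation of the sampled sign. The gates are split in two lists such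
that in each list no gate changes a wire that an earlier gate uses. -/
def signGates₁ (hb : b ≤ L.normBits) : List (CGate (wireCount n d L b)) :=
  [cg xor (.aux (.work .lft)) (.aux (.work .rgt)) (.aux (.work .par)) (by simp),
    cg (fun a _ => a) (.aux (.work .coin)) (.aux (.work .lft)) (.aux (.work .dec)) (by simp)] ++
  (List.finRange b).map (fun i => cg (fun a c => a && c) (.aux (.work (.rnd false i)))
    (.aux (.work (.nrm false (Fin.castLE hb i)))) (.aux (.work (.lev false i.succ))) (by simp)) ++
  (List.finRange b).map (fun i => cg (fun a c => a && c) (.aux (.work (.rnd true i)))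
    (.aux (.work (.nrm true (Fin.castLE hb i)))) (.aux (.work (.lev true i.succ))) (by simp))

/-- The second part of the computation of the sampled sign. -/
def signGates₂ : List (CGate (wireCount n d L b)) :=
  (List.finRange b).map (fun i => cg (fun a c => !a && c) (.aux (.work (.rnd false i)))
    (.aux (.work (.lev false i.castSucc))) (.aux (.work (.lev false i.succ)))
    (by simp [i.castSucc_lt_succ.ne])) ++
  (List.finRange b).map (fun i => cg (fun a c => !a && c) (.aux (.work (.rnd true i)))
    (.aux (.work (.lev true i.castSucc))) (.aux (.work (.lev true i.succ)))
    (by simp [i.castSucc_lt_succ.ne])) ++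
  [cg (fun a c => a && c) (.aux (.work (.lev false (Fin.last b))))
      (.aux (.work (.lev true (Fin.last b)))) (.aux (.work .both)) (by simp),
    cg xor (.aux (.work .mix)) (.aux (.work .coin)) (.aux (.work .par)) (by simp),
    cg (fun a c => a && c) (.aux (.work .both)) (.aux (.work .par)) (.aux (.work .dec)) (by simp)]

theorem signGates₁_pairwise (hb : b ≤ L.normBits) :
    (signGates₁ hb : List (CGate (wireCount n d L b))).Pairwise
      fun G G' => G'.t ≠ G.a ∧ G'.t ≠ G.b ∧ G'.t ≠ G.t := by
  rw [signGates₁, List.pairwise_append, List.pairwise_append]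
  refine ⟨⟨?_, pairwise_finRange_map _ fun i j hij => ?_, ?_⟩,
    pairwise_finRange_map _ fun i j hij => ?_, ?_⟩
  · simp
  · simp [hij.ne']
  · simp
  · simp [hij.ne']
  · intro G hG G' hG'
    simp only [List.mem_append, List.mem_cons, List.not_mem_nil, or_false, List.mem_map] at hG hG'
    obtain ⟨j, -, rfl⟩ := hG'
    rcases hG with (rfl | rfl) | ⟨i, -, rfl⟩ <;> simp

theorem signGates₂_pairwise :
    (signGates₂ : List (CGate (wireCount n d L b))).Pairwise
      fun G G' => G'.t ≠ G.a ∧ G'.t ≠ G.b ∧ G'.t ≠ G.t := by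
  have hlt : ∀ i j : Fin b, i < j → ¬ j.succ = i.castSucc := fun i j h h' => by
    have := congrArg Fin.val h'
    simp only [Fin.val_succ, Fin.val_castSucc] at this
    have := Fin.lt_def.mp h
    omega
  rw [signGates₂, List.pairwise_append, List.pairwise_append]
  refine ⟨⟨pairwise_finRange_map _ fun i j hij => ?_,
    pairwise_finRange_map _ fun i j hij => ?_, ?_⟩, ?_, ?_⟩
  · simp [hij.ne', hlt i j hij]
  · simp [hij.ne', hlt i j hij]
  · simp
  · simp
  · intro G hG G' hG'
    simp only [List.mem_append, List.mem_cons, List.not_mem_nil, or_false, List.mem_map] at hG hG'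
    rcases hG with ⟨i, -, rfl⟩ | ⟨i, -, rfl⟩ <;> rcases hG' with rfl | rfl | rfl <;> simp

/-- The qubit `dec` holds the sampled sign bit: the parity of the three selecting qubits if both
norm bits are set, and the coin otherwise. -/
theorem crun_signGates (hb : b ≤ L.normBits) (x : Bits (wireCount n d L b))
    (hpar : x (wk .par) = false) (hboth : x (wk .both) = false) (hdec : x (wk .dec) = false)
    (hlev : ∀ s i, x (wk (.lev s i)) = false) :
    crun (signGates₁ hb ++ signGates₂) x (wk .dec) =
      if sampleBit b (fun i => x (wk (.rnd false i)))
          (fun i => x (wk (.nrm false (Fin.castLE hb i)))) &&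
        sampleBit b (fun i => x (wk (.rnd true i)))
          (fun i => x (wk (.nrm true (Fin.castLE hb i))))
      then xor (xor (x (wk .lft)) (x (wk .rgt))) (x (wk .mix)) else x (wk .coin) := by
  rw [crun_append]
  have h1 := crun_eq (signGates₁_pairwise hb) x
  have h2 := crun_eq signGates₂_pairwise (crun (signGates₁ hb) x)
  have k1 : ∀ a : Wire n d L b, a ≠ .aux (.work .par) → a ≠ .aux (.work .dec) →
      (∀ s (i : Fin b), a ≠ .aux (.work (.lev s i.succ))) →
      crun (signGates₁ hb) x (wr a) = x (wr a) := by
    intro a ha ha' ha''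
    refine crun_of_ne (fun G hG => ?_) x
    simp only [signGates₁, List.mem_append, List.mem_cons, List.not_mem_nil, or_false,
      List.mem_map] at hG
    rcases hG with ((rfl | rfl) | ⟨i, -, rfl⟩) | ⟨i, -, rfl⟩ <;> simp [*]
  have k2 : ∀ a : Wire n d L b, a ≠ .aux (.work .par) → a ≠ .aux (.work .dec) →
      a ≠ .aux (.work .both) →
      (∀ s (i : Fin b), a ≠ .aux (.work (.lev s i.succ))) →
      crun signGates₂ (crun (signGates₁ hb) x) (wr a) = crun (signGates₁ hb) x (wr a) := by
    intro a ha ha' hb' ha''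
    refine crun_of_ne (fun G hG => ?_) _
    simp only [signGates₂, List.mem_append, List.mem_cons, List.not_mem_nil, or_false,
      List.mem_map] at hG
    rcases hG with (⟨i, -, rfl⟩ | ⟨i, -, rfl⟩) | rfl | rfl | rfl <;> simp [*]
  generalize crun signGates₂ (crun (signGates₁ hb) x) = Z at h2 k2 ⊢
  generalize crun (signGates₁ hb) x = y at h1 h2 k1 k2
  simp only [signGates₁, List.mem_append, List.mem_cons, List.not_mem_nil, or_false,
      List.mem_map, List.mem_finRange, true_and, or_imp, forall_and, forall_eq,
      forall_exists_index, forall_apply_eq_imp_iff, cg_a, cg_b, cg_t, cg_f] at h1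
  simp only [signGates₂, List.mem_append, List.mem_cons, List.not_mem_nil, or_false,
      List.mem_map, List.mem_finRange, true_and, or_imp, forall_and, forall_eq,
      forall_exists_index, forall_apply_eq_imp_iff, cg_a, cg_b, cg_t, cg_f] at h2
  obtain ⟨⟨⟨hpar1, hdec1⟩, hlf1⟩, hlt1⟩ := h1
  obtain ⟨⟨hlf2, hlt2⟩, hboth2, hpar2, hdec2⟩ := h2
  have h0 : ∀ i : Fin b, ¬ (0 : Fin (b + 1)) = i.succ := fun i => (Fin.succ_ne_zero i).symm
  have e0 : Z (wk (.lev false (Fin.last b))) = _ := eq_sampleBit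
    (fun i => x (wk (.rnd false i))) (fun i => x (wk (.nrm false (Fin.castLE hb i))))
    (fun i => Z (wk (.lev false i)))
    (by rw [k2 _ (by simp) (by simp) (by simp) (by simp [h0]),
          k1 _ (by simp) (by simp) (by simp [h0]), hlev])
    (fun i => by
      rw [hlf2, hlf1]
      simp only [k2 (.aux (.work (.rnd false i))) (by simp) (by simp) (by simp) (by simp),
        k1 (.aux (.work (.rnd false i))) (by simp) (by simp) (by simp),
        k1 (.aux (.work (.nrm false (Fin.castLE hb i)))) (by simp) (by simp) (by simp), hlev]
      simp)
  have e1 : Z (wk (.lev true (Fin.last b))) = _ := eq_sampleBit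
    (fun i => x (wk (.rnd true i))) (fun i => x (wk (.nrm true (Fin.castLE hb i))))
    (fun i => Z (wk (.lev true i)))
    (by rw [k2 _ (by simp) (by simp) (by simp) (by simp [h0]),
          k1 _ (by simp) (by simp) (by simp [h0]), hlev])
    (fun i => by
      rw [hlt2, hlt1]
      simp only [k2 (.aux (.work (.rnd true i))) (by simp) (by simp) (by simp) (by simp),
        k1 (.aux (.work (.rnd true i))) (by simp) (by simp) (by simp),
        k1 (.aux (.work (.nrm true (Fin.castLE hb i)))) (by simp) (by simp) (by simp), hlev]
      simp)
  rw [hdec2, hboth2, hpar2, e0, e1, hpar1, hdec1,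
    k2 _ (by simp) (by simp) (by simp) (by simp), k2 _ (by simp) (by simp) (by simp) (by simp),
    k1 _ (by simp) (by simp) (by simp), k1 _ (by simp) (by simp) (by simp),
    k1 _ (by simp) (by simp) (by simp), k1 _ (by simp) (by simp) (by simp),
    k1 _ (by simp) (by simp) (by simp), hpar, hboth, hdec]
  have hbool : ∀ e u v l r m : Bool,
      xor (xor false e) (xor false (u && v) && xor (xor false (xor l r)) (xor m e)) =
        if u && v then xor (xor l r) m else e := by decide
  exact hbool _ _ _ _ _ _

end

section

open ComplexConjugate

/-! ### The state preparation -/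

/-- The amplitudes after a program that loads a state `ρ y` into a zero register `D`, applied to a
superposition of basis states `y`. -/
theorem sem_load_apply {ι : Type} {w : ι → ℕ} {N k : ℕ} (O : Oracles w) (P : Prog w N)
    {D : Fin k → Fin N} (hD : Function.Injective D) (ρ : Bits N → QState k) {ψ : QState N}
    (h : ∀ y, ψ y ≠ 0 → P.sem O (ket y) = ∑ z, ρ y z • ket (Function.extend D z y))
    (h0 : ∀ y, ψ y ≠ 0 → ∀ j, y (D j) = false) (x : Bits N) :
    P.sem O ψ x = ρ (Function.extend D (fun _ => false) x) (fun j => x (D j)) *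
      ψ (Function.extend D (fun _ => false) x) := by
  have hoff : ∀ z (y : Bits N) i, (¬ ∃ j, D j = i) → Function.extend D z y i = y i :=
    fun z y i hi => Function.extend_apply' _ _ _ hi
  have hext : ∀ y z, x = Function.extend D z y ↔ (z = fun j => x (D j)) ∧
      ∀ i, (¬ ∃ j, D j = i) → x i = y i := fun y z => by
    constructor
    · intro hz
      refine ⟨funext fun j => by rw [hz, hD.extend_apply], fun i hi => by rw [hz, hoff _ _ _ hi]⟩
    · rintro ⟨rfl, hz⟩
      funext i
      by_cases hi : ∃ j, D j = i
      · obtain ⟨j, rfl⟩ := hi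
        rw [hD.extend_apply]
      · rw [hoff _ _ _ hi, hz i hi]
  have hval : ∀ y, (P.sem O (ψ y • ket y)) x =
      if ∀ i, (¬ ∃ j, D j = i) → x i = y i then ψ y * ρ y (fun j => x (D j)) else 0 := by
    intro y
    by_cases hy : ψ y = 0
    · simp [hy]
    rw [map_smul, h y hy]
    simp only [WithLp.ofLp_sum, WithLp.ofLp_smul, Finset.sum_apply, Pi.smul_apply, smul_eq_mul,
      ket_apply, hext]
    split_ifs with hc
    · simp only [and_iff_left hc, mul_ite, mul_one, mul_zero, Finset.sum_ite_eq', Finset.mem_univ,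
        if_true]
    · rw [Finset.sum_eq_zero fun z _ => by rw [if_neg fun h => hc h.2, mul_zero], mul_zero]
  conv_lhs => rw [state_eq_sum_ket ψ]
  rw [map_sum, WithLp.ofLp_sum, Finset.sum_apply,
    Finset.sum_eq_single (Function.extend D (fun _ => false) x)]
  · rw [hval, if_pos fun i hi => (hoff _ _ _ hi).symm, mul_comm]
  · intro y _ hne
    rw [hval]
    split_ifs with hc
    · by_cases hy : ψ y = 0
      · simp [hy]
      · refine absurd (funext fun i => ?_) hne
        by_cases hi : ∃ j, D j = i
        · obtain ⟨j, rfl⟩ := hi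
          rw [hD.extend_apply, h0 y hy]
        · rw [hoff _ _ _ hi, hc i hi]
    · rfl
  · simp

variable {n d : ℕ} {L : AccessLayout} {b : ℕ}

/-- The work qubits that start in a uniform superposition. -/
def coins (n d : ℕ) (L : AccessLayout) (b : ℕ) : List (Work n d L b) :=
  [.lft, .rgt, .mix, .coin] ++ (List.finRange b).map (.rnd false) ++
    (List.finRange b).map (.rnd true)

theorem coins_nodup : (coins n d L b).Nodup := by
  have h : ∀ s, ((List.finRange b).map (Work.rnd s : Fin b → Work n d L b)).Nodup := fun s =>
    (List.nodup_finRange b).map fun i j hij => by simpa using hij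
  rw [coins, List.nodup_append, List.nodup_append]
  refine ⟨⟨by simp, h false, by simp⟩, h true, by simp⟩

theorem mem_coins (W : Work n d L b) : W ∈ coins n d L b ↔
    W = .lft ∨ W = .rgt ∨ W = .mix ∨ W = .coin ∨ ∃ s i, W = .rnd s i := by
  simp [coins, eq_comm]

theorem length_coins : (coins n d L b).length = 4 + 2 * b := by
  simp [coins]
  ring

/-- The first part of the state preparation: random coins and the superposition of the encodings
of two data points. -/
def mixPrep : Prog (L.width n d) (wireCount n d L b) :=
  (coins n d L b).map (fun W => had (wr (.aux .eq)) (wk W) (by simp)) ++ rowLoad ++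
    [had (wr (.aux .eq)) (wk .mix) (by simp)]

/-- The second part of the state preparation: the sign is sampled with the help of the norms. -/
def signPrep (hb : b ≤ L.normBits) : Prog (L.width n d) (wireCount n d L b) :=
  normLoad false ++ normLoad true ++ cprog (signGates₁ hb ++ signGates₂)

/-- The state preparation. -/
def prep (hb : b ≤ L.normBits) : Prog (L.width n d) (wireCount n d L b) :=
  mixPrep ++ signPrep hb

/-- The wires that are in superposition after the first part of the state preparation. -/
def Wire.IsFree : Wire n d L b → Prop
  | .aux (.work W) => W ∈ coins n d L b ∨ ∃ j, W = .data j
  | _ => False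

open Classical in
/-- Setting the free wires to zero gives the label `v` exactly if the other wires hold the values
`v`. -/
theorem clear_eq_iff {v : Wire n d L b → Bool} (hv : ∀ a, a.IsFree → v a = false)
    (x : Bits (wireCount n d L b)) :
    clearBits ((coins n d L b).map wk)
      (Function.extend (fun j : Fin (idxWidth d) => wk (.data j)) (fun _ => false) x) = conf v ↔
      ∀ a : Wire n d L b, ¬ a.IsFree → x (wr a) = v a := by
  have hinj : Function.Injective fun j : Fin (idxWidth d) => wk (.data j : Work n d L b) :=
    fun i j hij => by simpa using hij
  have hoff : ∀ a : Wire n d L b, (∀ j, a ≠ .aux (.work (.data j))) →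
      Function.extend (fun j : Fin (idxWidth d) => wk (.data j : Work n d L b)) (fun _ => false) x
        (wr a) = x (wr a) := fun a ha =>
    Function.extend_apply' _ _ _ fun ⟨j, hj⟩ => ha j (by simpa using hj.symm)
  have hmem : ∀ a : Wire n d L b, wr a ∈ (coins n d L b).map wk ↔
      ∃ W ∈ coins n d L b, a = .aux (.work W) := fun a => by simp [eq_comm]
  have key : ∀ a : Wire n d L b, clearBits ((coins n d L b).map wk)
      (Function.extend (fun j : Fin (idxWidth d) => wk (.data j)) (fun _ => false) x) (wr a) =
        if a.IsFree then false else x (wr a) := by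
    intro a
    rw [clearBits]
    by_cases h1 : ∃ W ∈ coins n d L b, a = .aux (.work W)
    · rw [if_pos ((hmem a).mpr h1), if_pos]
      obtain ⟨W, hW, rfl⟩ := h1
      exact Or.inl hW
    · rw [if_neg fun h => h1 ((hmem a).mp h)]
      by_cases h2 : ∃ j, a = .aux (.work (.data j))
      · obtain ⟨j, rfl⟩ := h2
        rw [hinj.extend_apply (a := j)]
        exact (if_pos (Or.inr ⟨j, rfl⟩)).symm
      · push Not at h2
        rw [hoff a h2, if_neg]
        rintro hf
        match a, hf with
        | .aux (.work W), Or.inl hW => exact h1 ⟨W, hW, rfl⟩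
        | .aux (.work W), Or.inr ⟨j, hj⟩ => exact h2 j (by rw [hj])
  constructor
  · intro h a ha
    rw [← conf_wr v a, ← h, key, if_neg ha]
  · intro h
    refine bits_ext fun a => ?_
    rw [key, conf_wr]
    split_ifs with ha
    · exact (hv a ha).symm
    · exact h a ha

theorem baseVal_of_isFree (P Q : Bits (idxWidth n)) (e : Bool) (a : Wire n d L b)
    (ha : a.IsFree) : baseVal P Q e a = false := by
  match a, ha with
  | .aux (.work W), _ => rfl

/-- One of two indices. -/
def pick (p q : Fin n) (s : Bool) : Fin n := if s then q else p

open Classical in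
/-- The amplitudes after the first part of the state preparation. -/
theorem sem_mixPrep {S : Matrix (Fin n) (Fin d) ℝ} {κ T : ℝ} {O : Oracles (L.width n d)}
    (hO : QuantumAccess L S κ T O) (p q : Fin n) (e : Bool) (x : Bits (wireCount n d L b)) :
    (mixPrep.sem O (ket (conf (baseVal (natBits _ p) (natBits _ q) e)))) x =
      if ∀ a : Wire n d L b, ¬ a.IsFree → x (wr a) = baseVal (natBits _ p) (natBits _ q) e a then
        invSqrtTwo ^ (5 + 2 * b) *
          ((rowAmp S (pick p q (x (wk .lft))) (fun j => x (wk (.data j))) +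
            rsgn (x (wk .mix)) * rowAmp S (pick p q (x (wk .rgt))) (fun j => x (wk (.data j))) : ℝ)
              : ℂ)
      else 0 := by
  set v : Wire n d L b → Bool := baseVal (natBits _ p) (natBits _ q) e with hv
  have hvf : ∀ a, a.IsFree → v a = false := baseVal_of_isFree _ _ _
  set ψ₁ := Prog.sem O ((coins n d L b).map (fun W => had (wr (.aux .eq)) (wk W) (by simp)) :
    Prog (L.width n d) _) (ket (conf v)) with hψ₁
  have h1 : ∀ y, ψ₁ y = invSqrtTwo ^ (4 + 2 * b) *
      if clearBits ((coins n d L b).map wk) y = conf v then 1 else 0 := by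
    intro y
    rw [hψ₁, sem_hads O _ wk _ _ _ _ _ y, length_coins, ket_apply]
    · exact (coins_nodup).map fun W W' h => by simpa using h
    · intro W hW
      have := fixedAt_ket (wk W) (conf v)
      rwa [conf_wr] at this
  have hy : ∀ y, ψ₁ y ≠ 0 → ∀ a : Wire n d L b, (∀ W, a = .aux (.work W) → W ∉ coins n d L b) →
      y (wr a) = v a := by
    intro y hne a ha
    rw [h1] at hne
    have hc : clearBits ((coins n d L b).map wk) y = conf v := by
      by_contra hc
      rw [if_neg hc, mul_zero] at hne
      exact hne rfl
    rw [← conf_wr v a, ← hc, clearBits, if_neg]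
    simp only [List.mem_map, wr_inj, not_exists, not_and]
    exact fun W hW h => ha W h.symm hW
  have hinj : Function.Injective fun j : Fin (idxWidth d) => wk (.data j : Work n d L b) :=
    fun i j hij => by simpa using hij
  have h2 : ∀ y, rowLoad.sem O ψ₁ y = (rowAmp S (pick p q (if y (wk .mix) then y (wk .rgt)
      else y (wk .lft))) (fun j => y (wk (.data j))) : ℂ) *
      (invSqrtTwo ^ (4 + 2 * b) * if ∀ a : Wire n d L b, ¬ a.IsFree → y (wr a) = v a
        then 1 else 0) := by
    intro y
    rw [sem_load_apply O rowLoad hinj (fun y => rowState S (pick p q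
      (if y (wk .mix) then y (wk .rgt) else y (wk .lft)))) (fun y hne => ?_)
      (fun y hne j => ?_), h1, rowState_apply]
    · congr 2
      · rw [Function.extend_apply', Function.extend_apply', Function.extend_apply'] <;> simp
      · simp only [clear_eq_iff hvf]
    · exact sem_rowLoad hO (fun i => hy y hne _ (by simp)) (fun i => hy y hne _ (by simp))
        (fun i => hy y hne _ (by simp [mem_coins])) (hy y hne _ (by simp [mem_coins]))
        (fun j => hy y hne _ (by simp [mem_coins])) fun j => hy y hne _ (by simp [mem_coins])
    · exact hy y hne _ (by simp [mem_coins])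
  have h3 : ∀ β, (∀ a : Wire n d L b, ¬ a.IsFree →
      Function.update x (wk .mix) β (wr a) = v a) ↔ ∀ a : Wire n d L b, ¬ a.IsFree →
        x (wr a) = v a := fun β => by
    refine forall₂_congr fun a ha => ?_
    rw [Function.update_of_ne]
    intro h
    rw [wr_inj.mp h] at ha
    exact ha (Or.inl (by simp [coins]))
  rw [mixPrep, Prog.sem_append, Prog.sem_append, Prog.sem_cons, Prog.sem_nil, ← hψ₁, sem_had, h2,
    h2]
  simp only [h3, Function.update_self, ← rsgn_cast]
  have hmix : ∀ W : Work n d L b, W ≠ .mix → ∀ β, Function.update x (wk .mix) β (wk W) =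
      x (wk W) := fun W hW β => Function.update_of_ne (by simpa using hW) _ _
  simp only [hmix .rgt (by simp), hmix .lft (by simp), hmix (.data _) (by simp), if_true,
    Bool.false_eq_true, if_false]
  split_ifs
  · push_cast
    ring
  · simp

end

section

open ComplexConjugate

/-! ### The expectation of the sign after the state preparation -/

variable {n d : ℕ} {L : AccessLayout} {b : ℕ}

/-- The values of the free wires: the coins, the random bits and the data register. -/
abbrev FreeVal (d b : ℕ) : Type :=
  Bool × Bool × Bool × Bool × (Fin b → Bool) × (Fin b → Bool) × Bits (idxWidth d)

/-- Values of all wires, with given values of the free wires. -/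
def freeVal (v : Wire n d L b → Bool) (y : FreeVal d b) : Wire n d L b → Bool
  | .aux (.work .lft) => y.1
  | .aux (.work .rgt) => y.2.1
  | .aux (.work .mix) => y.2.2.1
  | .aux (.work .coin) => y.2.2.2.1
  | .aux (.work (.rnd s i)) => if s then y.2.2.2.2.2.1 i else y.2.2.2.2.1 i
  | .aux (.work (.data j)) => y.2.2.2.2.2.2 j
  | a => v a

theorem freeVal_of_not_isFree (v : Wire n d L b → Bool) (y : FreeVal d b) {a : Wire n d L b}
    (ha : ¬ a.IsFree) : freeVal v y a = v a := by
  unfold freeVal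
  split <;> first | rfl | (exfalso; exact ha (by simp [Wire.IsFree, mem_coins]))

/-- A sum over the basis states whose wires that are not free have given values. -/
theorem sum_eq_sum_freeVal (v : Wire n d L b → Bool) (F : Bits (wireCount n d L b) → ℂ)
    (hF : ∀ x, F x ≠ 0 → ∀ a : Wire n d L b, ¬ a.IsFree → x (wr a) = v a) :
    ∑ x, F x = ∑ y : FreeVal d b, F (conf (freeVal v y)) := by
  symm
  refine Finset.sum_of_injOn (fun y => conf (freeVal v y)) ?_ (by simp) ?_ (fun _ _ => rfl)
  · intro y _ y' _ h
    have h' : ∀ a : Wire n d L b, freeVal v y a = freeVal v y' a := fun a => by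
      simpa using congrFun h (wr a)
    obtain ⟨l, r, c, e, k, k', z⟩ := y
    obtain ⟨l₁, r₁, c₁, e₁, k₁, k₁', z₁⟩ := y'
    have h1 : l = l₁ := h' (.aux (.work .lft))
    have h2 : r = r₁ := h' (.aux (.work .rgt))
    have h3 : c = c₁ := h' (.aux (.work .mix))
    have h4 : e = e₁ := h' (.aux (.work .coin))
    have h5 : k = k₁ := funext fun i => h' (.aux (.work (.rnd false i)))
    have h6 : k' = k₁' := funext fun i => h' (.aux (.work (.rnd true i)))
    have h7 : z = z₁ := funext fun i => h' (.aux (.work (.data i)))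
    rw [h1, h2, h3, h4, h5, h6, h7]
  · intro x _ hx
    by_contra hne
    refine hx ⟨(x (wk .lft), x (wk .rgt), x (wk .mix), x (wk .coin),
      fun i => x (wk (.rnd false i)), fun i => x (wk (.rnd true i)), fun j => x (wk (.data j))),
      by simp, bits_ext fun a => ?_⟩
    refine (conf_wr _ a).trans ?_
    unfold freeVal
    split
    · rfl
    · rfl
    · rfl
    · rfl
    · rename_i s i
      cases s <;> rfl
    · rfl
    · refine (hF x hne a fun hf => ?_).symm
      match a, hf with
      | .aux (.work W), hf =>
        simp only [Wire.IsFree, mem_coins] at hf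
        rcases hf with (rfl | rfl | rfl | rfl | ⟨s, i, rfl⟩) | ⟨j, rfl⟩ <;> simp_all

/-- The basis state after the second part of the state preparation. -/
def signMap (hb : b ≤ L.normBits) (p q : Fin n) (X : Fin n → Bits L.normBits)
    (x : Bits (wireCount n d L b)) : Bits (wireCount n d L b) :=
  crun (signGates₁ hb ++ signGates₂)
    (Function.extend (fun j => wk (.nrm true j)) (X (pick p q (x (wk .rgt))))
      (Function.extend (fun j => wk (.nrm false j)) (X (pick p q (x (wk .lft)))) x))

section SignMap

variable (hb : b ≤ L.normBits) {p q : Fin n} {X : Fin n → Bits L.normBits} {e : Bool}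
  {x : Bits (wireCount n d L b)}

theorem extend_nrm_of_ne (s : Bool) (z : Bits L.normBits) (y : Bits (wireCount n d L b))
    {a : Wire n d L b} (ha : ∀ j, a ≠ .aux (.work (.nrm s j))) :
    Function.extend (fun j => wk (.nrm s j : Work n d L b)) z y (wr a) = y (wr a) :=
  Function.extend_apply' _ _ _ fun ⟨j, hj⟩ => ha j (wr_inj.mp hj).symm

theorem extend_nrm (s : Bool) (z : Bits L.normBits) (y : Bits (wireCount n d L b)) (j) :
    Function.extend (fun j => wk (.nrm s j : Work n d L b)) z y (wk (.nrm s j)) = z j :=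
  Function.Injective.extend_apply (f := fun j => wk (.nrm s j : Work n d L b))
    (fun i j hij => by simpa using hij) _ _ _

theorem sem_signPrep
    (hx : ∀ a : Wire n d L b, ¬ a.IsFree → x (wr a) = baseVal (natBits _ p) (natBits _ q) e a)
    {O : Oracles (L.width n d)}
    (hX : ∀ i, act (O AccessKind.norm).1
      (tensor (tensor (idxKet i) (zeroKet L.normBits)) (zeroKet L.normWork)) =
        tensor (tensor (idxKet i) (ket (X i))) (zeroKet L.normWork)) :
    (signPrep hb).sem O (ket x) = ket (signMap hb p q X x) := by
  have hx0 : ∀ W : Work n d L b, W ∉ coins n d L b → (∀ j, W ≠ .data j) → x (wk W) = false :=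
    fun W h h' => hx (.aux (.work W)) fun hf => hf.elim h fun ⟨j, hj⟩ => h' j hj
  rw [signPrep, Prog.sem_append, Prog.sem_append,
    sem_normLoad hX false (p := p) (q := q) (fun i => hx _ (by simp [Wire.IsFree]))
      (fun i => hx _ (by simp [Wire.IsFree]))
      (fun i => hx0 _ (by simp [mem_coins]) (by simp))
      (fun i => hx0 _ (by simp [mem_coins]) (by simp))
      (fun i => hx0 _ (by simp [mem_coins]) (by simp)),
    sem_normLoad hX true (p := p) (q := q), sem_cprog_ket, signMap]
  · congr 4
    rw [extend_nrm_of_ne _ _ _ (by simp [side])]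
    rfl
  · intro i
    rw [extend_nrm_of_ne _ _ _ (by simp)]
    exact hx _ (by simp [Wire.IsFree])
  · intro i
    rw [extend_nrm_of_ne _ _ _ (by simp)]
    exact hx _ (by simp [Wire.IsFree])
  · intro i
    rw [extend_nrm_of_ne _ _ _ (by simp)]
    exact hx0 _ (by simp [mem_coins]) (by simp)
  · intro i
    rw [extend_nrm_of_ne _ _ _ (by simp)]
    exact hx0 _ (by simp [mem_coins]) (by simp)
  · intro i
    rw [extend_nrm_of_ne _ _ _ (by simp)]
    exact hx0 _ (by simp [mem_coins]) (by simp)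

/-- The decision bit after the second part of the state preparation is the sampled sign bit. -/
theorem signMap_dec
    (hx : ∀ a : Wire n d L b, ¬ a.IsFree → x (wr a) = baseVal (natBits _ p) (natBits _ q) e a) :
    signMap hb p q X x (wk .dec) =
    if sampleBit b (fun i => x (wk (.rnd false i)))
        (fun i => X (pick p q (x (wk .lft))) (Fin.castLE hb i)) &&
      sampleBit b (fun i => x (wk (.rnd true i)))
        (fun i => X (pick p q (x (wk .rgt))) (Fin.castLE hb i))
    then xor (xor (x (wk .lft)) (x (wk .rgt))) (x (wk .mix)) else x (wk .coin) := by
  have hx0 : ∀ W : Work n d L b, W ∉ coins n d L b → (∀ j, W ≠ .data j) → x (wk W) = false :=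
    fun W h h' => hx (.aux (.work W)) fun hf => hf.elim h fun ⟨j, hj⟩ => h' j hj
  have hoff : ∀ W : Work n d L b, (∀ s j, W ≠ .nrm s j) →
      (Function.extend (fun j => wk (.nrm true j)) (X (pick p q (x (wk .rgt))))
      (Function.extend (fun j => wk (.nrm false j)) (X (pick p q (x (wk .lft)))) x)) (wk W) =
        x (wk W) := fun W hW => by
    rw [extend_nrm_of_ne _ _ _ (by simpa using hW true),
      extend_nrm_of_ne _ _ _ (by simpa using hW false)]
  rw [signMap, crun_signGates]
  · simp only [extend_nrm]
    rw [hoff .lft (by simp), hoff .rgt (by simp), hoff .mix (by simp), hoff .coin (by simp)]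
    simp only [hoff (.rnd _ _) (by simp)]
    simp only [extend_nrm_of_ne true _ _ (a := .aux (.work (.nrm false _))) (by simp), extend_nrm]
  · rw [hoff _ (by simp)]
    exact hx0 _ (by simp [mem_coins]) (by simp)
  · rw [hoff _ (by simp)]
    exact hx0 _ (by simp [mem_coins]) (by simp)
  · rw [hoff _ (by simp)]
    exact hx0 _ (by simp [mem_coins]) (by simp)
  · intro s i
    rw [hoff _ (by simp)]
    exact hx0 _ (by simp [mem_coins]) (by simp)

end SignMap

/-- The expectation of the reflection `(-1) ^ dec` after the state preparation is a multiple of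
the squared distance of two vectors that have the directions of the two data points and the
written norms. -/
theorem inner_prep {S : Matrix (Fin n) (Fin d) ℝ} {κ T : ℝ} {O : Oracles (L.width n d)}
    (hO : QuantumAccess L S κ T O) (hb : b ≤ L.normBits) (p q : Fin n) (e : Bool)
    {X : Fin n → Bits L.normBits}
    (hX : ∀ i, act (O AccessKind.norm).1
      (tensor (tensor (idxKet i) (zeroKet L.normBits)) (zeroKet L.normWork)) =
        tensor (tensor (idxKet i) (ket (X i))) (zeroKet L.normWork))
    (hlt : ∀ i, bitsVal (X i) < 2 ^ b) :
    inner ℂ ((prep hb).sem O (ket (conf (baseVal (natBits _ p) (natBits _ q) e))))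
      (signAt (wk .dec) ((prep hb).sem O (ket (conf (baseVal (natBits _ p) (natBits _ q) e))))) =
      ((1 / 4 * ∑ l : Bool, ∑ r : Bool, rsgn (xor l r) * (bitsVal (X (pick p q l)) / 2 ^ b) *
        (bitsVal (X (pick p q r)) / 2 ^ b) *
        (inner ℝ (row S (pick p q l)) (row S (pick p q r)) /
          (‖row S (pick p q l)‖ * ‖row S (pick p q r)‖)) : ℝ) : ℂ) := by
  have hψ := sem_mixPrep (b := b) hO p q e
  set ψ := mixPrep.sem O (ket (conf (baseVal (natBits _ p) (natBits _ q) e))) with hψd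
  have hne : ∀ x, ψ x ≠ 0 → ∀ a : Wire n d L b, ¬ a.IsFree →
      x (wr a) = baseVal (natBits _ p) (natBits _ q) e a := by
    intro x hx
    by_contra hcon
    exact hx (by rw [hψ, if_neg hcon])
  rw [prep, Prog.sem_append, ← hψd, inner_signAt_sem O (signPrep hb) (wk .dec) ψ
    (signMap hb p q X) fun x hx => sem_signPrep hb (hne x hx) hX]
  rw [sum_eq_sum_freeVal (baseVal (natBits _ p) (natBits _ q) e)]
  · have hval : ∀ y : FreeVal d b,
        ((‖ψ (conf (freeVal (baseVal (natBits _ p) (natBits _ q) e) y))‖ ^ 2 : ℝ) : ℂ) *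
          sgn (signMap hb p q X (conf (freeVal (baseVal (natBits _ p) (natBits _ q) e) y))
            (wk .dec)) =
        (((1 / 2 : ℝ) ^ (5 + 2 * b) * (rowAmp S (pick p q y.1) y.2.2.2.2.2.2 +
          rsgn y.2.2.1 * rowAmp S (pick p q y.2.1) y.2.2.2.2.2.2) ^ 2 *
        rsgn (if sampleBit b y.2.2.2.2.1 (fun i => X (pick p q y.1) (Fin.castLE hb i)) &&
            sampleBit b y.2.2.2.2.2.1 (fun i => X (pick p q y.2.1) (Fin.castLE hb i))
          then xor (xor y.1 y.2.1) y.2.2.1 else y.2.2.2.1) : ℝ) : ℂ) := by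
      intro y
      have hfr : ∀ a : Wire n d L b, ¬ a.IsFree →
          conf (freeVal (baseVal (natBits _ p) (natBits _ q) e) y) (wr a) =
            baseVal (natBits _ p) (natBits _ q) e a := fun a ha => by
        rw [conf_wr, freeVal_of_not_isFree _ _ ha]
      rw [hψ, if_pos hfr, signMap_dec hb hfr, norm_mul, norm_pow, mul_pow, pow_right_comm,
        norm_invSqrtTwo_sq, Complex.norm_real, Real.norm_eq_abs, sq_abs, ← rsgn_cast,
        ← Complex.ofReal_mul]
      simp only [conf_wr, freeVal, if_true, Bool.false_eq_true, if_false]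
    simp only [hval]
    rw [← Complex.ofReal_sum]
    congr 1
    have := sum_sampled_sign (b := b) (fun l z => rowAmp S (pick p q l) z)
      (fun s i => X (pick p q s) (Fin.castLE hb i))
    simp only [sum_rowAmp_mul, bitsVal_castLE hb _ (hlt _)] at this
    rw [← this]
    simp only [Fintype.sum_prod_type]
  · intro x hx
    refine hne x fun h0 => hx ?_
    rw [h0]
    simp

end

section

open ComplexConjugate

/-! ### Testing whether the work qubits are zero -/

variable {n d : ℕ} {L : AccessLayout} {b : ℕ}

/-- An enumeration of the work qubits. -/
def workEnum (i : Fin (Fintype.card (Work n d L b))) : Work n d L b := (Fintype.equivFin _).symm i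

/-- Compute in the last qubit of the ladder whether all work qubits are `|0⟩`, and whether the
function `f₀` of the signal qubit is true. -/
def ladder (f₀ : Bool → Bool) : List (CGate (wireCount n d L b)) :=
  cg (fun a _ => f₀ a) (.aux .sig) (.aux (.work .lft)) (.aux (.lad 0)) (by simp) ::
    (List.finRange (Fintype.card (Work n d L b))).map fun i =>
      cg (fun a c => a && !c) (.aux (.lad i.castSucc)) (.aux (.work (workEnum i)))
        (.aux (.lad i.succ)) (by simp [i.castSucc_lt_succ.ne])

/-- The last qubit of the ladder. -/
abbrev ladTop : Wire n d L b := .aux (.lad (Fin.last _))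

theorem ladder_pairwise (f₀ : Bool → Bool) :
    (ladder f₀ : List (CGate (wireCount n d L b))).Pairwise
      fun G G' => G'.t ≠ G.a ∧ G'.t ≠ G.b ∧ G'.t ≠ G.t := by
  rw [ladder, List.pairwise_cons]
  refine ⟨?_, pairwise_finRange_map _ fun i j hij => ?_⟩
  · intro G hG
    obtain ⟨i, -, rfl⟩ := List.mem_map.mp hG
    simp
  · have : ¬ j.succ = i.castSucc := fun h' => by
      have := congrArg Fin.val h'
      simp only [Fin.val_succ, Fin.val_castSucc] at this
      have := Fin.lt_def.mp hij
      omega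
    simp [hij.ne', this]

theorem crun_ladder_of_ne (f₀ : Bool → Bool) {a : Wire n d L b} (ha : ∀ i, a ≠ .aux (.lad i))
    (x : Bits (wireCount n d L b)) : crun (ladder f₀) x (wr a) = x (wr a) := by
  refine crun_of_ne (fun G hG => ?_) x
  rw [ladder, List.mem_cons, List.mem_map] at hG
  obtain rfl | ⟨i, -, rfl⟩ := hG <;> simp [ha]

theorem crun_ladder (f₀ : Bool → Bool) (x : Bits (wireCount n d L b))
    (hx : ∀ i, x (wr (.aux (.lad i))) = false) :
    crun (ladder f₀) x (wr ladTop) = true ↔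
      f₀ (x (wr (.aux .sig))) = true ∧ ∀ W : Work n d L b, x (wk W) = false := by
  have h1 := crun_eq (ladder_pairwise f₀) x
  have h2 := fun a ha => crun_ladder_of_ne f₀ (a := a) ha x
  generalize crun (ladder f₀) x = Z at h1 h2 ⊢
  simp only [ladder, List.mem_cons, List.mem_map, List.mem_finRange, true_and, or_imp,
    forall_and, forall_eq, forall_exists_index, forall_apply_eq_imp_iff, cg_a, cg_b, cg_t, cg_f,
    hx, Bool.false_xor] at h1
  obtain ⟨h0, hs⟩ := h1
  have key : ∀ i : Fin (Fintype.card (Work n d L b) + 1), Z (wr (.aux (.lad i))) = true ↔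
      f₀ (x (wr (.aux .sig))) = true ∧
        ∀ j : Fin (Fintype.card (Work n d L b)), (j : ℕ) < i → x (wk (workEnum j)) = false := by
    intro i
    induction i using Fin.induction with
    | zero =>
      rw [h0, h2 _ (by simp)]
      simp
    | succ i ih =>
      rw [hs, Bool.and_eq_true, ih, h2 _ (by simp), Bool.not_eq_true', and_assoc]
      refine and_congr_right fun _ => ⟨fun h j hj => ?_, fun h => ⟨fun j hj => h j ?_, h i ?_⟩⟩
      · rcases Nat.lt_succ_iff_lt_or_eq.mp hj with hj | hj
        · exact h.1 j hj
        · rw [Fin.ext hj]; exact h.2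
      · simp only [Fin.val_succ, Fin.val_castSucc] at hj ⊢
        omega
      · simp
  rw [key]
  refine and_congr_right fun _ => ⟨fun h W => ?_, fun h j _ => h _⟩
  have := h (Fintype.equivFin _ W) (by simp)
  rwa [workEnum, Equiv.symm_apply_apply] at this

/-- The reflection `2 |0⟩⟨0| - 1` about the state in which all work qubits are `|0⟩`, controlled by
the signal qubit: the ladder flips the sign on that state, and the last gate the overall sign. -/
def reflect : Prog (L.width n d) (wireCount n d L b) :=
  cprog (ladder id) ++ [signOp (wr (.aux .eq)) (wr ladTop) (by simp)] ++
    cprog (ladder id).reverse ++ [signOp (wr (.aux .eq)) (wr (.aux .sig)) (by simp)]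

theorem sem_reflect (O : Oracles (L.width n d)) (ψ : QState (wireCount n d L b))
    (x : Bits (wireCount n d L b)) :
    reflect.sem O ψ x = sgn (x (wr (.aux .sig))) * sgn (crun (ladder id) x (wr ladTop)) * ψ x := by
  rw [reflect, Prog.sem_append, Prog.sem_cons, Prog.sem_nil, sem_signOp,
    sem_cprog_reverse_sign O (ladder id) _ (fun x => sgn (x (wr ladTop))), mul_assoc]
  intro ψ x
  rw [Prog.sem_cons, Prog.sem_nil, sem_signOp]

/-! ### Comparing the two indices -/

/-- Compute whether the two index registers agree. -/
def eqGates : List (CGate (wireCount n d L b)) :=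
  (List.finRange (idxWidth n)).map (fun i =>
    cg xor (.p i) (.q i) (.aux (.work (.idx i))) (by simp)) ++ ladder fun _ => true

/-- Flip the qubit `eq` if the two index registers agree. -/
def eqProg : Prog (L.width n d) (wireCount n d L b) :=
  cprog eqGates ++
    [Op.cl (cg (fun a _ => a) ladTop (.aux .sig) (.aux .eq) (by simp))] ++ cprog eqGates.reverse

/-- The sums modulo two of the digits of the indices are computed in the index register of the black
boxes, and the ladder tests whether they vanish. -/
theorem crun_eqGates (x : Bits (wireCount n d L b))
    (hl : ∀ i, x (wr (.aux (.lad i))) = false) (hw : ∀ W : Work n d L b, x (wk W) = false) :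
    crun eqGates x (wr ladTop) = true ↔ ∀ i, x (wr (.p i)) = x (wr (.q i)) := by
  have h1 := crun_eq (pairwise_finRange_map (fun i =>
    cg xor (.p i) (.q i) (.aux (.work (.idx i)) : Wire n d L b) (by simp)) fun i j hij => by
      simp [hij.ne']) x
  have h2 : ∀ a : Wire n d L b, (∀ i, a ≠ .aux (.work (.idx i))) →
      crun ((List.finRange (idxWidth n)).map fun i =>
        cg xor (.p i) (.q i) (.aux (.work (.idx i)) : Wire n d L b) (by simp)) x (wr a) =
        x (wr a) := by
    intro a ha
    refine crun_of_ne (fun G hG => ?_) x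
    obtain ⟨i, -, rfl⟩ := List.mem_map.mp hG
    simp [ha]
  rw [eqGates, crun_append]
  generalize crun ((List.finRange (idxWidth n)).map fun i =>
    cg xor (.p i) (.q i) (.aux (.work (.idx i)) : Wire n d L b) (by simp)) x = y at h1 h2 ⊢
  rw [crun_ladder _ _ fun i => by rw [h2 _ (by simp), hl]]
  simp only [List.mem_map, List.mem_finRange, true_and,
    forall_exists_index, forall_apply_eq_imp_iff, cg_a, cg_b, cg_t, cg_f, hw, Bool.false_xor] at h1
  refine ⟨fun h i => ?_, fun h => ⟨rfl, fun W => ?_⟩⟩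
  · have h3 := h1 i
    rw [h.2, h2 _ (by simp), h2 _ (by simp)] at h3
    revert h3
    cases x (wr (.p i)) <;> cases x (wr (.q i)) <;> simp
  · by_cases hW : ∃ i, W = .idx i
    · obtain ⟨i, rfl⟩ := hW
      rw [h1, h2 _ (by simp), h2 _ (by simp), h i, Bool.xor_self]
    · rw [h2 _ (by simpa using hW), hw]

theorem eqGates_eq_ne (G : CGate (wireCount n d L b)) (hG : G ∈ eqGates) :
    (∀ a : Wire n d L b, a = .aux .eq ∨ a = .out → G.a ≠ wr a ∧ G.b ≠ wr a ∧ G.t ≠ wr a) ∧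
    (∀ i, G.t ≠ wr (.p i) ∧ G.t ≠ wr (.q i)) := by
  rw [eqGates, List.mem_append, List.mem_map, ladder, List.mem_cons, List.mem_map] at hG
  obtain ⟨i, -, rfl⟩ | rfl | ⟨i, -, rfl⟩ := hG <;> simp

theorem sem_eqProg (O : Oracles (L.width n d)) (x : Bits (wireCount n d L b))
    (hl : ∀ i, x (wr (.aux (.lad i))) = false) (hw : ∀ W : Work n d L b, x (wk W) = false) :
    eqProg.sem O (ket x) =
      ket (if ∀ i, x (wr (.p i)) = x (wr (.q i)) then flipBit (wr (.aux .eq)) x else x) := by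
  have hcl : ∀ (G : CGate (wireCount n d L b)) (y : Bits (wireCount n d L b)),
      (Op.cl G : Op (L.width n d) _).sem O (ket y) = ket (G.step y) := fun G y =>
    (sem_cprog_ket O [G] y : _)
  have hstep : (cg (fun a _ => a) ladTop (.aux .sig) (.aux .eq) (by simp) :
      CGate (wireCount n d L b)).step (crun eqGates x) =
      if ∀ i, x (wr (.p i)) = x (wr (.q i)) then flipBit (wr (.aux .eq)) (crun eqGates x)
      else crun eqGates x := by
    rw [CGate.step]
    simp only [← crun_eqGates x hl hw, cg_a, cg_t, cg_f, flipBit]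
    cases h : crun eqGates x (wr ladTop) <;> simp
  have htouch : ¬ (cprog eqGates.reverse : Prog (L.width n d) (wireCount n d L b)).Touches
      (wr (.aux .eq)) := by
    rintro ⟨g, hg, ht⟩
    obtain ⟨G, hG, rfl⟩ := List.mem_map.mp hg
    have := (eqGates_eq_ne G (List.mem_reverse.mp hG)).1 (.aux .eq) (Or.inl rfl)
    rcases ht with h | h | h
    · exact this.1 h.symm
    · exact this.2.1 h.symm
    · exact this.2.2 h.symm
  rw [eqProg, Prog.sem_append, Prog.sem_append, sem_cprog_ket, Prog.sem_cons, Prog.sem_nil, hcl,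
    hstep]
  split_ifs
  · rw [← flip_ket, Prog.sem_flip O _ htouch, sem_cprog_ket, crun_reverse_crun, flip_ket]
  · rw [sem_cprog_ket, crun_reverse_crun]

end

section

open ComplexConjugate

/-! ### Wires that the parts of the algorithm use -/

/-- The program uses only wires in `T` and changes only wires in `W`. -/
def Prog.Confined {ι : Type} {w : ι → ℕ} {N : ℕ} (T W : Set (Fin N)) (P : Prog w N) : Prop :=
  ∀ g ∈ P, (∀ i, g.Touches i → i ∈ T) ∧ ∀ i, g.Writes i → i ∈ W

namespace Prog.Confined

variable {ι : Type} {w : ι → ℕ} {N : ℕ} {T W : Set (Fin N)} {P Q : Prog w N}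

theorem append (hP : P.Confined T W) (hQ : Q.Confined T W) : (P ++ Q).Confined T W :=
  fun g hg => (List.mem_append.mp hg).elim (hP g) (hQ g)

theorem inv (hP : P.Confined T W) : (Prog.inv P).Confined T W := by
  intro g hg
  simp only [Prog.inv, List.mem_reverse, List.mem_map] at hg
  obtain ⟨g', hg', rfl⟩ := hg
  simpa only [Op.touches_inv, Op.writes_inv] using hP g' hg'

theorem mono {T' W' : Set (Fin N)} (hP : P.Confined T W) (hT : T ⊆ T') (hW : W ⊆ W') :
    P.Confined T' W' := fun g hg =>
  ⟨fun i hi => hT ((hP g hg).1 i hi), fun i hi => hW ((hP g hg).2 i hi)⟩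

theorem cprog {c : List (CGate N)} (h : ∀ G ∈ c, G.a ∈ T ∧ G.b ∈ T ∧ G.t ∈ T ∧ G.t ∈ W) :
    (QSim.cprog c : Prog w N).Confined T W := by
  intro g hg
  obtain ⟨G, hG, rfl⟩ := List.mem_map.mp hg
  obtain ⟨h1, h2, h3, h4⟩ := h G hG
  refine ⟨?_, ?_⟩
  · rintro i (rfl | rfl | rfl) <;> assumption
  · rintro i rfl
    exact h4

theorem rot {a t : Fin N} (h : a ≠ t) (M : Bool → Matrix.unitaryGroup Bool ℂ) (ha : a ∈ T)
    (ht : t ∈ T) (ht' : t ∈ W) : Prog.Confined T W ([Op.rot a t h M] : Prog w N) := by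
  intro g hg
  rw [List.mem_singleton] at hg
  subst hg
  refine ⟨?_, ?_⟩
  · rintro i (rfl | rfl) <;> assumption
  · intro i hi
    rwa [show i = t from hi]

theorem qry {o : ι} {e : Fin (w o) ↪ Fin N} {dg : Bool} (h : ∀ j, e j ∈ T ∧ e j ∈ W) :
    Prog.Confined T W ([Op.qry o dg e] : Prog w N) := by
  intro g hg
  rw [List.mem_singleton] at hg
  subst hg
  refine ⟨?_, ?_⟩
  · rintro i ⟨j, rfl⟩
    exact (h j).1
  · rintro i ⟨j, rfl⟩
    exact (h j).2

theorem flatMap {α : Type*} {l : List α} {F : α → Prog w N} (h : ∀ a, (F a).Confined T W) :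
    Prog.Confined T W (l.flatMap F) := fun g hg => by
  obtain ⟨a, -, hga⟩ := List.mem_flatMap.mp hg
  exact h a g hga

theorem not_touches (hP : P.Confined T W) {i : Fin N} (hi : i ∉ T) : ¬ P.Touches i :=
  fun ⟨g, hg, h⟩ => hi ((hP g hg).1 i h)

theorem not_writes (hP : P.Confined T W) {i : Fin N} (hi : i ∉ W) : ¬ P.Writes i :=
  fun ⟨g, hg, h⟩ => hi ((hP g hg).2 i h)

end Prog.Confined

variable {n d : ℕ} {L : AccessLayout} {b : ℕ}

theorem forall_loadEmb {N k l m : ℕ} {a : Fin k → Fin N} {a' : Fin l → Fin N} {r : Fin m → Fin N}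
    {he} {p : Fin N → Prop} (h : ∀ i, p (a i)) (h' : ∀ i, p (a' i)) (h'' : ∀ i, p (r i))
    (j : Fin (k + l + m)) : p (loadEmb a a' r he j) := by
  change p (Fin.append (Fin.append a a') r j)
  induction j using Fin.addCases with
  | left j =>
    induction j using Fin.addCases with
    | left j => simpa using h j
    | right j => simpa using h' j
  | right j => simpa using h'' j

/-- The wires that the state preparation uses. -/
def prepWires (n d : ℕ) (L : AccessLayout) (b : ℕ) : Set (Fin (wireCount n d L b)) :=
  {i | i ≠ wr (.aux .sig) ∧ i ≠ wr .out}

/-- The work wires. -/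
def workWires (n d : ℕ) (L : AccessLayout) (b : ℕ) : Set (Fin (wireCount n d L b)) :=
  Set.range wk

theorem wk_mem (W : Work n d L b) : wk W ∈ prepWires n d L b ∧ wk W ∈ workWires n d L b :=
  ⟨by simp [prepWires], W, rfl⟩

theorem confined_cprog_selIdx (s : Work n d L b) (hs) :
    (cprog (selIdx s hs) : Prog (L.width n d) _).Confined (prepWires n d L b)
      (workWires n d L b) := by
  refine Prog.Confined.cprog fun G hG => ?_
  obtain ⟨i, h1, h2 | h2, h3⟩ := mem_selIdx hG <;> rw [h1, h2, h3] <;>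
    simp [prepWires, workWires]

theorem confined_cprog_reverse {ι : Type} {w : ι → ℕ} {N : ℕ} {T W : Set (Fin N)}
    {c : List (CGate N)} (h : (cprog c : Prog w N).Confined T W) :
    (cprog c.reverse : Prog w N).Confined T W := by
  rw [← inv_cprog]
  exact h.inv

theorem confined_rowLoad : (rowLoad : Prog (L.width n d) (wireCount n d L b)).Confined
    (prepWires n d L b) (workWires n d L b) := by
  have h : (cprog rowIdx : Prog (L.width n d) (wireCount n d L b)).Confined
      (prepWires n d L b) (workWires n d L b) := by
    rw [rowIdx, cprog_append]
    refine Prog.Confined.append (Prog.Confined.cprog fun G hG => ?_) (confined_cprog_selIdx _ _)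
    simp only [List.mem_cons, List.not_mem_nil, or_false] at hG
    rcases hG with rfl | rfl <;> simp [prepWires, workWires]
  exact (h.append (Prog.Confined.qry fun j => by
    exact forall_loadEmb (p := fun i => i ∈ prepWires n d L b ∧ i ∈ workWires n d L b)
      (fun i => wk_mem _) (fun i => wk_mem _) (fun i => wk_mem _) j)).append
    (confined_cprog_reverse h)

theorem confined_normLoad (s : Bool) :
    (normLoad s : Prog (L.width n d) (wireCount n d L b)).Confined
    (prepWires n d L b) (workWires n d L b) :=
  ((confined_cprog_selIdx _ _).append (Prog.Confined.qry fun j => by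
    exact forall_loadEmb (p := fun i => i ∈ prepWires n d L b ∧ i ∈ workWires n d L b)
      (fun i => wk_mem _) (fun i => wk_mem _) (fun i => wk_mem _) j)).append (confined_cprog_reverse
      (confined_cprog_selIdx _ _))

theorem confined_prep (hb : b ≤ L.normBits) :
    (prep hb : Prog (L.width n d) (wireCount n d L b)).Confined
    (prepWires n d L b) (workWires n d L b) := by
  have heq : wr (.aux .eq) ∈ prepWires n d L b := by simp [prepWires]
  refine Prog.Confined.append (Prog.Confined.append (Prog.Confined.append ?_ confined_rowLoad)
    (Prog.Confined.rot _ _ heq (wk_mem _).1 (wk_mem _).2)) (Prog.Confined.append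
      ((confined_normLoad _).append (confined_normLoad _)) (Prog.Confined.cprog fun G hG => ?_))
  · intro g hg
    obtain ⟨W, -, rfl⟩ := List.mem_map.mp hg
    exact Prog.Confined.rot _ _ heq (wk_mem W).1 (wk_mem W).2 _ (List.mem_singleton_self _)
  · simp only [signGates₁, signGates₂, List.mem_append, List.mem_cons, List.not_mem_nil, or_false,
      List.mem_map] at hG
    rcases hG with (((rfl | rfl) | ⟨i, -, rfl⟩) | ⟨i, -, rfl⟩) |
      ((⟨i, -, rfl⟩ | ⟨i, -, rfl⟩) | rfl | rfl | rfl) <;> simp [prepWires, workWires]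

/-- The wires that the search for the decision uses. -/
def decWires (n d : ℕ) (L : AccessLayout) (b : ℕ) : Set (Fin (wireCount n d L b)) :=
  {i | i ≠ wr .out}

/-- The wires outside the index registers. -/
def freeWires (n d : ℕ) (L : AccessLayout) (b : ℕ) : Set (Fin (wireCount n d L b)) :=
  {i | ∀ j, i ≠ wr (.p j) ∧ i ≠ wr (.q j)}

theorem prepWires_subset : prepWires n d L b ⊆ decWires n d L b := fun _ h => h.2

theorem workWires_subset : workWires n d L b ⊆ freeWires n d L b := by
  rintro _ ⟨W, rfl⟩ j
  simp

theorem confined_ladder (f₀ : Bool → Bool) :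
    (cprog (ladder f₀) : Prog (L.width n d) (wireCount n d L b)).Confined
      (decWires n d L b) (freeWires n d L b) := by
  refine Prog.Confined.cprog fun G hG => ?_
  rw [ladder, List.mem_cons, List.mem_map] at hG
  obtain rfl | ⟨i, -, rfl⟩ := hG <;> simp [decWires, freeWires]

theorem confined_reflect : (reflect : Prog (L.width n d) (wireCount n d L b)).Confined
    (decWires n d L b) (freeWires n d L b) := by
  rw [reflect, signOp, signOp]
  refine (((confined_ladder _).append (Prog.Confined.rot _ _ ?_ ?_ ?_)).append
    (confined_cprog_reverse (confined_ladder _))).append (Prog.Confined.rot _ _ ?_ ?_ ?_) <;>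
  simp [decWires, freeWires]

theorem confined_eqProg : (eqProg : Prog (L.width n d) (wireCount n d L b)).Confined
    (decWires n d L b) (freeWires n d L b) := by
  have h : (cprog eqGates : Prog (L.width n d) (wireCount n d L b)).Confined
      (decWires n d L b) (freeWires n d L b) := by
    rw [eqGates, cprog_append]
    refine Prog.Confined.append (Prog.Confined.cprog fun G hG => ?_) (confined_ladder _)
    obtain ⟨i, -, rfl⟩ := List.mem_map.mp hG
    simp [decWires, freeWires]
  refine (h.append ?_).append (confined_cprog_reverse h)
  exact Prog.Confined.cprog (c := [_]) fun G hG => by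
    rw [List.mem_singleton.mp hG]
    simp [decWires, freeWires]

/-! ### Running times of the parts of the algorithm -/

theorem length_selIdx (s : Work n d L b) (hs) : (selIdx s hs).length = 2 * idxWidth n := by
  simp [selIdx]
  ring

theorem time_prep (hb : b ≤ L.normBits) (T : ℝ) :
    (prep hb : Prog (L.width n d) (wireCount n d L b)).time T =
      50 + 22 * b + 60 * idxWidth n + 3 * T := by
  have h : Prog.time T ((coins n d L b).map fun W =>
      (had (wr (.aux .eq)) (wk W) (by simp) : Op (L.width n d) _)) = (4 + 2 * b : ℕ) := by
    exact (Prog.time_map_rot _ _ _ fun W => time_rot _ _ _ _ _).trans (by rw [length_coins])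
  rw [prep, mixPrep, Prog.time_append, Prog.time_append, Prog.time_append, h]
  simp only [signPrep, rowLoad, normLoad, had, Prog.time_append, Prog.time_cons,
    Prog.time_nil, time_rot, time_qry, Prog.time_cprog, List.length_reverse, length_selIdx, rowIdx,
    signGates₁, signGates₂, List.length_append,
    List.length_cons, List.length_nil, List.length_map, List.length_finRange]
  push_cast
  ring

theorem time_reflect (T : ℝ) : (reflect : Prog (L.width n d) (wireCount n d L b)).time T =
    12 + 10 * Fintype.card (Work n d L b) := by
  simp only [reflect, Prog.time_append, Prog.time_cons, signOp, Prog.time_nil, time_rot,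
    Prog.time_cprog, List.length_reverse, ladder, List.length_cons, List.length_map,
    List.length_finRange]
  push_cast
  ring

theorem time_eqProg (T : ℝ) : (eqProg : Prog (L.width n d) (wireCount n d L b)).time T =
    15 + 10 * idxWidth n + 10 * Fintype.card (Work n d L b) := by
  simp only [eqProg, eqGates, Prog.time_append, Prog.time_cons, Prog.time_nil, time_cl,
    Prog.time_cprog, List.length_reverse, ladder, List.length_cons, List.length_map,
    List.length_append, List.length_finRange]
  push_cast
  ring

end

section

open ComplexConjugate

/-! ### The algorithm -/

variable {n d : ℕ} {L : AccessLayout} {b : ℕ}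

/-- The controlled reflection `(-1) ^ dec`. -/
def decSign : Prog (L.width n d) (wireCount n d L b) :=
  [ctrlSignOp (wr (.aux .sig)) (wk .dec) (by simp)]

/-- Signal processing of the walk: the decision is computed in the signal qubit. -/
def decProg (hb : b ≤ L.normBits) (M₀ : Matrix.unitaryGroup Bool ℂ)
    (Ms : List (Matrix.unitaryGroup Bool ℂ)) : Prog (L.width n d) (wireCount n d L b) :=
  prep hb ++ signalProg (walk (prep hb) reflect decSign) (wr (.aux .eq)) (wr (.aux .sig))
    (by simp) M₀ Ms

/-- The whole algorithm: the decision is copied to the output if the two indices differ, and all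
other qubits are restored. -/
def similarityProg (hb : b ≤ L.normBits) (M₀ : Matrix.unitaryGroup Bool ℂ)
    (Ms : List (Matrix.unitaryGroup Bool ℂ)) : Prog (L.width n d) (wireCount n d L b) :=
  eqProg ++ copyDecision (decProg hb M₀ Ms)
    (copyGate (wr (.aux .sig)) (wr (.aux .eq)) (wr .out) (by simp) (by simp) (by simp)) ++
    Prog.inv eqProg

theorem confined_decProg (hb : b ≤ L.normBits) (M₀ : Matrix.unitaryGroup Bool ℂ)
    (Ms : List (Matrix.unitaryGroup Bool ℂ)) :
    (decProg hb M₀ Ms : Prog (L.width n d) (wireCount n d L b)).Confined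
      (decWires n d L b) (freeWires n d L b) := by
  have hp := (confined_prep (n := n) (d := d) hb).mono prepWires_subset workWires_subset
  have hrot : ∀ M, Prog.Confined (decWires n d L b) (freeWires n d L b)
      ([signalRot (wr (.aux .eq)) (wr (.aux .sig)) (by simp) M] : Prog (L.width n d) _) :=
    fun M => by
      rw [signalRot]
      refine Prog.Confined.rot _ _ ?_ ?_ ?_ <;> simp [decWires, freeWires]
  have hZ : (decSign : Prog (L.width n d) (wireCount n d L b)).Confined
      (decWires n d L b) (freeWires n d L b) := by
    rw [decSign, ctrlSignOp]
    refine Prog.Confined.rot _ _ ?_ ?_ ?_ <;> simp [decWires, freeWires]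
  refine hp.append ?_
  rw [signalProg, ← List.singleton_append]
  exact (hrot _).append (Prog.Confined.flatMap fun M =>
    (((hZ.append hp.inv).append confined_reflect).append hp).append (hrot M))

/-- The parts of the algorithm satisfy the requirements of the walk; the wires that are kept fixed
are all those that are not work qubits. -/
theorem walkData (O : Oracles (L.width n d)) (hb : b ≤ L.normBits) (P Q : Bits (idxWidth n))
    (e : Bool) : WalkData O (prep hb) reflect decSign {i | i ∉ workWires n d L b}
      (conf (baseVal P Q e)) (wr (.aux .sig)) (wk .dec) where
  g_mem := by simp [workWires]
  x₀_g := by rw [conf_wr]; rfl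
  ne := by simp
  A_writes i hi := (confined_prep hb).not_writes hi
  A_touches := (confined_prep hb).not_touches fun h => h.1 rfl
  sem_Z ψ x := by rw [decSign, Prog.sem_cons, Prog.sem_nil, sem_ctrlSignOp]
  sem_R := by
    refine ⟨fun x => sgn (x (wr (.aux .sig))) * sgn (crun (ladder id) x (wr ladTop)),
      sem_reflect O, fun x hx => ?_⟩
    have hx' : ∀ a : Wire n d L b, (∀ W, a ≠ .aux (.work W)) → a ≠ .aux .sig →
        x (wr a) = baseVal P Q e a := fun a ha ha' => by
      rw [hx (wr a) (by simpa [workWires, eq_comm] using ha) (by simpa using ha'), conf_wr]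
    have hl := crun_ladder id x fun i => hx' _ (by simp) (by simp)
    have heq : x = flipBit (wr (.aux .sig)) (conf (baseVal P Q e)) ↔
        id (x (wr (.aux .sig))) = true ∧ ∀ W : Work n d L b, x (wk W) = false := by
      constructor
      · rintro h
        rw [h]
        refine ⟨?_, fun W => ?_⟩
        · rw [flipBit_self, conf_wr]; rfl
        · rw [flipBit_of_ne (by simp), conf_wr]; rfl
      · rintro ⟨h1, h2⟩
        refine bits_ext fun a => ?_
        by_cases ha : a = .aux .sig
        · rw [ha, flipBit_self, conf_wr]
          exact h1
        · rw [flipBit_of_ne (by simpa using ha), conf_wr]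
          by_cases ha' : ∃ W, a = .aux (.work W)
          · obtain ⟨W, rfl⟩ := ha'
            exact h2 W
          · exact hx' a (by simpa using ha') ha
    rw [← hl] at heq
    dsimp only
    cases hg : x (wr (.aux .sig))
    · have : crun (ladder id) x (wr ladTop) = false := by
        rw [← Bool.not_eq_true, hl, hg]
        simp
      simp [this, sgn]
    · by_cases h : crun (ladder id) x (wr ladTop) = true
      · rw [if_pos rfl, if_pos (heq.mpr h), h]
        simp [sgn]
      · have h' : x ≠ flipBit (wr (.aux .sig)) (conf (baseVal P Q e)) := fun h' => h (heq.mp h')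
        rw [Bool.not_eq_true] at h
        simp [h, h', sgn]

theorem sem_eqProg_base (O : Oracles (L.width n d)) (p q : Fin n) :
    (eqProg : Prog (L.width n d) (wireCount n d L b)).sem O
        (ket (conf (baseVal (natBits _ p) (natBits _ q) false))) =
      ket (conf (baseVal (natBits _ p) (natBits _ q) (decide (p = q)))) := by
  have h : (∀ i, natBits (idxWidth n) p i = natBits (idxWidth n) q i) ↔ p = q :=
    ⟨fun h => natBits_idx_injective n (funext h), fun h i => by rw [h]⟩
  rw [sem_eqProg O _ (fun i => by rw [conf_wr]; rfl) fun W => by rw [conf_wr]; rfl]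
  congr 1
  simp only [conf_wr, baseVal]
  by_cases hpq : p = q
  · subst hpq
    rw [if_pos fun i => rfl, decide_eq_true rfl]
    refine bits_ext fun a => ?_
    rw [conf_wr]
    by_cases ha : a = .aux .eq
    · rw [ha, flipBit_self, conf_wr]; rfl
    · rw [flipBit_of_ne (by simpa using ha), conf_wr]
      unfold baseVal
      split <;> first | rfl | exact absurd rfl ha
  · rw [if_neg fun h' => hpq (h.mp h'), decide_eq_false hpq]

theorem norm_sem_inv_sub {ι : Type} {w : ι → ℕ} {N : ℕ} (O : Oracles w) (P : Prog w N)
    (φ χ : QState N) : ‖(Prog.inv P).sem O φ - χ‖ = ‖φ - P.sem O χ‖ := by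
  rw [← Prog.norm_sem O P, map_sub, Prog.sem_sem_inv]

/-- The final state of the algorithm, when the signal amplitudes at the walk eigenvalues are
small for one of the two decisions. -/
theorem sem_similarityProg (O : Oracles (L.width n d)) (hb : b ≤ L.normBits)
    (M₀ : Matrix.unitaryGroup Bool ℂ) (Ms : List (Matrix.unitaryGroup Bool ℂ)) (p q : Fin n)
    {u : ℝ} (hu : inner ℂ ((prep hb).sem O (ket (conf (baseVal (natBits _ p) (natBits _ q)
        (decide (p = q)))))) (signAt (wk .dec) ((prep hb).sem O (ket (conf (baseVal (natBits _ p)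
        (natBits _ q) (decide (p = q))))))) = (u : ℂ)) :
    (p = q → (similarityProg hb M₀ Ms).sem O
        (ket (conf (baseVal (natBits _ p) (natBits _ q) false))) =
      ket (conf (baseVal (natBits _ p) (natBits _ q) false))) ∧
    (p ≠ q → ∀ δ : ℝ,
      ((∀ z : ℂ, ‖z‖ = 1 → z.re = u → ‖signalAmp M₀ Ms z true‖ ≤ δ) →
        ‖(similarityProg hb M₀ Ms).sem O
            (ket (conf (baseVal (natBits _ p) (natBits _ q) false))) -
          ket (conf (baseVal (natBits _ p) (natBits _ q) false))‖ ≤ 4 * δ) ∧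
      ((∀ z : ℂ, ‖z‖ = 1 → z.re = u → ‖signalAmp M₀ Ms z false‖ ≤ δ) →
        ‖(similarityProg hb M₀ Ms).sem O
            (ket (conf (baseVal (natBits _ p) (natBits _ q) false))) -
          ket (flipBit (wr .out) (conf (baseVal (natBits _ p) (natBits _ q) false)))‖ ≤
          4 * δ)) := by
  have H := walkData O hb (natBits _ p) (natBits _ q) (decide (p = q))
  obtain ⟨ψ, hψ, hsem, hsmall⟩ := H.exists_signal_components (d := wr (.aux .eq)) (by simp) M₀ Ms hu
  have heq := sem_eqProg_base (b := b) O p q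
  have hE : (eqProg : Prog (L.width n d) (wireCount n d L b)).sem O
      (ket (flipBit (wr .out) (conf (baseVal (natBits _ p) (natBits _ q) false)))) =
      ket (flipBit (wr .out) (conf (baseVal (natBits _ p) (natBits _ q) (decide (p = q))))) := by
    rw [← flip_ket, Prog.sem_flip O _ (confined_eqProg.not_touches fun h => h rfl), heq, flip_ket]
  set x₀ : Bits (wireCount n d L b) :=
    conf (baseVal (natBits _ p) (natBits _ q) (decide (p = q))) with hx₀
  have hx₀q : x₀ (wr (.aux .eq)) = decide (p = q) := conf_wr _ _
  have hfix : ∀ β, FixedAt (wr (.aux .sig)) false (ψ β) := fun β => H.fixedAt_g (hψ β)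
  have hfixq : ∀ β, FixedAt (wr (.aux .eq)) (x₀ (wr (.aux .eq))) (ψ β) := fun β =>
    hψ β _ (by simp [workWires])
  obtain ⟨h1, h2⟩ := decide_bounds (O := O) (g := wr (.aux .sig)) (q := wr (.aux .eq))
    (o := wr .out) (by simp) (by simp) (by simp) (U := decProg hb M₀ Ms) (x₀ := x₀)
    ((confined_decProg hb M₀ Ms).not_touches fun h => h rfl) (hfix false) (hfix true).flip_self
    (hfixq false) ((hfixq true).flip_of_ne (by simp))
    (by rw [decProg, Prog.sem_append, hsem])
  rw [hx₀q, decide_eq_true_eq] at h1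
  rw [hx₀q, decide_eq_false_iff_not] at h2
  rw [similarityProg, Prog.sem_append, Prog.sem_append, heq]
  refine ⟨fun hpq => ?_, fun hpq δ => ⟨fun hδ => ?_, fun hδ => ?_⟩⟩
  · rw [h1 hpq, ← heq, Prog.sem_inv_sem]
  · rw [norm_sem_inv_sub, heq]
    have := hsmall true δ hδ
    rw [norm_flip] at h2
    linarith [(h2 hpq).1]
  · rw [norm_sem_inv_sub, hE]
    have := hsmall false δ hδ
    linarith [(h2 hpq).2]

/-- The index registers are not written to. -/
theorem fixedAt_similarityProg (O : Oracles (L.width n d)) (hb : b ≤ L.normBits)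
    (M₀ : Matrix.unitaryGroup Bool ℂ) (Ms : List (Matrix.unitaryGroup Bool ℂ))
    {a : Wire n d L b} (ha : (∃ i, a = .p i) ∨ ∃ i, a = .q i) (x : Bits (wireCount n d L b)) :
    FixedAt (wr a) (x (wr a)) ((similarityProg hb M₀ Ms).sem O (ket x)) := by
  refine Prog.fixedAt_sem O _ (fun h => ?_) (fixedAt_ket _ x)
  have hE := confined_eqProg (n := n) (d := d) (L := L) (b := b)
  have hU := confined_decProg (n := n) (d := d) hb M₀ Ms
  have hc : Prog.Writes ([Op.cl (copyGate (wr (.aux .sig)) (wr (.aux .eq)) (wr .out) (by simp)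
      (by simp) (by simp))] : Prog (L.width n d) (wireCount n d L b)) (wr a) → a = .out := by
    rintro ⟨g, hg, hw⟩
    rw [List.mem_singleton.mp hg] at hw
    exact wr_inj.mp hw
  have hfree : wr a ∉ freeWires n d L b := by
    rcases ha with ⟨i, rfl⟩ | ⟨i, rfl⟩ <;> intro h <;> simpa using h i
  rw [similarityProg, copyDecision, Prog.writes_append, Prog.writes_append, Prog.writes_append,
    Prog.writes_append, Prog.writes_inv, Prog.writes_inv] at h
  rcases h with (h | (h | h) | h) | h
  · exact hE.not_writes hfree h
  · exact hU.not_writes hfree h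
  · rcases ha with ⟨i, rfl⟩ | ⟨i, rfl⟩ <;> exact absurd (hc h) (by simp)
  · exact hU.not_writes hfree h
  · exact hE.not_writes hfree h

/-! ### Product states -/

/-- A state whose first register has fixed bits is a product state. -/
theorem eq_tensor_of_fixedAt {M K : ℕ} (x : Bits M) (ψ : QState (M + K))
    (h : ∀ i, FixedAt (Fin.castAdd K i) (x i) ψ) :
    ψ = tensor (ket x) (WithLp.toLp 2 fun y => ψ (Fin.append x y)) := by
  ext z
  rw [tensor_apply, ket_apply]
  split_ifs with hz
  · rw [one_mul]
    refine congrArg ψ (funext fun i => ?_)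
    refine Fin.addCases (fun i => ?_) (fun i => ?_) i
    · rw [Fin.append_left, ← hz]
    · rw [Fin.append_right]
  · rw [zero_mul]
    obtain ⟨i, hi⟩ := Function.ne_iff.mp hz
    exact h i z hi

theorem norm_tensor_ket {M K : ℕ} (x : Bits M) (φ : QState K) : ‖tensor (ket x) φ‖ = ‖φ‖ := by
  rw [EuclideanSpace.norm_eq, EuclideanSpace.norm_eq]
  congr 1
  symm
  refine Finset.sum_of_injOn (fun y => Fin.append x y) ?_ (by simp) ?_ ?_
  · intro y _ y' _ h
    funext j
    simpa using congrFun h (Fin.natAdd M j)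
  · intro z _ hz
    rw [tensor_apply, ket_apply, if_neg, zero_mul, norm_zero, zero_pow two_ne_zero]
    intro hx
    refine hz ⟨fun j => z (Fin.natAdd M j), by simp, funext fun i => ?_⟩
    dsimp only
    refine Fin.addCases (fun i => ?_) (fun i => ?_) i
    · rw [Fin.append_left, ← hx]
    · rw [Fin.append_right]
  · intro y _
    rw [tensor_apply, ket_apply, if_pos (by simp)]
    simp

theorem tensor_sub {M K : ℕ} (φ : QState M) (ψ χ : QState K) :
    tensor φ (ψ - χ) = tensor φ ψ - tensor φ χ := by
  ext z
  simp [tensor_apply, mul_sub]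

open Classical in
/-- The initial and the ideal final state as basis states of all wires. -/
theorem tensor_base (x y : Bits (idxWidth n)) (o : Bool) :
    tensor (tensor (ket x) (ket y)) (tensor (ket fun _ : Fin 1 => o) (zeroKet (auxCount n d L b))) =
      ket (if o then flipBit (wr .out) (conf (baseVal x y false))
        else conf (baseVal x y false)) := by
  rw [zeroKet, tensor_ket_ket, tensor_ket_ket, tensor_ket_ket]
  congr 1
  refine bits_ext fun a => ?_
  have h : (if o then flipBit (wr .out) (conf (baseVal x y false)) else
      conf (baseVal x y false) : Bits (wireCount n d L b)) (wr a) =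
      if a = .out then o else baseVal x y false a := by
    cases o
    · rw [if_neg (by simp), conf_wr]
      split_ifs with ha
      · rw [ha]; rfl
      · rfl
    · rw [if_pos rfl]
      split_ifs with ha
      · rw [ha, flipBit_self, conf_wr]; rfl
      · rw [flipBit_of_ne (by simpa using ha), conf_wr]
  rw [h]
  match a with
  | .p i =>
    rw [if_neg (by simp)]
    simp only [wr, Fin.append_left, baseVal]
  | .q i =>
    rw [if_neg (by simp)]
    simp only [wr, Fin.append_right, Fin.append_left, baseVal]
  | .out => simp only [wr, Fin.append_right, Fin.append_left, if_true]
  | .aux ρ =>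
    rw [if_neg (by simp)]
    simp only [wr, Fin.append_right]
    cases ρ <;> rfl

end

section

open ComplexConjugate

/-! ### The precision of the computed expectation -/

variable {n d : ℕ} {L : AccessLayout} {b : ℕ}

/-- The number `b` of low bits of a `B`-bit register that suffices for values up to `s`, without
`2 ^ b` being much larger than `s`. -/
theorem exists_bit_count {s : ℝ} (hs : 1 ≤ s) (B : ℕ) :
    ∃ b ≤ B, (2 : ℝ) ^ b ≤ 2 * s ∧ (b = B ∨ s < 2 ^ b) := by
  induction B with
  | zero => exact ⟨0, le_rfl, by norm_num; linarith, Or.inl rfl⟩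
  | succ B ih =>
    obtain ⟨b, hb, h1, rfl | h2⟩ := ih
    · by_cases h : (2 : ℝ) ^ (b + 1) ≤ 2 * s
      · exact ⟨b + 1, le_rfl, h, Or.inl rfl⟩
      · refine ⟨b, b.le_succ, h1, Or.inr ?_⟩
        rw [pow_succ] at h
        linarith
    · exact ⟨b, by omega, h1, Or.inr h2⟩

theorem bitsVal_lt {N : ℕ} (x : Bits N) : bitsVal x < 2 ^ N := by
  induction N with
  | zero => simp [bitsVal]
  | succ N ih =>
    have := ih fun i => x i.castSucc
    rw [bitsVal_succ, pow_succ]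
    split_ifs <;> omega

/-- The squared distance of two vectors changes little if their lengths `a`, `c` are replaced by
estimates of precision `κ`; here `t` is the cosine of the angle. -/
theorem abs_sqDist_sub_le {a c a' c' t κ s : ℝ} (ha : |a' - a| ≤ κ) (hc : |c' - c| ≤ κ)
    (ht : |t| ≤ 1) (has : |a| ≤ s) (hcs : |c| ≤ s) :
    |(a' ^ 2 - 2 * (a' * c' * t) + c' ^ 2) - (a ^ 2 - 2 * (a * c * t) + c ^ 2)| ≤
      8 * κ * s + 4 * κ ^ 2 := by
  obtain ⟨α, rfl⟩ : ∃ α, a' = a + α := ⟨a' - a, by ring⟩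
  obtain ⟨β, rfl⟩ : ∃ β, c' = c + β := ⟨c' - c, by ring⟩
  rw [add_sub_cancel_left] at ha hc
  have hκ : 0 ≤ κ := (abs_nonneg α).trans ha
  have hs : 0 ≤ s := (abs_nonneg a).trans has
  have h1 : |α * (2 * a - 2 * (t * c))| ≤ κ * (4 * s) := by
    rw [abs_mul]
    refine mul_le_mul ha ?_ (abs_nonneg _) hκ
    have : |t * c| ≤ 1 * s := by rw [abs_mul]; exact mul_le_mul ht hcs (abs_nonneg _) zero_le_one
    rw [abs_le] at this has ⊢
    constructor <;> linarith [this.1, this.2, has.1, has.2]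
  have h2 : |β * (2 * c - 2 * (t * a))| ≤ κ * (4 * s) := by
    rw [abs_mul]
    refine mul_le_mul hc ?_ (abs_nonneg _) hκ
    have : |t * a| ≤ 1 * s := by rw [abs_mul]; exact mul_le_mul ht has (abs_nonneg _) zero_le_one
    rw [abs_le] at this hcs ⊢
    constructor <;> linarith [this.1, this.2, hcs.1, hcs.2]
  have h3 : |α ^ 2 + β ^ 2 - 2 * (t * (α * β))| ≤ 4 * κ ^ 2 := by
    have e1 : α ^ 2 ≤ κ ^ 2 := sq_le_sq' (by linarith [(abs_le.mp ha).1]) (abs_le.mp ha).2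
    have e2 : β ^ 2 ≤ κ ^ 2 := sq_le_sq' (by linarith [(abs_le.mp hc).1]) (abs_le.mp hc).2
    have e3 : |t * (α * β)| ≤ 1 * (κ * κ) := by
      rw [abs_mul, abs_mul]
      exact mul_le_mul ht (mul_le_mul ha hc (abs_nonneg _) hκ) (by positivity) zero_le_one
    rw [abs_le] at e3 ⊢
    constructor <;> nlinarith [sq_nonneg α, sq_nonneg β, e3.1, e3.2]
  have hsplit : ((a + α) ^ 2 - 2 * ((a + α) * (c + β) * t) + (c + β) ^ 2) -
      (a ^ 2 - 2 * (a * c * t) + c ^ 2) = α * (2 * a - 2 * (t * c)) + β * (2 * c - 2 * (t * a)) +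
        (α ^ 2 + β ^ 2 - 2 * (t * (α * β))) := by ring
  rw [hsplit]
  refine (abs_add_three _ _ _).trans ?_
  linarith

/-- The expectation of the sampled sign is the scaled squared distance of two vectors with the
directions of the data points and the written norms. -/
theorem expectation_eq {S : Matrix (Fin n) (Fin d) ℝ} (h0 : ∀ i, 0 < ‖row S i‖) (p q : Fin n)
    (x : Fin n → ℝ) :
    1 / 4 * ∑ l : Bool, ∑ r : Bool, rsgn (xor l r) * (x (pick p q l) / 2 ^ b) *
        (x (pick p q r) / 2 ^ b) * (inner ℝ (row S (pick p q l)) (row S (pick p q r)) /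
          (‖row S (pick p q l)‖ * ‖row S (pick p q r)‖)) =
      1 / (4 * (2 ^ b) ^ 2) * (x p ^ 2 - 2 * (x p * x q * (inner ℝ (row S p) (row S q) /
        (‖row S p‖ * ‖row S q‖))) + x q ^ 2) := by
  have hself : ∀ i, inner ℝ (row S i) (row S i) / (‖row S i‖ * ‖row S i‖) = 1 := fun i => by
    rw [real_inner_self_eq_norm_mul_norm, div_self (mul_pos (h0 i) (h0 i)).ne']
  simp only [Fintype.sum_bool, pick, if_true, Bool.false_eq_true, if_false, hself,
    real_inner_comm (row S p) (row S q), mul_comm ‖row S q‖ ‖row S p‖, rsgn, Bool.xor_self,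
    Bool.true_xor, Bool.false_xor, Bool.not_false]
  have : (2 : ℝ) ^ b ≠ 0 := by positivity
  field_simp
  ring

theorem dist_sq_eq {S : Matrix (Fin n) (Fin d) ℝ} (h0 : ∀ i, 0 < ‖row S i‖) (p q : Fin n) :
    dist (row S p) (row S q) ^ 2 = ‖row S p‖ ^ 2 - 2 * (‖row S p‖ * ‖row S q‖ *
      (inner ℝ (row S p) (row S q) / (‖row S p‖ * ‖row S q‖))) + ‖row S q‖ ^ 2 := by
  rw [dist_eq_norm, norm_sub_sq_real, mul_div_cancel₀ _ (mul_pos (h0 p) (h0 q)).ne']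

/-- What the algorithm assumes about the data and the access to them. -/
structure GoodAccess (L : AccessLayout) (S : Matrix (Fin n) (Fin d) ℝ) (κ T : ℝ)
    (O : Oracles (L.width n d)) (ε η : ℝ) : Prop where
  access : QuantumAccess L S κ T O
  one_le_norm : ∀ i, 1 ≤ ‖row S i‖
  norm_sq_le : ∀ i, ‖row S i‖ ^ 2 ≤ η
  kappa : 16 * κ * √η ≤ ε
  eps_pos : 0 < ε
  eps_le : ε ≤ η

/-- The factor by which the squared distance is scaled. -/
def distScale (L : AccessLayout) (b : ℕ) : ℝ := (2 ^ L.normFrac) ^ 2 / (4 * (2 ^ b) ^ 2)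

/-- The expectation of the sampled sign approximates the scaled squared distance. -/
theorem GoodAccess.exists_expectation {S : Matrix (Fin n) (Fin d) ℝ} {κ T ε η : ℝ}
    {O : Oracles (L.width n d)} (H : GoodAccess L S κ T O ε η) (hb : b ≤ L.normBits)
    (hb' : b = L.normBits ∨ 2 * √η * 2 ^ L.normFrac < 2 ^ b) (p q : Fin n) :
    ∃ D : ℝ, |D - dist (row S p) (row S q) ^ 2| ≤ 33 / 64 * ε ∧ ∀ e,
      inner ℂ ((prep hb).sem O (ket (conf (baseVal (natBits _ p) (natBits _ q) e))))
        (signAt (wk .dec) ((prep hb).sem O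
          (ket (conf (baseVal (natBits _ p) (natBits _ q) e))))) =
        ((D * distScale L b : ℝ) : ℂ) := by
  have h0 : ∀ i, 0 < ‖row S i‖ := fun i => zero_lt_one.trans_le (H.one_le_norm i)
  choose X hXκ hX using H.access.norm_map
  have hη : 0 < η := H.eps_pos.trans_le H.eps_le
  set s := √η with hs
  have hs0 : 0 < s := Real.sqrt_pos.mpr hη
  have hs2 : s ^ 2 = η := Real.sq_sqrt hη.le
  have hnorm : ∀ i, ‖row S i‖ ≤ s := fun i => Real.le_sqrt_of_sq_le (H.norm_sq_le i)
  have hκ0 : 0 ≤ κ := (abs_nonneg _).trans (hXκ p)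
  -- hence the written norms are at most `2 * s`, and their relevant bits are the `b` low ones
  have hκs : 16 * κ ≤ s := by
    refine le_of_mul_le_mul_right ((H.kappa.trans H.eps_le).trans_eq ?_) hs0
    rw [← pow_two, hs2]
  have hlt : ∀ i, bitsVal (X i) < 2 ^ b := by
    intro i
    rcases hb' with rfl | hb'
    · exact bitsVal_lt _
    · have h1 : (bitsVal (X i) : ℝ) / 2 ^ L.normFrac ≤ 2 * s := by
        linarith [(abs_le.mp (hXκ i)).2, hnorm i]
      rw [div_le_iff₀ (by positivity)] at h1
      exact_mod_cast h1.trans_lt hb'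
  set t := inner ℝ (row S p) (row S q) / (‖row S p‖ * ‖row S q‖) with ht
  set y : Fin n → ℝ := fun i => (bitsVal (X i) : ℝ) / 2 ^ L.normFrac with hy
  refine ⟨y p ^ 2 - 2 * (y p * y q * t) + y q ^ 2, ?_, fun e => ?_⟩
  · rw [dist_sq_eq h0]
    refine (abs_sqDist_sub_le (hXκ p) (hXκ q) (abs_real_inner_div_norm_mul_norm_le_one _ _)
      (s := s) ?_ ?_).trans ?_
    · rw [abs_of_pos (h0 p)]; exact hnorm p
    · rw [abs_of_pos (h0 q)]; exact hnorm q
    · have := H.kappa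
      nlinarith
  · rw [inner_prep H.access hb p q e hX hlt]
    congr 1
    rw [expectation_eq h0 p q fun i => (bitsVal (X i) : ℝ), distScale, ← ht]
    simp only [hy]
    field_simp

/-- The squared distance of a resolved pair is at distance at least `ε` from the threshold. -/
theorem Resolved.gap {S : Matrix (Fin n) (Fin d) ℝ} {dmin ε : ℝ} {p q : Fin n}
    (h : Resolved S dmin ε p q) (hε : 0 < ε) :
    (dist (row S p) (row S q) ^ 2 ≤ dmin ^ 2 → dist (row S p) (row S q) ^ 2 + ε ≤ dmin ^ 2) ∧
    (dmin ^ 2 < dist (row S p) (row S q) ^ 2 → dmin ^ 2 ≤ dist (row S p) (row S q) ^ 2 - ε) := by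
  constructor
  · intro hle
    refine (h _ ?_).mpr hle
    rw [add_sub_cancel_left, abs_of_pos hε]
  · intro hlt
    by_contra! hcon
    refine hlt.not_ge ((h (dist (row S p) (row S q) ^ 2 - ε) ?_).mp hcon.le)
    rw [sub_sub_cancel_left, abs_neg, abs_of_pos hε]

/-- The final state is near the ideal one, if the signal amplitudes are small on the respective
sides of the scaled threshold. -/
theorem GoodAccess.norm_sub_le {S : Matrix (Fin n) (Fin d) ℝ} {κ T ε η dmin δ : ℝ}
    {O : Oracles (L.width n d)} (H : GoodAccess L S κ T O ε η) (hb : b ≤ L.normBits)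
    (hb₁ : (2 : ℝ) ^ b ≤ 4 * √η * 2 ^ L.normFrac)
    (hb₂ : b = L.normBits ∨ 2 * √η * 2 ^ L.normFrac < 2 ^ b) (hd : 0 < dmin)
    {M₀ : Matrix.unitaryGroup Bool ℂ} {Ms : List (Matrix.unitaryGroup Bool ℂ)}
    (hT : ∀ z : ℂ, ‖z‖ = 1 → dmin ^ 2 * distScale L b + ε / (256 * η) ≤ z.re →
      ‖signalAmp M₀ Ms z true‖ ≤ δ)
    (hF : ∀ z : ℂ, ‖z‖ = 1 → z.re ≤ dmin ^ 2 * distScale L b - ε / (256 * η) →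
      ‖signalAmp M₀ Ms z false‖ ≤ δ) (hδ : 0 ≤ δ) {p q : Fin n}
    (hpq : p = q ∨ Resolved S dmin ε p q) :
    ‖(similarityProg hb M₀ Ms).sem O (ket (conf (baseVal (natBits _ p) (natBits _ q) false))) -
      ket (if adjacencyBit S dmin p q then
        flipBit (wr .out) (conf (baseVal (natBits _ p) (natBits _ q) false))
        else conf (baseVal (natBits _ p) (natBits _ q) false))‖ ≤ 4 * δ := by
  obtain ⟨D, hD, hu⟩ := H.exists_expectation hb hb₂ p q
  obtain ⟨heq, hne⟩ := sem_similarityProg O hb M₀ Ms p q (hu _)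
  by_cases h : p = q
  · have hadj : adjacencyBit S dmin p q = false := by simp [adjacencyBit, h]
    rw [heq h, hadj, if_neg (by simp), sub_self, norm_zero]
    positivity
  have hη : 0 < η := H.eps_pos.trans_le H.eps_le
  -- the scale is at least `1 / (64 η)`, since the norms are at most `√η`
  have hscale : 1 / (64 * η) ≤ distScale L b := by
    have h1 : ((2 : ℝ) ^ b) ^ 2 ≤ (4 * √η * 2 ^ L.normFrac) ^ 2 := by gcongr
    rw [mul_pow, mul_pow, Real.sq_sqrt hη.le] at h1
    rw [distScale, div_le_div_iff₀ (by positivity) (by positivity)]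
    linarith
  have hgap : ε / (256 * η) ≤ 31 / 64 * ε * distScale L b := by
    calc ε / (256 * η) ≤ 31 / 64 * ε * (1 / (64 * η)) := by
          rw [div_le_iff₀ (by positivity)]
          have : 31 / 64 * ε * (1 / (64 * η)) * (256 * η) = 31 / 16 * ε := by
            field_simp
            ring
          linarith [H.eps_pos]
      _ ≤ _ := mul_le_mul_of_nonneg_left hscale (by linarith [H.eps_pos])
  have hs0 : 0 < distScale L b := lt_of_lt_of_le (by positivity) hscale
  obtain ⟨hlo, hhi⟩ := (hpq.resolve_left h).gap H.eps_pos
  rw [abs_le] at hD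
  rcases le_or_gt (dist (row S p) (row S q) ^ 2) (dmin ^ 2) with hle | hlt
  · have hadj : adjacencyBit S dmin p q = true := by
      rw [adjacencyBit, decide_eq_true_eq]
      exact ⟨h, le_of_sq_le_sq hle hd.le⟩
    rw [hadj, if_pos rfl]
    refine (hne h δ).2 fun z hz hzu => hF z hz ?_
    rw [hzu]
    have : (D + 31 / 64 * ε) * distScale L b ≤ dmin ^ 2 * distScale L b :=
      mul_le_mul_of_nonneg_right (by linarith [hlo hle, hD.2]) hs0.le
    linarith
  · have hadj : adjacencyBit S dmin p q = false := by
      rw [adjacencyBit, decide_eq_false_iff_not]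
      rintro ⟨-, hle⟩
      exact hlt.not_ge (by gcongr)
    rw [hadj, if_neg (by simp)]
    refine (hne h δ).1 fun z hz hzu => hT z hz ?_
    rw [hzu]
    have : (dmin ^ 2 + 31 / 64 * ε) * distScale L b ≤ D * distScale L b :=
      mul_le_mul_of_nonneg_right (by linarith [hhi hlt, hD.1]) hs0.le
    linarith

/-- Each part of the algorithm uses a bounded number of calls, and a number of gates that is linear
in the number of qubits of the black boxes, which is at most `T`. -/
theorem time_similarityProg_le (hb : b ≤ L.normBits) (M₀ : Matrix.unitaryGroup Bool ℂ)
    (Ms : List (Matrix.unitaryGroup Bool ℂ)) {T : ℝ} (hn : 1 ≤ idxWidth n)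
    (hT : ∀ o, (L.width n d o : ℝ) ≤ T) :
    (similarityProg hb M₀ Ms : Prog (L.width n d) (wireCount n d L b)).time T ≤
      (707 + 928 * Ms.length) * T := by
  have h1 : ((idxWidth n + idxWidth d + L.rowWork : ℕ) : ℝ) ≤ T := hT .row
  have h2 : ((idxWidth n + L.normBits + L.normWork : ℕ) : ℝ) ≤ T := hT .norm
  have h3 : (Fintype.card (Work n d L b) : ℝ) ≤ _ :=
    Nat.cast_le.mpr (card_work_le (n := n) (d := d) (L := L) (b := b))
  have h4 : (1 : ℝ) ≤ idxWidth n := by exact_mod_cast hn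
  have h5 : (b : ℝ) ≤ L.normBits := by exact_mod_cast hb
  push_cast at h1 h2 h3
  have p1 : (0 : ℝ) ≤ idxWidth d := Nat.cast_nonneg _
  have p2 : (0 : ℝ) ≤ L.rowWork := Nat.cast_nonneg _
  have p3 : (0 : ℝ) ≤ L.normBits := Nat.cast_nonneg _
  have p4 : (0 : ℝ) ≤ L.normWork := Nat.cast_nonneg _
  have p5 : (0 : ℝ) ≤ b := Nat.cast_nonneg _
  have hprep : (prep hb : Prog (L.width n d) (wireCount n d L b)).time T ≤ 135 * T := by
    rw [time_prep]; linarith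
  have hrefl : (reflect : Prog (L.width n d) (wireCount n d L b)).time T ≤ 192 * T := by
    rw [time_reflect]; linarith
  have heq : (eqProg : Prog (L.width n d) (wireCount n d L b)).time T ≤ 215 * T := by
    rw [time_eqProg]; linarith
  have hsig : Prog.time T (signalProg (walk (prep hb) reflect decSign) (wr (.aux .eq))
      (wr (.aux .sig)) (by simp) M₀ Ms : Prog (L.width n d) (wireCount n d L b)) ≤
      1 + Ms.length * (464 * T) := by
    rw [signalProg, Prog.time_cons, signalRot, time_rot]
    refine add_le_add le_rfl (Prog.time_flatMap_le _ _ _ _ fun M => ?_)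
    rw [Prog.time_append, walk, Prog.time_append, Prog.time_append, Prog.time_append,
      Prog.time_inv, decSign, ctrlSignOp, Prog.time_cons, Prog.time_cons, signalRot, time_rot,
      time_rot, Prog.time_nil]
    linarith
  rw [similarityProg, copyDecision, decProg]
  simp only [Prog.time_append, Prog.time_inv, Prog.time_cons, Prog.time_nil, time_cl]
  linarith

end

section

open ComplexConjugate

/-! ### Norm bounds and the output state -/

variable {n d : ℕ} {L : AccessLayout} {b : ℕ}

theorem norm_bounds [Nonempty (Fin n)] {S : Matrix (Fin n) (Fin d) ℝ} {η : ℝ}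
    (hS : (⨅ i, ‖row S i‖) = 1) (hη : eta S ≤ η) :
    (∀ i, 1 ≤ ‖row S i‖) ∧ ∀ i, ‖row S i‖ ^ 2 ≤ η := by
  have h1 : ∀ i, 1 ≤ ‖row S i‖ := fun i => hS ▸ ciInf_le (Set.finite_range _).bddBelow i
  obtain ⟨i₀, hi₀⟩ := exists_eq_ciInf_of_finite (f := fun i => ‖row S i‖)
  have h2 : (⨅ i, ‖row S i‖ ^ 2) = 1 := by
    refine le_antisymm ((ciInf_le (Set.finite_range _).bddBelow i₀).trans ?_)
      (le_ciInf fun i => one_le_pow₀ (h1 i))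
    rw [hi₀, hS, one_pow]
  rw [eta, h2, div_one] at hη
  exact ⟨h1, fun i =>
    (le_ciSup (f := fun i => ‖row S i‖ ^ 2) (Set.finite_range _).bddAbove i).trans hη⟩

theorem log_eight_div_le {δ : ℝ} (hδ : 0 < δ) (hδ1 : δ ≤ 1) :
    Real.log (2 / (δ / 4)) ≤ 3 * Real.log (2 / δ) := by
  have h : 2 / (δ / 4) = 2 ^ 3 / δ := by field_simp; norm_num
  rw [h, Real.log_div (by norm_num) hδ.ne', Real.log_div (by norm_num) hδ.ne', Real.log_pow]
  push_cast
  linarith [Real.log_nonpos hδ.le hδ1]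

theorem half_le_ratio_mul_log {δ r : ℝ} (hδ : 0 < δ) (hδ1 : δ ≤ 1) (hr : 1 ≤ r) :
    1 / 2 ≤ r * Real.log (2 / δ) := by
  have h : 1 / 2 ≤ Real.log (2 / δ) := by
    have : Real.log 2 ≤ Real.log (2 / δ) := by
      refine Real.log_le_log (by norm_num) ?_
      rw [le_div_iff₀ hδ]
      linarith
    linarith [Real.log_two_gt_d9]
  nlinarith

/-- The algorithm performs the required map on all index pairs that are resolved. -/
theorem exists_output_state {S : Matrix (Fin n) (Fin d) ℝ} {κ T ε η dmin δ : ℝ}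
    {O : Oracles (L.width n d)} (H : GoodAccess L S κ T O ε η) (hb : b ≤ L.normBits)
    (hb₁ : (2 : ℝ) ^ b ≤ 4 * √η * 2 ^ L.normFrac)
    (hb₂ : b = L.normBits ∨ 2 * √η * 2 ^ L.normFrac < 2 ^ b) (hd : 0 < dmin)
    {M₀ : Matrix.unitaryGroup Bool ℂ} {Ms : List (Matrix.unitaryGroup Bool ℂ)}
    (hT : ∀ z : ℂ, ‖z‖ = 1 → dmin ^ 2 * distScale L b + ε / (256 * η) ≤ z.re →
      ‖signalAmp M₀ Ms z true‖ ≤ δ)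
    (hF : ∀ z : ℂ, ‖z‖ = 1 → z.re ≤ dmin ^ 2 * distScale L b - ε / (256 * η) →
      ‖signalAmp M₀ Ms z false‖ ≤ δ) (hδ : 0 ≤ δ) (p q : Fin n) :
    ∃ φ : QState (1 + auxCount n d L b),
      Circuit.run O (similarityProg hb M₀ Ms).circ (tensor (tensor (idxKet p) (idxKet q))
          (tensor (zeroKet 1) (zeroKet (auxCount n d L b)))) =
        tensor (tensor (idxKet p) (idxKet q)) φ ∧
      (p = q ∨ Resolved S dmin ε p q →
        ‖φ - tensor (ket fun _ => adjacencyBit S dmin p q) (zeroKet (auxCount n d L b))‖ ≤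
          4 * δ) := by
  set x := natBits (idxWidth n) p with hx
  set y := natBits (idxWidth n) q with hy
  have hstart : tensor (tensor (idxKet p) (idxKet q))
      (tensor (zeroKet 1) (zeroKet (auxCount n d L b))) = ket (conf (baseVal x y false)) :=
    tensor_base x y false
  set ψ := (similarityProg hb M₀ Ms).sem O (ket (conf (baseVal x y false))) with hψ
  have hfix : ∀ i, FixedAt (Fin.castAdd (1 + auxCount n d L b) i) (Fin.append x y i) ψ := by
    intro i
    refine Fin.addCases (fun i => ?_) (fun i => ?_) i
    · have := fixedAt_similarityProg O hb M₀ Ms (a := .p i) (Or.inl ⟨i, rfl⟩)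
        (conf (baseVal x y false))
      rw [conf_wr] at this
      rwa [Fin.append_left]
    · have := fixedAt_similarityProg O hb M₀ Ms (a := .q i) (Or.inr ⟨i, rfl⟩)
        (conf (baseVal x y false))
      rw [conf_wr] at this
      rwa [Fin.append_right]
  have hprod := eq_tensor_of_fixedAt (Fin.append x y) ψ hfix
  generalize (WithLp.toLp 2 fun z => ψ (Fin.append (Fin.append x y) z) :
    QState (1 + auxCount n d L b)) = φ at hprod
  refine ⟨φ, ?_, fun hpq => ?_⟩
  · rw [hstart, idxKet, idxKet, tensor_ket_ket, ← hprod]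
    rfl
  · rw [← norm_tensor_ket (Fin.append x y), tensor_sub, ← hprod, ← tensor_ket_ket, tensor_base]
    exact H.norm_sub_le hb hb₁ hb₂ hd hT hF hδ hpq

/-- With at most one data point there is nothing to do. -/
theorem run_nil_of_subsingleton [Subsingleton (Fin n)] (S : Matrix (Fin n) (Fin d) ℝ)
    (dmin δ : ℝ) (hδ : 0 < δ) (O : Oracles (L.width n d)) (p q : Fin n) :
    ∃ φ : QState (1 + 0),
      Circuit.run O [] (tensor (tensor (idxKet p) (idxKet q)) (tensor (zeroKet 1) (zeroKet 0))) =
        tensor (tensor (idxKet p) (idxKet q)) φ ∧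
      ‖φ - tensor (ket fun _ => adjacencyBit S dmin p q) (zeroKet 0)‖ ≤ δ := by
  refine ⟨tensor (zeroKet 1) (zeroKet 0), run_nil O _, ?_⟩
  have hadj : adjacencyBit S dmin p q = false := by
    simp [adjacencyBit, Subsingleton.elim p q]
  rw [hadj, zeroKet, sub_self, norm_zero]
  exact hδ.le

end

end QSim

end

theorem mainTheorem4 :
    ∃ C : ℝ, 0 < C ∧
      ∀ (n d : ℕ) (L : QSim.AccessLayout) (dmin ε η δ : ℝ),
        0 < dmin → 0 < ε → ε ≤ η → 0 < δ → δ ≤ 1 →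
        ∃ (m : ℕ) (c : QSim.Circuit (L.width n d)
            (QSim.idxWidth n + QSim.idxWidth n + (1 + m))),
          ∀ (S : Matrix (Fin n) (Fin d) ℝ) (κ T : ℝ) (O : QSim.Oracles (L.width n d)),
            (⨅ i, ‖QSim.row S i‖) = 1 → QSim.eta S ≤ η → 16 * κ * √η ≤ ε →
            QSim.QuantumAccess L S κ T O →
            QSim.Circuit.time T c ≤ C * (T * (η / ε) * Real.log (2 / δ)) ∧
            ∀ p q : Fin n, ∃ φ : QSim.QState (1 + m),
              QSim.Circuit.run O c
                  (QSim.tensor (QSim.tensor (QSim.idxKet p) (QSim.idxKet q))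
                    (QSim.tensor (QSim.zeroKet 1) (QSim.zeroKet m))) =
                QSim.tensor (QSim.tensor (QSim.idxKet p) (QSim.idxKet q)) φ ∧
              (p = q ∨ QSim.Resolved S dmin ε p q →
                ‖φ - QSim.tensor (QSim.ket fun _ => QSim.adjacencyBit S dmin p q)
                    (QSim.zeroKet m)‖ ≤ δ) := by
  obtain ⟨C, hC, hstep⟩ := QSim.exists_step_pair
  refine ⟨1414 + 712704 * C, by positivity, fun n d L dmin ε η δ hd hε hεη hδ hδ1 => ?_⟩
  have hη0 : 0 < η := hε.trans_le hεη
  have hlog : 0 ≤ Real.log (2 / δ) := Real.log_nonneg (by rw [le_div_iff₀ hδ]; linarith)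
  by_cases hn : 2 ≤ n ∧ 1 ≤ η
  · obtain ⟨hn, hη⟩ := hn
    have hne : Nonempty (Fin n) := ⟨⟨0, by omega⟩⟩
    have hs1 : 1 ≤ √η := Real.one_le_sqrt.mpr hη
    have hf1 : (1 : ℝ) ≤ 2 ^ L.normFrac := one_le_pow₀ one_le_two
    -- a written norm is at most `2 * √η`, an integer multiple of `2 ^ (-normFrac)`
    obtain ⟨b, hb, hb₁, hb₂⟩ := QSim.exists_bit_count
      (s := 2 * √η * 2 ^ L.normFrac) (by nlinarith) L.normBits
    have hγ1 : ε / (256 * η) ≤ 1 := by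
      rw [div_le_one (by positivity)]
      linarith
    -- precision `δ / 4`: splitting into eigencomponents and copying each lose a factor `2`
    obtain ⟨K, P, Q, hK, hP, hQ, hPQ, hsmall⟩ := hstep (ε / (256 * η))
      (dmin ^ 2 * QSim.distScale L b) (δ / 4) (by positivity) hγ1 (by positivity) (by linarith)
    obtain ⟨M₀, Ms, hlen, hamp⟩ := QSim.exists_signalAmp K P Q hP hQ hPQ
    refine ⟨QSim.auxCount n d L b, (QSim.similarityProg hb M₀ Ms).circ, ?_⟩
    intro S κ T O hS heta hκ hO
    obtain ⟨h1, h2⟩ := QSim.norm_bounds hS heta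
    refine ⟨?_, fun p q => ?_⟩
    · have hw : 1 ≤ QSim.idxWidth n := Nat.clog_pos (by norm_num) hn
      have htime := QSim.time_similarityProg_le (d := d) hb M₀ Ms hw hO.width_le
      have hT : 0 ≤ T := (Nat.cast_nonneg _).trans (hO.width_le .row)
      rw [hlen] at htime
      refine htime.trans ?_
      have hr : 1 ≤ η / ε := by rwa [one_le_div hε]
      have hX := QSim.half_le_ratio_mul_log hδ hδ1 hr
      -- the degree of the step polynomials
      have hK' : (K : ℝ) ≤ 768 * C * (η / ε * Real.log (2 / δ)) := by
        calc (K : ℝ) ≤ C * (1 / (ε / (256 * η)) * Real.log (2 / (δ / 4))) := hK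
          _ ≤ C * (1 / (ε / (256 * η)) * (3 * Real.log (2 / δ))) := by
            gcongr
            exact QSim.log_eight_div_le hδ hδ1
          _ = 768 * C * (η / ε * Real.log (2 / δ)) := by
            rw [one_div_div]
            ring
      calc (707 + 928 * (K : ℝ)) * T
          ≤ (1414 * (η / ε * Real.log (2 / δ)) +
              928 * (768 * C * (η / ε * Real.log (2 / δ)))) * T := by
            refine mul_le_mul_of_nonneg_right ?_ hT
            linarith
        _ = (1414 + 712704 * C) * (T * (η / ε) * Real.log (2 / δ)) := by ring
    · obtain ⟨φ, hφ, hφ'⟩ := QSim.exists_output_state (δ := δ / 4)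
        ⟨hO, h1, h2, hκ, hε, hεη⟩ hb (by linarith)
        hb₂ hd (M₀ := M₀) (Ms := Ms)
        (fun z hz hzu => by rw [hamp z]; exact (hsmall z hz).1 hzu)
        (fun z hz hzu => by rw [hamp z]; exact (hsmall z hz).2 hzu) (by positivity) p q
      exact ⟨φ, hφ, fun hpq => (hφ' hpq).trans_eq (by ring)⟩
  · -- `η < 1` admits no data matrix at all, and `n ≤ 1` only pairs of equal indices
    refine ⟨0, [], fun S κ T O hS heta hκ hO => ?_⟩
    have hT : 0 ≤ T := (Nat.cast_nonneg _).trans (hO.width_le .row)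
    refine ⟨?_, fun p q => ?_⟩
    · rw [QSim.Circuit.time, List.map_nil, List.sum_nil]
      positivity
    · have hne : Nonempty (Fin n) := ⟨p⟩
      have hη : 1 ≤ η := by
        obtain ⟨h1, h2⟩ := QSim.norm_bounds hS heta
        exact (one_le_pow₀ (h1 p)).trans (h2 p)
      have hn1 : n ≤ 1 := by
        by_contra hn1
        exact hn ⟨by omega, hη⟩
      have : Subsingleton (Fin n) := Fin.subsingleton_iff_le_one.mpr hn1
      obtain ⟨φ, hφ, hφ'⟩ := QSim.run_nil_of_subsingleton S dmin δ hδ O p q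
      exact ⟨φ, hφ, fun _ => hφ'⟩
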